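/- Let $n\ge 2$ and let $(M,\mathcal Q)$ be an almost para-quaternionic manifold of dimension $2n$: $\mathcal Q\subset\operatorname{End}(TM)$ is a rank $3$ subbundle locally spanned by smooth $I,J,K$ with $I^2=J^2=\operatorname{id}$, $K=IJ=-JI$. Put $G=PGL(2+n,\mathbb R)$, $\mathfrak g=\mathfrak{sl}(2+n,\mathbb R)=\mathfrak{gl}(2+n,\mathbb R)/\mathbb R$, let $P\subset G$ be the stabilizer of the plane spanned by the first two basis vectors, and let $(\mathcal G\to M,\omega)$ be a normal Cartan geometry of type $G/P$ which induces $\mathcal Q$, that is, every $u\in\mathcal G$ identifies $\mathcal Q_x\subset\operatorname{End}(T_xM)$ with the set of the endomorphisms $X\mapsto X\circ S$ of $\mathfrak g/\mathfrak p\cong\mathfrak g_{-1}=\operatorname{Hom}(\mathbb R^2,\mathbb R^n)$, $S\in\mathfrak{sl}(2,\mathbb R)$. Let $\varepsilon\in\{-1,0,1\}$ and let $\mathcal Z^\varepsilon=\{A\in\mathcal Q: A\ne 0,\ A\circ A=\varepsilon\operatorname{id}\}$ be the $\varepsilon$-twistor space, a submanifold of $\operatorname{End}(TM)$. Choose $j\in\mathfrak{sl}(2,\mathbb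 R)$, $j\ne0$, with $j^2=\varepsilon\operatorname{id}$, and let $R\subset P$ be the stabilizer of $X\mapsto X\circ j$ and $\mathfrak r$ its Lie algebra. The map sending $u\in\mathcal G$ to the endomorphism of $TM$ which corresponds under $u$ to $X\mapsto X\circ j$ identifies $\mathcal G/R$ with $\mathcal Z^\varepsilon$, and so $\omega$ identifies $T\mathcal Z^\varepsilon$ with $\mathcal G\times_R(\mathfrak g/\mathfrak r)$. Under this identification: * there is a unique endomorphism field $\mathcal J^\varepsilon$ of $T\mathcal Z^\varepsilon$ (the canonical almost $\varepsilon$-complex structure) given by the endomorphism $A\mapsto A\begin{pmatrix}j&0\\0&0\end{pmatrix}$ of $\mathfrak g/\mathfrak r$; * there is a unique field $\mathcal T$ of bilinear maps $T\mathcal Z^\varepsilon\times T\mathcal Z^\varepsilon\to T\mathcal Z^\varepsilon$ (the torsion of the Cartan connection $\omega$ over $\mathcal Z^\varepsilon$) given at $u\in\mathcal G$ by $(X,Y)\mapsto[X,Y]-\omega\big([\omega^{-1}(X),\omega^{-1}(Y)](u)\big)\bmod\mathfrak r$; * the Nijenhuis tensor $N(\xi,\eta)=-\mathcal J^2[\xi,\eta]-[\mathcal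 J\xi,\mathcal J\eta]+\mathcal J[\mathcal J\xi,\eta]+\mathcal J[\xi,\mathcal J\eta]$ of $\mathcal J=\mathcal J^\varepsilon$ is a non-zero constant multiple of the $(0,2)$-part of $\mathcal T$ with respect to $\mathcal J^\varepsilon$: $$N=c_\varepsilon\,\mathcal T^{0,2},\qquad c_1=4,\quad c_0=c_{-1}=-4.$$ Here the $(0,2)$-part of a bilinear map $\varphi$ with respect to $A$ with $A^2=-s\operatorname{id}$ is $$\varphi^{0,2}(X,Y)=\tfrac1{4s}\big(s\,\varphi(X,Y)-\varphi(AX,AY)+A\varphi(AX,Y)+A\varphi(X,AY)\big)\quad(s\neq0),$$ $$\varphi^{0,2}(X,Y)=\tfrac14\big(-\varphi(AX,AY)+A\varphi(AX,Y)+A\varphi(X,AY)\big)\quad(s=0),$$ and for $A=\mathcal J^\varepsilon$ one has $s=-\varepsilon$. -/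

import Mathlib

open Bundle
open scoped Manifold ContDiff Matrix.Norms.Operator

noncomputable section

namespace Paraquat

/-! ### Linear algebra of `𝔤 = 𝔰𝔩(2 + n, ℝ)` and of the parabolic subgroup -/

/-- Real square matrices of size `2 + n`, written in blocks of sizes `2` and `n`. -/
abbrev Mat (n : ℕ) : Type := Matrix (Fin 2 ⊕ Fin n) (Fin 2 ⊕ Fin n) ℝ

/-- The Lie algebra `𝔤 = 𝔰𝔩(2 + n, ℝ)` of `G = PGL(2 + n, ℝ)`: the trace-free matrices. -/
def Sl (n : ℕ) : Type := LinearMap.ker (Matrix.traceLinearMap (Fin 2 ⊕ Fin n) ℝ ℝ)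

instance (n : ℕ) : NormedAddCommGroup (Sl n) :=
  inferInstanceAs (NormedAddCommGroup (LinearMap.ker (Matrix.traceLinearMap (Fin 2 ⊕ Fin n) ℝ ℝ)))

instance (n : ℕ) : NormedSpace ℝ (Sl n) :=
  inferInstanceAs (NormedSpace ℝ (LinearMap.ker (Matrix.traceLinearMap (Fin 2 ⊕ Fin n) ℝ ℝ)))

instance (n : ℕ) : FiniteDimensional ℝ (Sl n) :=
  inferInstanceAs
    (FiniteDimensional ℝ (LinearMap.ker (Matrix.traceLinearMap (Fin 2 ⊕ Fin n) ℝ ℝ)))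

/-- The inclusion of `𝔰𝔩(2 + n)` into the matrices. -/
def toMat {n : ℕ} : Sl n →ₗ[ℝ] Mat n :=
  (LinearMap.ker (Matrix.traceLinearMap (Fin 2 ⊕ Fin n) ℝ ℝ)).subtype

/-- A trace-free matrix as an element of `𝔰𝔩(2 + n)`. -/
def Sl.mk {n : ℕ} (A : Mat n) (hA : A.trace = 0) : Sl n := ⟨A, hA⟩

@[simp] lemma toMat_mk {n : ℕ} (A : Mat n) (hA : A.trace = 0) : toMat (Sl.mk A hA) = A := rfl

@[simp] lemma trace_toMat {n : ℕ} (X : Sl n) : (toMat X).trace = 0 := X.2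

lemma toMat_injective {n : ℕ} : Function.Injective (toMat (n := n)) := Subtype.val_injective

/-- The algebra of block upper triangular matrices. -/
def blockUpperSubalgebra (n : ℕ) : Subalgebra ℝ (Mat n) where
  carrier := {a | a.toBlocks₂₁ = 0}
  mul_mem' := by
    intro a b ha hb
    simp only [Set.mem_ofPred_eq] at ha hb ⊢
    rw [← Matrix.fromBlocks_toBlocks a, ← Matrix.fromBlocks_toBlocks b,
      Matrix.fromBlocks_multiply, Matrix.toBlocks_fromBlocks₂₁, ha, hb]
    simp
  add_mem' := by
    intro a b ha hb
    simp only [Set.mem_ofPred_eq] at ha hb ⊢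
    ext i j
    have h1 := congrFun (congrFun ha i) j
    have h2 := congrFun (congrFun hb i) j
    simp only [Matrix.toBlocks₂₁, Matrix.of_apply, Matrix.zero_apply, Matrix.add_apply] at *
    rw [h1, h2, add_zero]
  algebraMap_mem' := by
    intro r
    ext i j
    simp [Matrix.toBlocks₂₁, Matrix.algebraMap_matrix_apply]

/-- The normed algebra of block upper triangular matrices. -/
def BlockUpper (n : ℕ) : Type := blockUpperSubalgebra n

instance (n : ℕ) : NormedRing (BlockUpper n) :=
  inferInstanceAs (NormedRing (blockUpperSubalgebra n))

instance (n : ℕ) : NormedAlgebra ℝ (BlockUpper n) :=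
  inferInstanceAs (NormedAlgebra ℝ (blockUpperSubalgebra n))

instance (n : ℕ) : FiniteDimensional ℝ (BlockUpper n) :=
  inferInstanceAs (FiniteDimensional ℝ (blockUpperSubalgebra n))

instance (n : ℕ) : CompleteSpace (BlockUpper n) := FiniteDimensional.complete ℝ _

/-- The inclusion of the block upper triangular matrices into all matrices. -/
def blockMat {n : ℕ} : BlockUpper n →ₐ[ℝ] Mat n := (blockUpperSubalgebra n).val

/-- The Lie group of invertible block upper triangular matrices (the stabilizer in
`GL(2 + n, ℝ)` of the plane spanned by the first two basis vectors).  The parabolic subgroup `P` of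
`PGL(2 + n, ℝ)` is its quotient by the non-zero multiples of the identity. -/
abbrev ParabolicGL (n : ℕ) : Type := (BlockUpper n)ˣ

/-- The commutator of trace-free matrices. -/
def slBracket {n : ℕ} (X Y : Sl n) : Sl n :=
  Sl.mk (toMat X * toMat Y - toMat Y * toMat X) (by
    rw [Matrix.trace_sub, Matrix.trace_mul_comm, sub_self])

/-- The projection `𝔤𝔩(2 + n) → 𝔤𝔩(2 + n) / ℝ ≅ 𝔰𝔩(2 + n)`. -/
def traceFree {n : ℕ} : Mat n →ₗ[ℝ] Sl n :=
  LinearMap.codRestrict (LinearMap.ker (Matrix.traceLinearMap (Fin 2 ⊕ Fin n) ℝ ℝ))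
    (LinearMap.id - (LinearMap.toSpanSingleton ℝ (Mat n) (1 : Mat n)).comp
      (((n : ℝ) + 2)⁻¹ • Matrix.traceLinearMap (Fin 2 ⊕ Fin n) ℝ ℝ)) (by
    intro A
    have h2 : (n : ℝ) + 2 ≠ 0 := by positivity
    rw [LinearMap.mem_ker, Matrix.traceLinearMap_apply]
    simp only [LinearMap.sub_apply, LinearMap.id_apply, LinearMap.comp_apply, LinearMap.smul_apply,
      Matrix.traceLinearMap_apply, LinearMap.toSpanSingleton_apply, Matrix.trace_sub,
      Matrix.trace_smul, Matrix.trace_one, smul_eq_mul, Fintype.card_sum, Fintype.card_fin]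
    push_cast
    field_simp
    ring)

lemma toMat_traceFree {n : ℕ} (A : Mat n) :
    toMat (traceFree A) = A - (((n : ℝ) + 2)⁻¹ * A.trace) • (1 : Mat n) := rfl

/-- The inclusion `X ↦ (0 0; X 0)` of `𝔤₋₁ = ℝ^{2*} ⊗ ℝⁿ` into `𝔤`. -/
def gMinus (n : ℕ) : Matrix (Fin n) (Fin 2) ℝ →ₗ[ℝ] Sl n where
  toFun C := Sl.mk (Matrix.fromBlocks 0 0 C 0) (by
    simp [Matrix.trace, Fintype.sum_sum_type])
  map_add' C D := by
    apply toMat_injective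
    simp [Matrix.fromBlocks_add]
  map_smul' r C := by
    apply toMat_injective
    simp [Matrix.fromBlocks_smul]

/-- The endomorphism `X ↦ X ∘ S` of `ℝ^{2*} ⊗ ℝⁿ`, for a `2 × 2` matrix `S`. -/
def mulRightMat {n : ℕ} (S : Matrix (Fin 2) (Fin 2) ℝ) :
    Matrix (Fin n) (Fin 2) ℝ →ₗ[ℝ] Matrix (Fin n) (Fin 2) ℝ where
  toFun X := X * S
  map_add' X Y := Matrix.add_mul X Y S
  map_smul' r X := Matrix.smul_mul r X S

/-- For a `2 × 2` matrix `S`, the endomorphism of `𝔤` which is the right multiplication by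
`(S 0; 0 0)` in `𝔤𝔩(2 + n)` modulo multiples of the identity.
For an `ε`-complex structure `j`, the map `rightMul j` descends to the endomorphism
`(U *; X *) ↦ (U j *; X j *)` of `𝔤 / 𝔯`. -/
def rightMul {n : ℕ} (S : Matrix (Fin 2) (Fin 2) ℝ) : Sl n →ₗ[ℝ] Sl n :=
  traceFree ∘ₗ (LinearMap.mulRight ℝ (Matrix.fromBlocks S 0 0 0 : Mat n)) ∘ₗ toMat

/-! ### Almost para-quaternionic structures and twistor spaces -/

section Base

variable {n : ℕ} {M : Type*} [TopologicalSpace M] [ChartedSpace (EuclideanSpace ℝ (Fin (2 * n))) M]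

/-- Endomorphisms of a tangent space of a `2n`-dimensional manifold. -/
abbrev TEnd (n : ℕ) {M : Type*} [TopologicalSpace M]
    [ChartedSpace (EuclideanSpace ℝ (Fin (2 * n))) M] (x : M) : Type :=
  TangentSpace (𝓡 (2 * n)) x →L[ℝ] TangentSpace (𝓡 (2 * n)) x

/-- The total space of the vector bundle `End (TM)`. -/
abbrev EndBundle (n : ℕ) (M : Type*) [TopologicalSpace M]
    [ChartedSpace (EuclideanSpace ℝ (Fin (2 * n))) M] [IsManifold (𝓡 (2 * n)) ∞ M] : Type _ :=
  TotalSpace (EuclideanSpace ℝ (Fin (2 * n)) →L[ℝ] EuclideanSpace ℝ (Fin (2 * n)))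
    (fun x : M => TEnd n x)

/-- The model of the total space of `End (TM)`. -/
abbrev endModel (n : ℕ) := (𝓡 (2 * n)).prod
  𝓘(ℝ, EuclideanSpace ℝ (Fin (2 * n)) →L[ℝ] EuclideanSpace ℝ (Fin (2 * n)))

end Base

/-- An almost para-quaternionic structure on a `2n`-dimensional manifold: a subbundle of `End (TM)`
locally spanned by smooth `I, J, K` with `I² = J² = id` and `K = IJ = -JI`. -/
structure AlmostParaquaternionic (n : ℕ) (M : Type*) [TopologicalSpace M]
    [ChartedSpace (EuclideanSpace ℝ (Fin (2 * n))) M] [IsManifold (𝓡 (2 * n)) ∞ M] where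
  fiber : ∀ x : M, Submodule ℝ (TEnd n x)
  local_basis : ∀ x₀ : M, ∃ U : Set M, IsOpen U ∧ x₀ ∈ U ∧
    ∃ I J K : ∀ x : M, TEnd n x,
      ContMDiffOn (𝓡 (2 * n)) (endModel n) ∞ (fun x => (⟨x, I x⟩ : EndBundle n M)) U ∧
      ContMDiffOn (𝓡 (2 * n)) (endModel n) ∞ (fun x => (⟨x, J x⟩ : EndBundle n M)) U ∧
      ContMDiffOn (𝓡 (2 * n)) (endModel n) ∞ (fun x => (⟨x, K x⟩ : EndBundle n M)) U ∧
      ∀ x ∈ U, I x ∘L I x = ContinuousLinearMap.id ℝ _ ∧ J x ∘L J x = ContinuousLinearMap.id ℝ _ ∧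
        K x = I x ∘L J x ∧ K x = -(J x ∘L I x) ∧ fiber x = Submodule.span ℝ {I x, J x, K x}

/-- The `s`-twistor space: all non-zero `A ∈ Q` with `A ∘ A = s id` (only for `s = 0` is the
condition `A ≠ 0` a restriction), with the topology induced from `End (TM)`. -/
abbrev AlmostParaquaternionic.Twistor {n : ℕ} {M : Type*} [TopologicalSpace M]
    [ChartedSpace (EuclideanSpace ℝ (Fin (2 * n))) M] [IsManifold (𝓡 (2 * n)) ∞ M]
    (Q : AlmostParaquaternionic n M) (s : ℝ) : Type _ :=
  {p : EndBundle n M // p.2 ∈ Q.fiber p.1 ∧ p.2 ∘L p.2 = s • ContinuousLinearMap.id ℝ _ ∧ p.2 ≠ 0}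

/-! ### Cartan geometries of type `(PGL(2 + n, ℝ), P)` -/

/-- A Cartan geometry of type `G/P` over `M`, where `G = PGL(2 + n, ℝ)` and `P` is the stabilizer of
a plane.  The right action of `P` on the principal bundle `𝒢` is given as a right action of
`ParabolicGL n`, whose stabilizers are exactly the multiples of the identity. -/
structure CartanGeometry (n d : ℕ) (M 𝒢 : Type*) [TopologicalSpace M]
    [ChartedSpace (EuclideanSpace ℝ (Fin (2 * n))) M]
    [TopologicalSpace 𝒢] [ChartedSpace (EuclideanSpace ℝ (Fin d)) 𝒢] [IsManifold (𝓡 d) ∞ 𝒢] where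
  /-- the bundle projection -/
  proj : 𝒢 → M
  contMDiff_proj : ContMDiff (𝓡 d) (𝓡 (2 * n)) ∞ proj
  /-- the principal right action -/
  act : 𝒢 → ParabolicGL n → 𝒢
  contMDiff_act : ContMDiff ((𝓡 d).prod 𝓘(ℝ, BlockUpper n)) (𝓡 d) ∞
    (fun p : 𝒢 × ParabolicGL n => act p.1 p.2)
  act_one : ∀ u, act u 1 = u
  act_mul : ∀ u a b, act u (a * b) = act (act u a) b
  /-- the multiples of the identity act trivially, and the induced action of `P` is free -/
  act_eq_self_iff : ∀ u a, act u a = u ↔ ∃ c : ℝ, blockMat (a : BlockUpper n) = c • (1 : Mat n)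
  /-- the orbits are the fibers of the projection -/
  proj_eq_iff : ∀ u v, proj u = proj v ↔ ∃ a, v = act u a
  /-- there are local smooth sections, i.e. local trivializations -/
  exists_section : ∀ x₀ : M, ∃ U : Set M, IsOpen U ∧ x₀ ∈ U ∧ ∃ σ : M → 𝒢,
    ContMDiffOn (𝓡 (2 * n)) (𝓡 d) ∞ σ U ∧ ∀ x ∈ U, proj (σ x) = x
  /-- the Cartan connection -/
  conn : ∀ u : 𝒢, TangentSpace (𝓡 d) u ≃L[ℝ] Sl n
  contMDiff_conn : ContMDiff (𝓡 d).tangent 𝓘(ℝ, Sl n) ∞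
    (fun v : TangentBundle (𝓡 d) 𝒢 => conn v.1 v.2)
  /-- equivariance: `R_a^* ω = Ad(a⁻¹) ∘ ω` -/
  conn_act : ∀ (u : 𝒢) (a : ParabolicGL n) (v : TangentSpace (𝓡 d) u),
    toMat (conn (act u a) (mfderiv (𝓡 d) (𝓡 d) (fun u' => act u' a) u v)) =
      blockMat (a⁻¹ : ParabolicGL n) * toMat (conn u v) * blockMat a
  /-- `ω` reproduces the generators of the fundamental vector fields -/
  conn_fundamental : ∀ (u : 𝒢) (X : BlockUpper n), (blockMat X).trace = 0 →
    toMat (conn u (mfderiv 𝓘(ℝ, BlockUpper n) (𝓡 d) (act u) (1 : ParabolicGL n) X)) = blockMat X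

namespace CartanGeometry

variable {n d : ℕ} {M 𝒢 : Type*} [TopologicalSpace M]
  [ChartedSpace (EuclideanSpace ℝ (Fin (2 * n))) M] [IsManifold (𝓡 (2 * n)) ∞ M]
  [TopologicalSpace 𝒢] [ChartedSpace (EuclideanSpace ℝ (Fin d)) 𝒢] [IsManifold (𝓡 d) ∞ 𝒢]

section

variable (C : CartanGeometry n d M 𝒢)

/-- The constant vector field `ω⁻¹(X)`. -/
def constField (X : Sl n) (u : 𝒢) : TangentSpace (𝓡 d) u := (C.conn u).symm X

/-- The frame form of the Cartan curvature,
`κ_u(X, Y) = (dω + ω ∧ ω)(ω⁻¹(X), ω⁻¹(Y))(u) = [X, Y] - ω([ω⁻¹(X), ω⁻¹(Y)])(u)`. -/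
def curvature (u : 𝒢) (X Y : Sl n) : Sl n :=
  slBracket X Y - C.conn u (VectorField.mlieBracket (𝓡 d) (C.constField X) (C.constField Y) u)

/-- Normality `∂^* κ = 0`.  The elementary matrices `E_{ia} ∈ 𝔤₋₁` and `E_{ai} ∈ 𝔤₁` are dual bases
of `𝔤₋₁ ≅ 𝔤/𝔭` and `𝔤₁ = 𝔭₊` for the trace form, hence for the Killing form up to a factor. -/
def IsNormal : Prop :=
  ∀ (u : 𝒢) (Y : Sl n), ∑ i : Fin n, ∑ a : Fin 2,
    (let κ : Mat n := toMat (C.curvature u (gMinus n (Matrix.single i a 1)) Y)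
     let Z : Mat n := Matrix.single (Sum.inl a) (Sum.inr i) 1
     Z * κ - κ * Z) = 0

/-- The map `X ↦ T proj (ω⁻¹(X)(u))`, from `𝔤` onto the tangent space of `M`. -/
def toTangent (u : 𝒢) : Sl n →ₗ[ℝ] TangentSpace (𝓡 (2 * n)) (C.proj u) :=
  (mfderiv (𝓡 d) (𝓡 (2 * n)) C.proj u).toLinearMap ∘ₗ (C.conn u).symm.toLinearMap

/-- The map `toTangent` vanishes on `𝔭`. -/
lemma toTangent_of_blockUpper (u : 𝒢) (X : Sl n) (hX : toMat X ∈ blockUpperSubalgebra n) :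
    C.toTangent u X = 0 := by
  set X' : BlockUpper n := ⟨toMat X, hX⟩ with hX'
  have h1 : C.conn u (mfderiv 𝓘(ℝ, BlockUpper n) (𝓡 d) (C.act u) (1 : ParabolicGL n) X') = X :=
    toMat_injective (C.conn_fundamental u X' (trace_toMat X))
  have h2 : (C.conn u).symm X =
      mfderiv 𝓘(ℝ, BlockUpper n) (𝓡 d) (C.act u) (1 : ParabolicGL n) X' :=
    (C.conn u).symm_apply_eq.2 h1.symm
  have hact : ContMDiff 𝓘(ℝ, BlockUpper n) (𝓡 d) ∞ (C.act u) :=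
    C.contMDiff_act.comp (contMDiff_const.prodMk contMDiff_id)
  have hconst : C.proj ∘ C.act u = fun _ => C.proj u := by
    funext a
    exact ((C.proj_eq_iff u _).2 ⟨a, rfl⟩).symm
  have h3 := mfderiv_comp (I := 𝓘(ℝ, BlockUpper n)) (I' := 𝓡 d) (I'' := 𝓡 (2 * n))
    (1 : ParabolicGL n)
    ((C.contMDiff_proj _).mdifferentiableAt (by simp)) ((hact 1).mdifferentiableAt (by simp))
  rw [hconst, mfderiv_const] at h3
  have h4 := congrArg (fun L => L X') h3
  have h5 : ∀ v : 𝒢, v = u → ∀ w : EuclideanSpace ℝ (Fin d),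
      (mfderiv (𝓡 d) (𝓡 (2 * n)) C.proj v w : EuclideanSpace ℝ (Fin (2 * n))) =
      mfderiv (𝓡 d) (𝓡 (2 * n)) C.proj u w := by
    rintro v rfl w; rfl
  change mfderiv (𝓡 d) (𝓡 (2 * n)) C.proj u ((C.conn u).symm X) = 0
  rw [h2]
  exact (h5 _ (C.act_one u) _).symm.trans h4.symm

lemma mfderiv_proj_surjective (u : 𝒢) :
    Function.Surjective (mfderiv (𝓡 d) (𝓡 (2 * n)) C.proj u) := by
  obtain ⟨U, hU, hxU, σ, hσ, hσp⟩ := C.exists_section (C.proj u)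
  obtain ⟨a, ha⟩ := (C.proj_eq_iff (σ (C.proj u)) u).1 (hσp _ hxU)
  have hact : ContMDiff (𝓡 d) (𝓡 d) ∞ (fun v => C.act v a) :=
    C.contMDiff_act.comp (contMDiff_id.prodMk contMDiff_const)
  have hs : ContMDiffAt (𝓡 (2 * n)) (𝓡 d) ∞ (fun x => C.act (σ x) a) (C.proj u) :=
    (hact _).comp _ ((hσ _ hxU).contMDiffAt (hU.mem_nhds hxU))
  have hid : C.proj ∘ (fun x => C.act (σ x) a) =ᶠ[nhds (C.proj u)] id := by
    filter_upwards [hU.mem_nhds hxU] with x hx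
    exact ((C.proj_eq_iff (σ x) _).2 ⟨a, rfl⟩).symm.trans (hσp x hx)
  have h3 := mfderiv_comp (I := 𝓡 (2 * n)) (I' := 𝓡 d) (I'' := 𝓡 (2 * n)) (C.proj u)
    ((C.contMDiff_proj _).mdifferentiableAt (by simp)) (hs.mdifferentiableAt (by simp))
  rw [hid.mfderiv_eq, mfderiv_id] at h3
  have h5 : ∀ v : 𝒢, v = u → ∀ w : EuclideanSpace ℝ (Fin d),
      (mfderiv (𝓡 d) (𝓡 (2 * n)) C.proj v w : EuclideanSpace ℝ (Fin (2 * n))) =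
      mfderiv (𝓡 d) (𝓡 (2 * n)) C.proj u w := by
    rintro v rfl w; rfl
  intro w
  have h4 := congrArg (fun L => L w) h3
  exact ⟨_, (h5 _ ha.symm _).symm.trans h4.symm⟩

/-- The identification of `𝔤₋₁ ≅ 𝔤/𝔭` with a tangent space of `M` which is given by the Cartan
connection and a point of `𝒢`. -/
def tangentEquiv (u : 𝒢) :
    Matrix (Fin n) (Fin 2) ℝ ≃L[ℝ] TangentSpace (𝓡 (2 * n)) (C.proj u) :=
  have hsurj : Function.Surjective (C.toTangent u ∘ₗ gMinus n) := by
    intro w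
    obtain ⟨v, hv⟩ := C.mfderiv_proj_surjective u w
    have hX : C.toTangent u (C.conn u v) = w := by simp [toTangent, hv]
    refine ⟨(toMat (C.conn u v)).toBlocks₂₁, ?_⟩
    rw [← hX, ← sub_eq_zero, LinearMap.comp_apply, ← map_sub]
    apply C.toTangent_of_blockUpper
    change Matrix.toBlocks₂₁ _ = 0
    ext i j
    rw [map_sub]
    simp [gMinus, Matrix.toBlocks₂₁]
  have hrank : Module.finrank ℝ (Matrix (Fin n) (Fin 2) ℝ) =
      Module.finrank ℝ (TangentSpace (𝓡 (2 * n)) (C.proj u)) := by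
    change _ = Module.finrank ℝ (EuclideanSpace ℝ (Fin (2 * n)))
    simp [Module.finrank_matrix, mul_comm]
  haveI : FiniteDimensional ℝ (TangentSpace (𝓡 (2 * n)) (C.proj u)) :=
    inferInstanceAs (FiniteDimensional ℝ (EuclideanSpace ℝ (Fin (2 * n))))
  haveI : T2Space (TangentSpace (𝓡 (2 * n)) (C.proj u)) :=
    inferInstanceAs (T2Space (EuclideanSpace ℝ (Fin (2 * n))))
  (LinearEquiv.ofBijective (C.toTangent u ∘ₗ gMinus n)
    ⟨(LinearMap.injective_iff_surjective_of_finrank_eq_finrank hrank).2 hsurj,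
      hsurj⟩).toContinuousLinearEquiv

lemma tangentEquiv_apply (u : 𝒢) (X : Matrix (Fin n) (Fin 2) ℝ) :
    C.tangentEquiv u X = mfderiv (𝓡 d) (𝓡 (2 * n)) C.proj u (C.constField (gMinus n X) u) := rfl

/-- The endomorphism of `T_{proj u} M` which corresponds to the endomorphism `X ↦ X ∘ S` of
`𝔤₋₁ = ℝ^{2*} ⊗ ℝⁿ`, for a `2 × 2` matrix `S`. -/
def stdEnd (u : 𝒢) (S : Matrix (Fin 2) (Fin 2) ℝ) : TEnd n (C.proj u) :=
  (C.tangentEquiv u).toContinuousLinearMap ∘L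
    (LinearMap.toContinuousLinearMap (mulRightMat S)) ∘L
    (C.tangentEquiv u).symm.toContinuousLinearMap

/-- The Cartan geometry induces `Q`: at every point `u` of `𝒢`, it identifies the standard
para-quaternionic structure on `𝔤₋₁`, given by the trace-free `2 × 2` matrices, with `Q`. -/
def Induces (Q : AlmostParaquaternionic n M) : Prop :=
  ∀ (u : 𝒢) (A : TEnd n (C.proj u)),
    A ∈ Q.fiber (C.proj u) ↔ ∃ S : Matrix (Fin 2) (Fin 2) ℝ, S.trace = 0 ∧ A = C.stdEnd u S

lemma stdEnd_comp (u : 𝒢) (S S' : Matrix (Fin 2) (Fin 2) ℝ) :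
    C.stdEnd u S ∘L C.stdEnd u S' = C.stdEnd u (S' * S) := by
  ext v : 1
  simp [stdEnd, mulRightMat, Matrix.mul_assoc]

lemma stdEnd_smul_one (u : 𝒢) (s : ℝ) :
    C.stdEnd u (s • 1) = s • ContinuousLinearMap.id ℝ _ := by
  ext v : 1
  simp [stdEnd, mulRightMat]

lemma stdEnd_ne_zero (hn : 2 ≤ n) (u : 𝒢) {S : Matrix (Fin 2) (Fin 2) ℝ} (hS : S ≠ 0) :
    C.stdEnd u S ≠ 0 := by
  intro h
  apply hS
  ext a b
  have h1 := congrArg (fun L => L (C.tangentEquiv u (Matrix.single ⟨0, by omega⟩ a 1))) h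
  simp only [stdEnd, ContinuousLinearMap.comp_apply, ContinuousLinearEquiv.coe_coe,
    ContinuousLinearEquiv.symm_apply_apply, zero_apply,
    EmbeddingLike.map_eq_zero_iff] at h1
  have h2 := congrFun (congrFun h1 ⟨0, by omega⟩) b
  simpa [mulRightMat] using h2

end

end CartanGeometry

/-- A trace-free `ε`-complex structure on `ℝ²`, that is, an `ε`-complex structure on
`ℝ^{2*} ⊗ ℝⁿ` (acting by `X ↦ X ∘ j`) which belongs to the standard para-quaternionic structure. -/
structure EpsComplex (ε : ℝ) where
  mat : Matrix (Fin 2) (Fin 2) ℝ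
  trace_eq_zero : mat.trace = 0
  mul_self : mat * mat = ε • (1 : Matrix (Fin 2) (Fin 2) ℝ)
  ne_zero : mat ≠ 0

namespace CartanGeometry

section

variable {n d : ℕ} {M 𝒢 : Type*} [TopologicalSpace M]
  [ChartedSpace (EuclideanSpace ℝ (Fin (2 * n))) M] [IsManifold (𝓡 (2 * n)) ∞ M]
  [TopologicalSpace 𝒢] [ChartedSpace (EuclideanSpace ℝ (Fin d)) 𝒢] [IsManifold (𝓡 d) ∞ 𝒢]
  (C : CartanGeometry n d M 𝒢) {Q : AlmostParaquaternionic n M} (hn : 2 ≤ n) (hQ : C.Induces Q)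
  {ε : ℝ} (j : EpsComplex ε)

/-- The canonical projection `u ↦ [u, j]` from `𝒢` to the `ε`-twistor space, which identifies
the `ε`-twistor space with the quotient of `𝒢` by the stabilizer of `j` in `P`. -/
def twistorProj (u : 𝒢) : Q.Twistor ε :=
  ⟨⟨C.proj u, C.stdEnd u j.mat⟩, (hQ u _).2 ⟨j.mat, j.trace_eq_zero, rfl⟩,
    by rw [stdEnd_comp, j.mul_self, stdEnd_smul_one], C.stdEnd_ne_zero hn u j.ne_zero⟩

variable [ChartedSpace (EuclideanSpace ℝ (Fin (2 * n + 2))) (Q.Twistor ε)]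

/-- The map `X ↦ [u, X + 𝔯]` from `𝔤` onto a tangent space of the twistor space, i.e. the tangent
map of the projection from `𝒢` applied to `ω⁻¹(X)(u)`. -/
def toTwistorTangent (u : 𝒢) :
    Sl n →ₗ[ℝ] TangentSpace (𝓡 (2 * n + 2)) (C.twistorProj hn hQ j u) :=
  (mfderiv (𝓡 d) (𝓡 (2 * n + 2)) (C.twistorProj hn hQ j) u).toLinearMap ∘ₗ
    (C.conn u).symm.toLinearMap

/-- `J` is the canonical almost `ε`-complex structure on the `ε`-twistor space: its frame form
is the constant endomorphism `(U *; X *) ↦ (U j *; X j *)` of `𝔤 / 𝔯`. -/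
def IsCanonicalStructure
    (J : ∀ z : Q.Twistor ε,
      TangentSpace (𝓡 (2 * n + 2)) z →L[ℝ] TangentSpace (𝓡 (2 * n + 2)) z) : Prop :=
  ∀ (u : 𝒢) (X : Sl n),
    J (C.twistorProj hn hQ j u) (C.toTwistorTangent hn hQ j u X) =
      C.toTwistorTangent hn hQ j u (rightMul j.mat X)

/-- `T` is the torsion of the Cartan connection over the `ε`-twistor space: its frame form
is the Cartan curvature modulo `𝔯`. -/
def IsTwistorTorsion
    (T : ∀ z : Q.Twistor ε, TangentSpace (𝓡 (2 * n + 2)) z →L[ℝ]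
      TangentSpace (𝓡 (2 * n + 2)) z →L[ℝ] TangentSpace (𝓡 (2 * n + 2)) z) : Prop :=
  ∀ (u : 𝒢) (X Y : Sl n),
    T (C.twistorProj hn hQ j u) (C.toTwistorTangent hn hQ j u X)
        (C.toTwistorTangent hn hQ j u Y) =
      C.toTwistorTangent hn hQ j u (C.curvature u X Y)

end

end CartanGeometry

/-! ### The Nijenhuis tensor and the `(0,2)`-part -/

/-- The Nijenhuis tensor `N_A(ξ, η) = -A²[ξ, η] - [Aξ, Aη] + A[Aξ, η] + A[ξ, Aη]`. -/
def nijenhuis {E H : Type*} [NormedAddCommGroup E] [NormedSpace ℝ E] [TopologicalSpace H]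
    (I : ModelWithCorners ℝ E H) {Z : Type*} [TopologicalSpace Z] [ChartedSpace H Z]
    (A : ∀ z : Z, TangentSpace I z →L[ℝ] TangentSpace I z)
    (ξ η : ∀ z : Z, TangentSpace I z) (z : Z) : TangentSpace I z :=
  -(A z (A z (VectorField.mlieBracket I ξ η z)))
    - VectorField.mlieBracket I (fun w => A w (ξ w)) (fun w => A w (η w)) z
    + A z (VectorField.mlieBracket I (fun w => A w (ξ w)) η z)
    + A z (VectorField.mlieBracket I ξ (fun w => A w (η w)) z)

/-- The `(0,2)`-part of a bilinear map `φ` with respect to an endomorphism `A` such that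
`A² = -s id` (so `s` is `|A|²`), with the convention for `s = 0`. -/
def zeroTwoPart {W : Type*} [AddCommGroup W] [Module ℝ W] [TopologicalSpace W]
    [IsTopologicalAddGroup W] [ContinuousConstSMul ℝ W] (s : ℝ)
    (A : W →L[ℝ] W) (φ : W →L[ℝ] W →L[ℝ] W) (X Y : W) : W :=
  if s = 0 then (1 / 4 : ℝ) • (-φ (A X) (A Y) + A (φ (A X) Y) + A (φ X (A Y)))
  else (1 / (4 * s)) • (s • φ X Y - φ (A X) (A Y) + A (φ (A X) Y) + A (φ X (A Y)))

end Paraquat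

end

/-! Write `𝒵` for the twistor space, `p : 𝒢 → 𝒵` for `twistorProj`, `L_u = Tp ∘ ω_u⁻¹ : 𝔤 → T𝒵` for
`toTwistorTangent`, `e = (j 0; 0 0)` and `R = rightMul j.mat`, which is right multiplication by `e`
up to multiples of the identity.

Geometry. The map `p` is a surjective submersion, and the kernel of each `L_u` is exactly `𝔯`
(`toTwistorTangent_eq_zero_iff`): differentiating the conjugation action on `j` shows that the
kernel lies in `𝔯`, and equality follows by counting dimensions. Two points of `𝒢` over the same
point of `𝒵` differ by an `a` whose upper left block commutes with `j`. So a frame form descends to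
`𝒵` once it is compatible with such `a` and with adding elements of `𝔯`, everything modulo `𝔯`. For
`R` this is a computation with blocks (`rightMul_adj_sub_mem_isotropy`); for the curvature it is
equivariance (`curvature_act`) together with horizontality (`curvature_of_blockUpper`).

Formula. Near any `u₀` a smooth field `ξ` on `𝒵` has a smooth lift `f : 𝒢 → 𝔤`, that is, `L_u (f u)
= ξ (p u)` (`exists_lift`), and then `R f` lifts `𝒥ξ`. Brackets of `p`-related fields are
`p`-related, so `[ξ, η]` is represented by `D_f g - D_g f + [f, g] - κ(f, g)`, where `D_f` is the
derivative along `ω⁻¹(f)` (`mlieBracket_of_lift`). Insert this into the Nijenhuis tensor. The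
derivative terms cancel because `R` is constant. The commutator terms cancel modulo `𝔯` because a
right multiplication in an associative algebra has zero Nijenhuis tensor for the commutator
(`algebraicNijenhuis_mem_isotropy`). Only curvature survives, and since `R² = ε` modulo `𝔯`, `N(ξ,
η) = ε 𝒯(ξ, η) + 𝒯(𝒥ξ, 𝒥η) - 𝒥 𝒯(𝒥ξ, η) - 𝒥 𝒯(ξ, 𝒥η)`, which is the asserted multiple of the
`(0,2)`-part (`zeroTwoPart_eq`). -/

noncomputable section

namespace Paraquat

open VectorField

/-! ### Lie brackets as derivations, and brackets of related vector fields -/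

section Bracket
variable {E F : Type*} [NormedAddCommGroup E] [NormedSpace ℝ E]
  [NormedAddCommGroup F] [NormedSpace ℝ F]
  {M : Type*} [TopologicalSpace M] [ChartedSpace E M] [IsManifold 𝓘(ℝ, E) ∞ M]

lemma contMDiffAt_extChartAt_symm (x : M) :
    ContMDiffAt 𝓘(ℝ, E) 𝓘(ℝ, E) ∞ (extChartAt 𝓘(ℝ, E) x).symm (extChartAt 𝓘(ℝ, E) x x) :=
  (contMDiffOn_extChartAt_symm x).contMDiffAt
    ((isOpen_extChartAt_target x).mem_nhds (mem_extChartAt_target x))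

lemma isInvertible_mfderiv_extChartAt_symm {x : M} {y : E}
    (hy : y ∈ (extChartAt 𝓘(ℝ, E) x).target) :
    (mfderiv 𝓘(ℝ, E) 𝓘(ℝ, E) (extChartAt 𝓘(ℝ, E) x).symm y).IsInvertible := by
  have : IsManifold 𝓘(ℝ, E) 1 M := .of_le (n := ∞) (by simp)
  have := isInvertible_mfderivWithin_extChartAt_symm (I := 𝓘(ℝ, E)) (x := x) hy
  rwa [modelWithCornersSelf_coe, Set.range_id, mfderivWithin_univ] at this

lemma two_le_infty : (2 : ℕ∞ω) ≤ ∞ := ENat.LEInfty.out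

omit [IsManifold 𝓘(ℝ, E) ∞ M] in
lemma mvfderiv_comp_apply' {E' : Type*} [NormedAddCommGroup E'] [NormedSpace ℝ E']
    {M' : Type*} [TopologicalSpace M'] [ChartedSpace E' M'] {g : M → F} {f : M' → M} {x : M'}
    (hg : MDiffAt g (f x)) (hf : MDiffAt f x) (v : TangentSpace 𝓘(ℝ, E') x) :
    mvfderiv 𝓘(ℝ, E') (fun y => g (f y)) x v =
      mvfderiv 𝓘(ℝ, E) g (f x) (mfderiv 𝓘(ℝ, E') 𝓘(ℝ, E) f x v) :=
  mfderiv_comp_apply x hg hf v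

lemma mlieBracket_eq_lieBracket (V W : ∀ x : E, TangentSpace 𝓘(ℝ, E) x) (x : E) :
    mlieBracket 𝓘(ℝ, E) V W x = lieBracket ℝ (V : E → E) (W : E → E) x := by
  rw [← mlieBracketWithin_univ, mlieBracketWithin_eq_lieBracketWithin]
  exact congrFun (lieBracketWithin_univ (𝕜 := ℝ) (V := (V : E → E)) (W := (W : E → E))) x

/-- In the chart at `x` this is the symmetry of the second derivative. Vector values of `g` are
allowed so that a chart can be taken for `g`, which turns brackets into derivatives of functions. -/
lemma mvfderiv_apply_mlieBracket [CompleteSpace E] {g : M → F} {x : M}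
    {V W : ∀ y : M, TangentSpace 𝓘(ℝ, E) y}
    (hg : CMDiffAt ∞ g x) (hV : MDiffAt (T% V) x) (hW : MDiffAt (T% W) x)
    (hgV : MDiffAt (fun y => mvfderiv 𝓘(ℝ, E) g y (V y)) x)
    (hgW : MDiffAt (fun y => mvfderiv 𝓘(ℝ, E) g y (W y)) x) :
    mvfderiv 𝓘(ℝ, E) g x (mlieBracket 𝓘(ℝ, E) V W x) =
      mvfderiv 𝓘(ℝ, E) (fun y => mvfderiv 𝓘(ℝ, E) g y (W y)) x (V x) -
      mvfderiv 𝓘(ℝ, E) (fun y => mvfderiv 𝓘(ℝ, E) g y (V y)) x (W x) := by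
  have : IsManifold 𝓘(ℝ, E) 1 M := .of_le (n := ∞) (by simp)
  have : IsManifold 𝓘(ℝ, E) 2 M := .of_le (n := ∞) two_le_infty
  have : IsManifold 𝓘(ℝ, E) (minSmoothness ℝ 2) M := by simpa
  set φ := extChartAt 𝓘(ℝ, E) x with hφ
  have hs : ContMDiffAt 𝓘(ℝ, E) 𝓘(ℝ, E) ∞ φ.symm (φ x) := contMDiffAt_extChartAt_symm x
  have hx : φ.symm (φ x) = x := extChartAt_to_inv x
  have hpull := mpullback_mlieBracket (n := ∞) (f := φ.symm) (x₀ := φ x) (V := V) (W := W)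
    (I := 𝓘(ℝ, E)) (I' := 𝓘(ℝ, E)) (by rwa [hx]) (by rwa [hx]) hs (by simpa using two_le_infty)
  have htarget : ∀ᶠ y in nhds (φ x), y ∈ φ.target :=
    (isOpen_extChartAt_target x).mem_nhds (mem_extChartAt_target x)
  have hsd : ∀ y ∈ φ.target, MDifferentiableAt 𝓘(ℝ, E) 𝓘(ℝ, E) φ.symm y := fun y hy =>
    ((contMDiffOn_extChartAt_symm (n := ∞) x).contMDiffAt
      ((isOpen_extChartAt_target x).mem_nhds hy)).mdifferentiableAt (by simp)
  -- The derivative of `φ.symm` is invertible on the target, so it carries the pulled back field to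
  -- the original one.
  have key : ∀ {h : M → F} {U : ∀ y : M, TangentSpace 𝓘(ℝ, E) y} {y : E}, y ∈ φ.target →
      MDiffAt h (φ.symm y) →
      fderiv ℝ (h ∘ φ.symm) y (mpullback 𝓘(ℝ, E) 𝓘(ℝ, E) φ.symm U y) =
        mvfderiv 𝓘(ℝ, E) h (φ.symm y) (U (φ.symm y)) := by
    intro h U y hy hh
    have h1 := mvfderiv_comp_apply' hh (hsd y hy) (mpullback 𝓘(ℝ, E) 𝓘(ℝ, E) φ.symm U y)
    have h2 : mfderiv 𝓘(ℝ, E) 𝓘(ℝ, E) φ.symm y (mpullback 𝓘(ℝ, E) 𝓘(ℝ, E) φ.symm U y) =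
        U (φ.symm y) := by
      rw [mpullback_apply]
      exact (isInvertible_mfderiv_extChartAt_symm hy).self_apply_inverse _
    rw [h2] at h1
    rw [← h1, mvfderiv, mfderiv_eq_fderiv]
    rfl
  have hgd : ∀ᶠ y in nhds (φ x), MDiffAt g (φ.symm y) := by
    have h1 := (contMDiffAt_iff_contMDiffAt_nhds (n := 1) (by simp)).1 (hg.of_le (by simp))
    have h2 : Filter.Tendsto φ.symm (nhds (φ x)) (nhds x) := by
      simpa only [ContinuousAt, hx] using hs.continuousAt
    filter_upwards [h2.eventually h1] with y hy using hy.mdifferentiableAt one_ne_zero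
  have h1 := key (U := mlieBracket 𝓘(ℝ, E) V W) (h := g) (mem_extChartAt_target x)
    (by rw [hx]; exact hg.mdifferentiableAt (by simp))
  have hd : ∀ U : ∀ y : M, TangentSpace 𝓘(ℝ, E) y, MDiffAt (T% U) x →
      DifferentiableAt ℝ (mpullback 𝓘(ℝ, E) 𝓘(ℝ, E) φ.symm U : E → E) (φ x) := by
    intro U hU
    have := (mdifferentiableWithinAt_univ.2 hU).differentiableWithinAt_mpullbackWithin_vectorField
    rw [modelWithCornersSelf_coe, Set.range_id, mpullbackWithin_univ, Set.preimage_univ,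
      Set.inter_univ] at this
    exact differentiableWithinAt_univ.1 this
  have hev : ∀ U : ∀ y : M, TangentSpace 𝓘(ℝ, E) y,
      (fun y => fderiv ℝ (g ∘ φ.symm) y (mpullback 𝓘(ℝ, E) 𝓘(ℝ, E) φ.symm U y)) =ᶠ[nhds (φ x)]
        (fun y => mvfderiv 𝓘(ℝ, E) g y (U y)) ∘ φ.symm := by
    intro U
    filter_upwards [hgd, htarget] with y h1 h2 using key h2 h1
  have h2 := fderiv_apply_lieBracket (n := 2) (f := g ∘ φ.symm) (x := φ x)
    (contMDiffAt_iff_contDiffAt.1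
      ((ContMDiffAt.comp (φ x) (by rwa [hx]) hs).of_le two_le_infty)) (by simp) (hd W hW) (hd V hV)
  rw [(hev V).fderiv_eq, (hev W).fderiv_eq,
    key (mem_extChartAt_target x) (by rwa [hx]), key (mem_extChartAt_target x) (by rwa [hx])] at h2
  rw [hpull, mlieBracket_eq_lieBracket, h2, hx] at h1
  exact h1.symm

lemma trivializationAt_tangent_snd {x : M} {v : TangentBundle 𝓘(ℝ, E) M}
    (hv : v.1 ∈ (chartAt E x).source) :
    (trivializationAt E (TangentSpace 𝓘(ℝ, E)) x v).2 =
      mvfderiv 𝓘(ℝ, E) (extChartAt 𝓘(ℝ, E) x) v.1 v.2 := by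
  have : IsManifold 𝓘(ℝ, E) 1 M := .of_le (n := ∞) (by simp)
  have h := TangentBundle.continuousLinearMapAt_trivializationAt (I := 𝓘(ℝ, E)) hv
  rw [mvfderiv, ← h]
  have hb : v.1 ∈ (trivializationAt E (TangentSpace 𝓘(ℝ, E) (M := M)) x).baseSet := by simpa using hv
  change _ = (trivializationAt E (TangentSpace 𝓘(ℝ, E)) x).continuousLinearMapAt ℝ v.1 v.2
  rw [Trivialization.continuousLinearMapAt_apply, Trivialization.coe_linearMapAt_of_mem _ hb]

/-- The trivialization at `b x` is the derivative of the chart there. Smoothness of vector fields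
thereby becomes smoothness of functions into the model space. -/
lemma contMDiffAt_tangentBundle_iff {E' : Type*} [NormedAddCommGroup E'] [NormedSpace ℝ E']
    {H' : Type*} [TopologicalSpace H'] {I' : ModelWithCorners ℝ E' H'}
    {N : Type*} [TopologicalSpace N] [ChartedSpace H' N]
    {b : N → M} {v : ∀ y, TangentSpace 𝓘(ℝ, E) (b y)} {x : N} :
    ContMDiffAt I' 𝓘(ℝ, E).tangent ∞ (fun y => (⟨b y, v y⟩ : TangentBundle 𝓘(ℝ, E) M)) x ↔
      ContMDiffAt I' 𝓘(ℝ, E) ∞ b x ∧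
      ContMDiffAt I' 𝓘(ℝ, E) ∞
        (fun y => mvfderiv 𝓘(ℝ, E) (extChartAt 𝓘(ℝ, E) (b x)) (b y) (v y)) x := by
  rw [contMDiffAt_totalSpace]
  refine and_congr_right fun hb => ?_
  refine Filter.EventuallyEq.contMDiffAt_iff ?_
  filter_upwards [hb.continuousAt.eventually
    ((chartAt E (b x)).open_source.mem_nhds (mem_chart_source E (b x)))] with y hy
  exact trivializationAt_tangent_snd (v := ⟨b y, v y⟩) hy

lemma mdifferentiableAt_tangentBundle_iff {E' : Type*} [NormedAddCommGroup E'] [NormedSpace ℝ E']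
    {H' : Type*} [TopologicalSpace H'] {I' : ModelWithCorners ℝ E' H'}
    {N : Type*} [TopologicalSpace N] [ChartedSpace H' N]
    {b : N → M} {v : ∀ y, TangentSpace 𝓘(ℝ, E) (b y)} {x : N} :
    MDifferentiableAt I' 𝓘(ℝ, E).tangent (fun y => (⟨b y, v y⟩ : TangentBundle 𝓘(ℝ, E) M)) x ↔
      MDifferentiableAt I' 𝓘(ℝ, E) b x ∧
      MDifferentiableAt I' 𝓘(ℝ, E)
        (fun y => mvfderiv 𝓘(ℝ, E) (extChartAt 𝓘(ℝ, E) (b x)) (b y) (v y)) x := by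
  have : IsManifold 𝓘(ℝ, E) 1 M := .of_le (n := ∞) (by simp)
  rw [mdifferentiableAt_totalSpace]
  refine and_congr_right fun hb => ?_
  refine Filter.EventuallyEq.mdifferentiableAt_iff ?_
  filter_upwards [hb.continuousAt.eventually
    ((chartAt E (b x)).open_source.mem_nhds (mem_chart_source E (b x)))] with y hy
  exact trivializationAt_tangent_snd (v := ⟨b y, v y⟩) hy

/-- The derivative of `f` need not be invertible, so the fields on `N` cannot be pulled back. Both
sides are instead tested with the chart `ψ` at `f x`, whose derivative is injective:
`mvfderiv_apply_mlieBracket` is applied to `ψ` on `N` and to `ψ ∘ f` on `M`. -/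
lemma mlieBracket_mfderiv_of_related [CompleteSpace E] {E' : Type*} [NormedAddCommGroup E'] [NormedSpace ℝ E']
    [CompleteSpace E'] {N : Type*} [TopologicalSpace N] [ChartedSpace E' N]
    [IsManifold 𝓘(ℝ, E') ∞ N] {f : M → N} {x : M}
    {V W : ∀ y : M, TangentSpace 𝓘(ℝ, E) y} {V' W' : ∀ y : N, TangentSpace 𝓘(ℝ, E') y}
    (hf : CMDiffAt ∞ f x) (hV : MDiffAt (T% V) x) (hW : MDiffAt (T% W) x)
    (hV' : MDiffAt (T% V') (f x)) (hW' : MDiffAt (T% W') (f x))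
    (hVV' : ∀ᶠ y in nhds x, mfderiv 𝓘(ℝ, E) 𝓘(ℝ, E') f y (V y) = V' (f y))
    (hWW' : ∀ᶠ y in nhds x, mfderiv 𝓘(ℝ, E) 𝓘(ℝ, E') f y (W y) = W' (f y)) :
    mfderiv 𝓘(ℝ, E) 𝓘(ℝ, E') f x (mlieBracket 𝓘(ℝ, E) V W x) =
      mlieBracket 𝓘(ℝ, E') V' W' (f x) := by
  have : IsManifold 𝓘(ℝ, E') 1 N := .of_le (n := ∞) (by simp)
  have : IsManifold 𝓘(ℝ, E') 2 N := .of_le (n := ∞) two_le_infty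
  set ψ := extChartAt 𝓘(ℝ, E') (f x) with hψdef
  have hψ : ∀ᶠ z in nhds (f x), CMDiffAt ∞ ψ z := by
    filter_upwards [(chartAt E' (f x)).open_source.mem_nhds (mem_chart_source E' (f x))] with z hz
    exact contMDiffAt_extChartAt' hz
  have hψd : ∀ᶠ z in nhds (f x), MDiffAt ψ z := by
    filter_upwards [hψ] with z hz using hz.mdifferentiableAt (by simp)
  have hfd : ∀ᶠ y in nhds x, MDiffAt f y := by
    filter_upwards [(contMDiffAt_iff_contMDiffAt_nhds (n := 1) (by simp)).1 (hf.of_le (by simp))]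
      with y hy using hy.mdifferentiableAt one_ne_zero
  have hψU : ∀ U : ∀ y : N, TangentSpace 𝓘(ℝ, E') y, MDiffAt (T% U) (f x) →
      MDiffAt (fun z => mvfderiv 𝓘(ℝ, E') ψ z (U z)) (f x) := by
    intro U hU
    exact (mdifferentiableAt_tangentBundle_iff.1 hU).2
  have hcomp : ∀ (U : ∀ y : M, TangentSpace 𝓘(ℝ, E) y) (U' : ∀ y : N, TangentSpace 𝓘(ℝ, E') y),
      (∀ᶠ y in nhds x, mfderiv 𝓘(ℝ, E) 𝓘(ℝ, E') f y (U y) = U' (f y)) →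
      (fun y => mvfderiv 𝓘(ℝ, E) (fun y => ψ (f y)) y (U y)) =ᶠ[nhds x]
        (fun y => mvfderiv 𝓘(ℝ, E') ψ (f y) (U' (f y))) := by
    intro U U' h
    filter_upwards [h, hfd, hf.continuousAt.eventually hψd] with y h1 h2 h3
    rw [mvfderiv_comp_apply' h3 h2, h1]
  have hfx := hfd.self_of_nhds
  have hd : ∀ (U : ∀ y : M, TangentSpace 𝓘(ℝ, E) y) (U' : ∀ y : N, TangentSpace 𝓘(ℝ, E') y),
      (∀ᶠ y in nhds x, mfderiv 𝓘(ℝ, E) 𝓘(ℝ, E') f y (U y) = U' (f y)) → MDiffAt (T% U') (f x) →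
      MDiffAt (fun y => mvfderiv 𝓘(ℝ, E) (fun y => ψ (f y)) y (U y)) x := fun U U' h hU' =>
    ((hψU U' hU').comp x hfx).congr_of_eventuallyEq (hcomp U U' h)
  have h1 := mvfderiv_apply_mlieBracket (hψ.self_of_nhds) hV' hW' (hψU _ hV') (hψU _ hW')
  have h2 := mvfderiv_apply_mlieBracket (g := fun y => ψ (f y))
    (ContMDiffAt.comp x hψ.self_of_nhds hf) hV hW (hd V V' hVV' hV') (hd W W' hWW' hW')
  have hder : ∀ (U : ∀ y : M, TangentSpace 𝓘(ℝ, E) y) (U' : ∀ y : N, TangentSpace 𝓘(ℝ, E') y),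
      (∀ᶠ y in nhds x, mfderiv 𝓘(ℝ, E) 𝓘(ℝ, E') f y (U y) = U' (f y)) → MDiffAt (T% U') (f x) →
      ∀ v, mvfderiv 𝓘(ℝ, E) (fun y => mvfderiv 𝓘(ℝ, E) (fun y => ψ (f y)) y (U y)) x v =
        mvfderiv 𝓘(ℝ, E') (fun z => mvfderiv 𝓘(ℝ, E') ψ z (U' z)) (f x)
          (mfderiv 𝓘(ℝ, E) 𝓘(ℝ, E') f x v) := by
    intro U U' h hU' v
    rw [← mvfderiv_comp_apply' (hψU U' hU') hfx, mvfderiv, mvfderiv, (hcomp U U' h).mfderiv_eq]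
    rfl
  rw [hder V V' hVV' hV', hder W W' hWW' hW', hVV'.self_of_nhds, hWW'.self_of_nhds, ← h1,
    mvfderiv_comp_apply' hψd.self_of_nhds hfx] at h2
  exact (isInvertible_mfderiv_extChartAt (I := 𝓘(ℝ, E')) (mem_extChartAt_source (f x))).injective h2
end Bracket

/-! ### Brackets in a parallelism -/

section Parallelism

variable {E' : Type*} [NormedAddCommGroup E'] [NormedSpace ℝ E']
    {H' : Type*} [TopologicalSpace H'] {I' : ModelWithCorners ℝ E' H'}
    {X : Type*} [TopologicalSpace X] [ChartedSpace H' X]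

/-- A family of linear maps on a finite-dimensional space is smooth if its values are smooth. -/
lemma contMDiffAt_clm_of_apply {E F : Type*} [NormedAddCommGroup E] [NormedSpace ℝ E]
    [FiniteDimensional ℝ E] [NormedAddCommGroup F] [NormedSpace ℝ F]
    {A : X → E →L[ℝ] F} {x : X} (hA : ∀ e, ContMDiffAt I' 𝓘(ℝ, F) ∞ (fun y => A y e) x) :
    ContMDiffAt I' 𝓘(ℝ, E →L[ℝ] F) ∞ A x := by
  let b := Module.finBasis ℝ E
  have h : A = fun y => ∑ i, ContinuousLinearMap.smulRightL ℝ E F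
      (LinearMap.toContinuousLinearMap (b.coord i)) (A y (b i)) := by
    ext y e
    calc A y e = A y (∑ i, b.repr e i • b i) := by rw [b.sum_repr]
      _ = _ := by rw [map_sum]; simp
  rw [h]
  exact contMDiffAt_finsetSum fun i _ =>
    (ContinuousLinearMap.contMDiff _).contMDiffAt.comp x (hA (b i))

lemma mvfderiv_clm_apply {E F : Type*} [NormedAddCommGroup E] [NormedSpace ℝ E]
    [NormedAddCommGroup F] [NormedSpace ℝ F]
    {A : X → E →L[ℝ] F} {f : X → E} {x : X} (hA : MDifferentiableAt I' 𝓘(ℝ, E →L[ℝ] F) A x)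
    (hf : MDifferentiableAt I' 𝓘(ℝ, E) f x) (v : TangentSpace I' x) :
    mvfderiv I' (fun y => A y (f y)) x v = mvfderiv I' A x v (f x) + A x (mvfderiv I' f x v) := by
  have h1 := hA.hasMFDerivAt
  have h2 := hf.hasMFDerivAt
  have h3 := h1.2.clm_apply h2.2
  rw [show writtenInExtChartAt I' 𝓘(ℝ, E →L[ℝ] F) x A (extChartAt I' x x) = A x by
    simp [writtenInExtChartAt]; rfl, show writtenInExtChartAt I' 𝓘(ℝ, E) x f (extChartAt I' x x) = f x by
    simp [writtenInExtChartAt]; rfl] at h3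
  have h4 : HasMFDerivAt I' 𝓘(ℝ, F) (fun y => A y (f y)) x _ := ⟨h1.1.clm_apply h2.1, h3⟩
  rw [mvfderiv, h4.mfderiv]
  exact add_comm _ _

variable {E : Type*} [NormedAddCommGroup E] [NormedSpace ℝ E] [FiniteDimensional ℝ E]
  {G : Type*} [NormedAddCommGroup G] [NormedSpace ℝ G]
  {N : Type*} [TopologicalSpace N] [ChartedSpace E N] [IsManifold 𝓘(ℝ, E) ∞ N]
  {θ : ∀ u : N, TangentSpace 𝓘(ℝ, E) u ≃L[ℝ] G}

variable (θ) in
/-- The inverse of a parallelism `θ`, in the chart at `u₀`. -/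
def frameInChart (u₀ u : N) : G →L[ℝ] E :=
  mvfderiv 𝓘(ℝ, E) (extChartAt 𝓘(ℝ, E) u₀) u ∘L (θ u).symm.toContinuousLinearMap

/-- The opposite map `A u`, the composition of `θ u` with the inverse of the chart derivative, is
smooth because it is smooth on each fixed vector. The frame is its inverse, and inversion of linear
maps is smooth. -/
lemma contMDiffAt_frameInChart
    (hθ : ContMDiff 𝓘(ℝ, E).tangent 𝓘(ℝ, G) ∞ (fun v : TangentBundle 𝓘(ℝ, E) N => θ v.1 v.2))
    (u₀ : N) : ContMDiffAt 𝓘(ℝ, E) 𝓘(ℝ, G →L[ℝ] E) ∞ (frameInChart θ u₀) u₀ := by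
  have : IsManifold 𝓘(ℝ, E) 1 N := .of_le (n := ∞) (by simp)
  set D : ∀ u : N, TangentSpace 𝓘(ℝ, E) u →L[ℝ] E :=
    fun u => mvfderiv 𝓘(ℝ, E) (extChartAt 𝓘(ℝ, E) u₀) u with hD
  have hsrc : ∀ᶠ u in nhds u₀, u ∈ (extChartAt 𝓘(ℝ, E) u₀).source :=
    extChartAt_source_mem_nhds u₀
  have hinv : ∀ᶠ u in nhds u₀, (D u).IsInvertible := by
    filter_upwards [hsrc] with u hu using isInvertible_mfderiv_extChartAt hu
  set A : N → E →L[ℝ] G := fun u => (θ u).toContinuousLinearMap ∘L (D u).inverse with hA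
  have hAs : ContMDiffAt 𝓘(ℝ, E) 𝓘(ℝ, E →L[ℝ] G) ∞ A u₀ := by
    refine contMDiffAt_clm_of_apply fun e => ?_
    refine hθ.contMDiffAt.comp u₀ (f := fun u => (⟨u, (D u).inverse e⟩ : TangentBundle 𝓘(ℝ, E) N))
      (contMDiffAt_tangentBundle_iff.2 ⟨contMDiffAt_id, ?_⟩)
    refine (contMDiffAt_const (c := e)).congr_of_eventuallyEq ?_
    filter_upwards [hinv] with u hu using hu.self_apply_inverse e
  have hAinv : ∀ u, (D u).IsInvertible → ∃ e : G ≃L[ℝ] E, frameInChart θ u₀ u = e ∧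
      A u = e.symm := by
    rintro u ⟨e, he⟩
    refine ⟨(θ u).symm.trans e, ?_, ?_⟩
    · ext x
      exact congrArg (fun L => L ((θ u).symm x)) he.symm
    · ext x
      simp [hA, ← he]
  have hcongr : frameInChart θ u₀ =ᶠ[nhds u₀] fun u => (A u).inverse := by
    filter_upwards [hinv] with u hu
    obtain ⟨e, he, he'⟩ := hAinv u hu
    rw [he, he', ContinuousLinearMap.inverse_equiv]
    rfl
  refine ContMDiffAt.congr_of_eventuallyEq ?_ hcongr
  obtain ⟨e, he, he'⟩ := hAinv u₀ hinv.self_of_nhds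
  have h1 := contDiffAt_map_inverse (n := ∞) e.symm
  rw [← he'] at h1
  exact h1.contMDiffAt.comp u₀ hAs

lemma contMDiffAt_parallelism_symm
    (hθ : ContMDiff 𝓘(ℝ, E).tangent 𝓘(ℝ, G) ∞ (fun v : TangentBundle 𝓘(ℝ, E) N => θ v.1 v.2))
    {b : X → N} {g : X → G} {x : X} (hb : ContMDiffAt I' 𝓘(ℝ, E) ∞ b x)
    (hg : ContMDiffAt I' 𝓘(ℝ, G) ∞ g x) :
    ContMDiffAt I' 𝓘(ℝ, E).tangent ∞
      (fun y => (⟨b y, (θ (b y)).symm (g y)⟩ : TangentBundle 𝓘(ℝ, E) N)) x :=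
  contMDiffAt_tangentBundle_iff.2 ⟨hb,
    ((contMDiffAt_frameInChart hθ (b x)).comp x hb).clm_apply hg⟩

/-- Leibniz rule: in the chart the fields are `frameInChart θ u` applied to `f` and `g`, and the
terms in which the frame is differentiated depend only on the values `f u` and `g u`. -/
lemma parallelism_mlieBracket
    (hθ : ContMDiff 𝓘(ℝ, E).tangent 𝓘(ℝ, G) ∞ (fun v : TangentBundle 𝓘(ℝ, E) N => θ v.1 v.2))
    {f g : N → G} {u : N} (hf : ContMDiffAt 𝓘(ℝ, E) 𝓘(ℝ, G) ∞ f u)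
    (hg : ContMDiffAt 𝓘(ℝ, E) 𝓘(ℝ, G) ∞ g u) :
    θ u (mlieBracket 𝓘(ℝ, E) (fun y => (θ y).symm (f y)) (fun y => (θ y).symm (g y)) u) =
      mvfderiv 𝓘(ℝ, E) g u ((θ u).symm (f u)) - mvfderiv 𝓘(ℝ, E) f u ((θ u).symm (g u)) +
      θ u (mlieBracket 𝓘(ℝ, E) (fun y => (θ y).symm (f u)) (fun y => (θ y).symm (g u)) u) := by
  have : IsManifold 𝓘(ℝ, E) 1 N := .of_le (n := ∞) (by simp)
  have : CompleteSpace E := FiniteDimensional.complete ℝ E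
  set ψ := extChartAt 𝓘(ℝ, E) u with hψ
  have hψs : CMDiffAt ∞ ψ u := contMDiffAt_extChartAt
  have hB := contMDiffAt_frameInChart hθ u
  have hBd := hB.mdifferentiableAt (by simp)
  have key : ∀ f g : N → G, CMDiffAt ∞ f u → CMDiffAt ∞ g u →
      mvfderiv 𝓘(ℝ, E) ψ u (mlieBracket 𝓘(ℝ, E) (fun y => (θ y).symm (f y))
        (fun y => (θ y).symm (g y)) u) =
      (mvfderiv 𝓘(ℝ, E) (frameInChart θ u) u ((θ u).symm (f u)) (g u) +
        frameInChart θ u u (mvfderiv 𝓘(ℝ, E) g u ((θ u).symm (f u)))) -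
      (mvfderiv 𝓘(ℝ, E) (frameInChart θ u) u ((θ u).symm (g u)) (f u) +
        frameInChart θ u u (mvfderiv 𝓘(ℝ, E) f u ((θ u).symm (g u)))) := by
    intro f g hf hg
    have h1 := (contMDiffAt_parallelism_symm hθ contMDiffAt_id hf).mdifferentiableAt (by simp)
    have h2 := (contMDiffAt_parallelism_symm hθ contMDiffAt_id hg).mdifferentiableAt (by simp)
    rw [← mvfderiv_clm_apply hBd (hg.mdifferentiableAt (by simp)),
      ← mvfderiv_clm_apply hBd (hf.mdifferentiableAt (by simp))]
    exact mvfderiv_apply_mlieBracket hψs h1 h2 (mdifferentiableAt_tangentBundle_iff.1 h1).2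
      (mdifferentiableAt_tangentBundle_iff.1 h2).2
  have h1 := key f g hf hg
  -- Freezing the coefficients isolates the terms which differentiate the frame.
  have h2 := key (fun _ => f u) (fun _ => g u) contMDiffAt_const contMDiffAt_const
  simp only [mvfderiv_const] at h2
  have hinj := (isInvertible_mfderiv_extChartAt (I := 𝓘(ℝ, E)) (mem_extChartAt_source u)).injective
  rw [← (θ u).eq_symm_apply]
  apply hinj
  refine h1.trans ?_
  change _ = frameInChart θ u u _
  rw [map_add, map_sub]
  have h3 : ∀ w, frameInChart θ u u (θ u w) = mvfderiv 𝓘(ℝ, E) ψ u w := fun w => by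
    change mvfderiv 𝓘(ℝ, E) ψ u ((θ u).symm (θ u w)) = _
    rw [ContinuousLinearEquiv.symm_apply_apply]
  rw [h3, h2, zero_apply, zero_apply, map_zero]
  abel

end Parallelism

/-! ### Blocks and the adjoint action of the parabolic group -/

section Algebra
variable {n : ℕ}

lemma toBlocks₂₁_blockMat (b : BlockUpper n) : (blockMat b).toBlocks₂₁ = 0 := b.2

lemma blockMat_injective : Function.Injective (blockMat (n := n)) := Subtype.val_injective

lemma blockMat_eq_fromBlocks (b : BlockUpper n) : blockMat b =
    Matrix.fromBlocks (blockMat b).toBlocks₁₁ (blockMat b).toBlocks₁₂ 0 (blockMat b).toBlocks₂₂ := by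
  conv_lhs => rw [← Matrix.fromBlocks_toBlocks (blockMat b), toBlocks₂₁_blockMat]

/-- The upper left block, as a homomorphism of algebras. -/
def upperLeft : BlockUpper n →ₐ[ℝ] Matrix (Fin 2) (Fin 2) ℝ :=
  AlgHom.ofLinearMap
    { toFun := fun b => (blockMat b).toBlocks₁₁
      map_add' := fun a b => by rw [map_add]; rfl
      map_smul' := fun r b => by rw [map_smul]; rfl }
    (by ext i j; simp [Matrix.toBlocks₁₁, Matrix.one_apply])
    (fun a b => by
      change (blockMat (a * b)).toBlocks₁₁ = (blockMat a).toBlocks₁₁ * (blockMat b).toBlocks₁₁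
      rw [map_mul, blockMat_eq_fromBlocks a, blockMat_eq_fromBlocks b, Matrix.fromBlocks_multiply]
      simp)

/-- The lower right block, as a homomorphism of algebras. -/
def lowerRight : BlockUpper n →ₐ[ℝ] Matrix (Fin n) (Fin n) ℝ :=
  AlgHom.ofLinearMap
    { toFun := fun b => (blockMat b).toBlocks₂₂
      map_add' := fun a b => by rw [map_add]; rfl
      map_smul' := fun r b => by rw [map_smul]; rfl }
    (by ext i j; simp [Matrix.toBlocks₂₂, Matrix.one_apply])
    (fun a b => by
      change (blockMat (a * b)).toBlocks₂₂ = (blockMat a).toBlocks₂₂ * (blockMat b).toBlocks₂₂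
      rw [map_mul, blockMat_eq_fromBlocks a, blockMat_eq_fromBlocks b, Matrix.fromBlocks_multiply]
      simp)

lemma upperLeft_mul_inv (a : ParabolicGL n) :
    upperLeft (a : BlockUpper n) * upperLeft (↑a⁻¹ : BlockUpper n) = 1 := by
  rw [← map_mul, Units.mul_inv, map_one]

lemma upperLeft_inv_mul (a : ParabolicGL n) :
    upperLeft (↑a⁻¹ : BlockUpper n) * upperLeft (a : BlockUpper n)  = 1 := by
  rw [← map_mul, Units.inv_mul, map_one]

lemma blockMat_inv_mul (a : ParabolicGL n) :
    blockMat (↑a⁻¹ : BlockUpper n) * blockMat (a : BlockUpper n) = 1 := by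
  rw [← map_mul, Units.inv_mul, map_one]

lemma blockMat_mul_inv (a : ParabolicGL n) :
    blockMat (a : BlockUpper n) * blockMat (↑a⁻¹ : BlockUpper n) = 1 := by
  rw [← map_mul, Units.mul_inv, map_one]

/-- The adjoint action of the parabolic subgroup. -/
def adj (a : ParabolicGL n) : Sl n →ₗ[ℝ] Sl n where
  toFun X := Sl.mk (blockMat (a : BlockUpper n) * toMat X * blockMat (↑a⁻¹ : BlockUpper n)) (by
    rw [Matrix.trace_mul_comm, ← mul_assoc, blockMat_inv_mul, one_mul, trace_toMat])
  map_add' X Y := by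
    apply toMat_injective
    simp [mul_add, add_mul]
  map_smul' r X := by
    apply toMat_injective
    simp

@[simp] lemma toMat_adj (a : ParabolicGL n) (X : Sl n) : toMat (adj a X) =
    blockMat (a : BlockUpper n) * toMat X * blockMat (↑a⁻¹ : BlockUpper n) := rfl

@[simp] lemma toMat_slBracket (X Y : Sl n) :
    toMat (slBracket X Y) = toMat X * toMat Y - toMat Y * toMat X := rfl

lemma adj_slBracket (a : ParabolicGL n) (X Y : Sl n) :
    adj a (slBracket X Y) = slBracket (adj a X) (adj a Y) := by
  have h : ∀ A B : Mat n, blockMat (a : BlockUpper n) * A * blockMat (↑a⁻¹ : BlockUpper n) *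
      (blockMat (a : BlockUpper n) * B * blockMat (↑a⁻¹ : BlockUpper n)) =
      blockMat (a : BlockUpper n) * (A * B) * blockMat (↑a⁻¹ : BlockUpper n) := by
    intro A B
    calc _ = blockMat (a : BlockUpper n) * A * (blockMat (↑a⁻¹ : BlockUpper n) *
        blockMat (a : BlockUpper n)) * B * blockMat (↑a⁻¹ : BlockUpper n) := by noncomm_ring
      _ = _ := by rw [blockMat_inv_mul]; noncomm_ring
  apply toMat_injective
  simp only [toMat_adj, toMat_slBracket, h]
  noncomm_ring

lemma adj_adj_inv (a : ParabolicGL n) (X : Sl n) : adj a (adj a⁻¹ X) = X := by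
  apply toMat_injective
  simp only [toMat_adj, inv_inv]
  calc _ = (blockMat (a : BlockUpper n) * blockMat (↑a⁻¹ : BlockUpper n)) * toMat X *
        (blockMat (a : BlockUpper n) * blockMat (↑a⁻¹ : BlockUpper n)) := by noncomm_ring
    _ = _ := by rw [blockMat_mul_inv]; simp

lemma adj_inv_adj (a : ParabolicGL n) (X : Sl n) : adj a⁻¹ (adj a X) = X := by
  simpa using adj_adj_inv a⁻¹ X

/-- The lower left block, i.e. the projection to `𝔤/𝔭`. -/
def lowerLeft : Sl n →ₗ[ℝ] Matrix (Fin n) (Fin 2) ℝ where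
  toFun X := (toMat X).toBlocks₂₁
  map_add' X Y := by rw [map_add]; rfl
  map_smul' r X := by rw [map_smul]; rfl

lemma lowerLeft_eq_zero_iff (X : Sl n) :
    lowerLeft X = 0 ↔ toMat X ∈ blockUpperSubalgebra n := Iff.rfl

@[simp] lemma lowerLeft_gMinus (X : Matrix (Fin n) (Fin 2) ℝ) : lowerLeft (gMinus n X) = X := rfl

lemma lowerLeft_adj (a : ParabolicGL n) (X : Sl n) : lowerLeft (adj a X) =
    lowerRight (a : BlockUpper n) * lowerLeft X * upperLeft (↑a⁻¹ : BlockUpper n) := by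
  change (blockMat (a : BlockUpper n) * toMat X * blockMat (↑a⁻¹ : BlockUpper n)).toBlocks₂₁ =
    (blockMat (a : BlockUpper n)).toBlocks₂₂ * (toMat X).toBlocks₂₁ *
      (blockMat (↑a⁻¹ : BlockUpper n)).toBlocks₁₁
  generalize (a : BlockUpper n) = b, (↑a⁻¹ : BlockUpper n) = c
  rw [blockMat_eq_fromBlocks b, blockMat_eq_fromBlocks c,
    ← Matrix.fromBlocks_toBlocks (toMat X), Matrix.fromBlocks_multiply, Matrix.fromBlocks_multiply]
  simp

end Algebra

lemma endBundle_ext {n : ℕ} {M : Type*} [TopologicalSpace M]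
    [ChartedSpace (EuclideanSpace ℝ (Fin (2 * n))) M] [IsManifold (𝓡 (2 * n)) ∞ M] {x y : M}
    (h : x = y) {A : TEnd n x} {B : TEnd n y}
    (hAB : (A : EuclideanSpace ℝ (Fin (2 * n)) →L[ℝ] EuclideanSpace ℝ (Fin (2 * n))) = B) :
    (⟨x, A⟩ : EndBundle n M) = ⟨y, B⟩ := by
  subst h
  subst hAB
  rfl

/-! ### Equivariance of the Cartan connection, its curvature and `stdEnd` -/

namespace CartanGeometry

variable {n d : ℕ} {M 𝒢 : Type*} [TopologicalSpace M]
  [ChartedSpace (EuclideanSpace ℝ (Fin (2 * n))) M]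
  [TopologicalSpace 𝒢] [ChartedSpace (EuclideanSpace ℝ (Fin d)) 𝒢] [IsManifold (𝓡 d) ∞ 𝒢]
  (C : CartanGeometry n d M 𝒢)

lemma contMDiffAt_conn_symm {E' : Type*} [NormedAddCommGroup E'] [NormedSpace ℝ E']
    {H' : Type*} [TopologicalSpace H'] {I' : ModelWithCorners ℝ E' H'}
    {X : Type*} [TopologicalSpace X] [ChartedSpace H' X] {b : X → 𝒢} {g : X → Sl n} {x : X}
    (hb : ContMDiffAt I' (𝓡 d) ∞ b x) (hg : ContMDiffAt I' 𝓘(ℝ, Sl n) ∞ g x) :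
    ContMDiffAt I' (𝓡 d).tangent ∞
      (fun y => (⟨b y, (C.conn (b y)).symm (g y)⟩ : TangentBundle (𝓡 d) 𝒢)) x :=
  contMDiffAt_parallelism_symm C.contMDiff_conn hb hg

lemma contMDiff_constField (X : Sl n) : ContMDiff (𝓡 d) (𝓡 d).tangent ∞
    (fun u => (⟨u, C.constField X u⟩ : TangentBundle (𝓡 d) 𝒢)) := fun _ =>
  C.contMDiffAt_conn_symm contMDiffAt_id contMDiffAt_const

lemma mdifferentiableAt_constField (X : Sl n) (u : 𝒢) :
    MDifferentiableAt (𝓡 d) (𝓡 d).tangent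
      (fun u => (⟨u, C.constField X u⟩ : TangentBundle (𝓡 d) 𝒢)) u :=
  (C.contMDiff_constField X u).mdifferentiableAt (by simp)

lemma contMDiff_act_right (a : ParabolicGL n) :
    ContMDiff (𝓡 d) (𝓡 d) ∞ (fun u => C.act u a) :=
  C.contMDiff_act.comp (contMDiff_id.prodMk contMDiff_const)

lemma contMDiff_act_left (u : 𝒢) : ContMDiff 𝓘(ℝ, BlockUpper n) (𝓡 d) ∞ (C.act u) :=
  C.contMDiff_act.comp (contMDiff_const.prodMk contMDiff_id)

lemma proj_act (u : 𝒢) (a : ParabolicGL n) : C.proj (C.act u a) = C.proj u :=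
  ((C.proj_eq_iff u _).2 ⟨a, rfl⟩).symm

lemma conn_mfderiv_act (u : 𝒢) (a : ParabolicGL n) (v : TangentSpace (𝓡 d) u) :
    C.conn (C.act u a) (mfderiv (𝓡 d) (𝓡 d) (fun u' => C.act u' a) u v) =
      adj a⁻¹ (C.conn u v) := by
  apply toMat_injective
  rw [C.conn_act]
  simp

lemma mfderiv_act_conn_symm (u : 𝒢) (a : ParabolicGL n) (X : Sl n) :
    mfderiv (𝓡 d) (𝓡 d) (fun u' => C.act u' a) u ((C.conn u).symm X) =
      (C.conn (C.act u a)).symm (adj a⁻¹ X) := by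
  rw [ContinuousLinearEquiv.eq_symm_apply, conn_mfderiv_act,
    ContinuousLinearEquiv.apply_symm_apply]

/-- Translation by `a` relates `ω⁻¹(X)` to `ω⁻¹(Ad(a⁻¹) X)`, hence also the brackets of such fields,
and `Ad(a⁻¹)` is an automorphism of `𝔤`. -/
lemma curvature_act (u : 𝒢) (a : ParabolicGL n) (X Y : Sl n) :
    C.curvature (C.act u a) (adj a⁻¹ X) (adj a⁻¹ Y) = adj a⁻¹ (C.curvature u X Y) := by
  have h := mlieBracket_mfderiv_of_related (f := fun u' => C.act u' a) (x := u)
    (V := C.constField X) (W := C.constField Y) (V' := C.constField (adj a⁻¹ X))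
    (W' := C.constField (adj a⁻¹ Y)) (C.contMDiff_act_right a u)
    (C.mdifferentiableAt_constField X u) (C.mdifferentiableAt_constField Y u)
    (C.mdifferentiableAt_constField _ _) (C.mdifferentiableAt_constField _ _)
    (.of_forall fun v => C.mfderiv_act_conn_symm v a X)
    (.of_forall fun v => C.mfderiv_act_conn_symm v a Y)
  rw [curvature, curvature, ← h, conn_mfderiv_act, map_sub, adj_slBracket]

lemma constField_of_blockUpper (u : 𝒢) (X : Sl n) (hX : toMat X ∈ blockUpperSubalgebra n) :
    C.constField X u =
      mfderiv 𝓘(ℝ, BlockUpper n) (𝓡 d) (C.act u) (1 : ParabolicGL n) (⟨toMat X, hX⟩ : BlockUpper n) := by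
  refine (C.conn u).symm_apply_eq.2 ?_
  exact toMat_injective (C.conn_fundamental u ⟨toMat X, hX⟩ (trace_toMat X)).symm

variable [IsManifold (𝓡 (2 * n)) ∞ M]

lemma toTangent_eq_tangentEquiv (u : 𝒢) (X : Sl n) :
    C.toTangent u X = C.tangentEquiv u (lowerLeft X) := by
  change _ = C.toTangent u (gMinus n (lowerLeft X))
  rw [← sub_eq_zero, ← map_sub]
  apply C.toTangent_of_blockUpper
  rw [← lowerLeft_eq_zero_iff, map_sub, lowerLeft_gMinus, sub_self]

omit [IsManifold (𝓡 (2 * n)) ∞ M] in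
lemma toTangent_act (u : 𝒢) (a : ParabolicGL n) (X : Sl n) :
    (C.toTangent (C.act u a) (adj a⁻¹ X) : EuclideanSpace ℝ (Fin (2 * n))) = C.toTangent u X := by
  have h := mfderiv_comp_apply (I := 𝓡 d) (I' := 𝓡 d) (I'' := 𝓡 (2 * n)) u
    (g := C.proj) (f := fun u' => C.act u' a)
    ((C.contMDiff_proj _).mdifferentiableAt (by simp))
    ((C.contMDiff_act_right a u).mdifferentiableAt (by simp)) ((C.conn u).symm X)
  rw [mfderiv_act_conn_symm] at h
  have h2 : C.proj ∘ (fun u' => C.act u' a) = C.proj := funext fun v => C.proj_act v a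
  rw [h2] at h
  exact h.symm

lemma tangentEquiv_act (u : 𝒢) (a : ParabolicGL n) (X : Matrix (Fin n) (Fin 2) ℝ) :
    (C.tangentEquiv (C.act u a) X : EuclideanSpace ℝ (Fin (2 * n))) =
      C.tangentEquiv u (lowerRight (a : BlockUpper n) * X * upperLeft (↑a⁻¹ : BlockUpper n)) := by
  have h := C.toTangent_act u a (adj a (gMinus n X))
  rw [adj_inv_adj, toTangent_eq_tangentEquiv, toTangent_eq_tangentEquiv, lowerLeft_adj,
    lowerLeft_gMinus] at h
  exact h

lemma stdEnd_tangentEquiv (u : 𝒢) (S : Matrix (Fin 2) (Fin 2) ℝ) (X : Matrix (Fin n) (Fin 2) ℝ) :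
    C.stdEnd u S (C.tangentEquiv u X) = C.tangentEquiv u (X * S) := by
  simp [stdEnd, mulRightMat]

/-- On `𝔤/𝔭` the element `a` acts by `X ↦ a₂₂ X a₁₁⁻¹`. The left factor commutes with right
multiplications, so only conjugation of `S` by `a₁₁` remains. -/
lemma stdEnd_act (u : 𝒢) (a : ParabolicGL n) (S : Matrix (Fin 2) (Fin 2) ℝ) :
    (⟨C.proj (C.act u a), C.stdEnd (C.act u a) S⟩ : EndBundle n M) =
      ⟨C.proj u, C.stdEnd u (upperLeft (a : BlockUpper n) * S * upperLeft (↑a⁻¹ : BlockUpper n))⟩ := by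
  have h : (C.stdEnd (C.act u a) S :
      EuclideanSpace ℝ (Fin (2 * n)) →L[ℝ] EuclideanSpace ℝ (Fin (2 * n))) =
      C.stdEnd u (upperLeft (a : BlockUpper n) * S * upperLeft (↑a⁻¹ : BlockUpper n)) := by
    refine ContinuousLinearMap.ext fun v => ?_
    obtain ⟨X, hX⟩ := (C.tangentEquiv (C.act u a)).surjective v
    have h1 := C.stdEnd_tangentEquiv (C.act u a) S X
    rw [hX, tangentEquiv_act] at h1
    refine h1.trans ?_
    rw [tangentEquiv_act] at hX
    rw [← hX]
    refine ((C.stdEnd_tangentEquiv u _ _).trans (congrArg (C.tangentEquiv u) ?_)).symm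
    calc _ = lowerRight (a : BlockUpper n) * X * (upperLeft (↑a⁻¹ : BlockUpper n) *
          upperLeft (a : BlockUpper n)) * S * upperLeft (↑a⁻¹ : BlockUpper n) := by
          simp only [Matrix.mul_assoc]
      _ = _ := by rw [upperLeft_inv_mul, Matrix.mul_one]; simp only [Matrix.mul_assoc]
  exact endBundle_ext (C.proj_act u a) h

end CartanGeometry

/-! ### Calculus on the group of units of a Banach algebra -/

section Units
variable {R : Type*} [NormedRing R] [NormedAlgebra ℝ R] [CompleteSpace R]

/-- A right inverse of the inclusion of the units on its image. -/
def toUnits (b : R) : Rˣ := (chartAt R (1 : Rˣ)).symm b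

omit [NormedAlgebra ℝ R] in
@[simp] lemma toUnits_val (a : Rˣ) : toUnits (a : R) = a :=
  (chartAt R (1 : Rˣ)).left_inv (by simp)

omit [NormedAlgebra ℝ R] in
@[simp] lemma toUnits_one : toUnits (1 : R) = 1 := toUnits_val 1

lemma contMDiffAt_toUnits (a : Rˣ) : ContMDiffAt 𝓘(ℝ, R) 𝓘(ℝ, R) ∞ (toUnits (R := R)) a :=
  (contMDiffOn_chart_symm (I := 𝓘(ℝ, R)) (H := R) (x := (1 : Rˣ))).contMDiffAt
    ((chartAt R (1 : Rˣ)).open_target.mem_nhds ((chartAt R (1 : Rˣ)).map_source (x := a) (by simp)))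

/-- The charts of `Rˣ` are given by `Units.val`, so its tangent spaces are copies of `R`. The next
lemmas make this identification available for explicit computations in `R`. -/
lemma mfderiv_units_val (a : Rˣ) (v : R) :
    (mfderiv 𝓘(ℝ, R) 𝓘(ℝ, R) (Units.val : Rˣ → R) a v : R) = v := by
  have h1 : MDifferentiableAt 𝓘(ℝ, R) 𝓘(ℝ, R) (Units.val : Rˣ → R) a :=
    (Units.contMDiff_val (n := ∞) a).mdifferentiableAt (by simp)
  have h2 : writtenInExtChartAt 𝓘(ℝ, R) 𝓘(ℝ, R) a (Units.val : Rˣ → R) =ᶠ[nhds (a : R)] id := by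
    filter_upwards [Units.isOpenEmbedding_val.isOpen_range.mem_nhds ⟨a, rfl⟩] with b hb
    obtain ⟨b, rfl⟩ := hb
    exact congrArg Units.val (toUnits_val b)
  have h3 := h1.mfderiv
  rw [modelWithCornersSelf_coe, Set.range_id, fderivWithin_univ] at h3
  rw [h3]
  have h4 : fderiv ℝ (writtenInExtChartAt 𝓘(ℝ, R) 𝓘(ℝ, R) a (Units.val : Rˣ → R)) (a : R) =
    ContinuousLinearMap.id ℝ R := by rw [h2.fderiv_eq, fderiv_id]
  exact congrArg (fun L => L v) h4

lemma mfderiv_toUnits (a : Rˣ) (v : R) :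
    (mfderiv 𝓘(ℝ, R) 𝓘(ℝ, R) (toUnits (R := R)) a v : R) = v := by
  have h1 : MDifferentiableAt 𝓘(ℝ, R) 𝓘(ℝ, R) (toUnits (R := R)) a :=
    (contMDiffAt_toUnits a).mdifferentiableAt (by simp)
  have h2 : MDifferentiableAt 𝓘(ℝ, R) 𝓘(ℝ, R) (Units.val : Rˣ → R) (toUnits (a : R)) :=
    (Units.contMDiff_val (n := ∞) _).mdifferentiableAt (by simp)
  have h3 := mfderiv_comp_apply (a : R) h2 h1 v
  have h4 : (Units.val : Rˣ → R) ∘ toUnits =ᶠ[nhds (a : R)] id := by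
    filter_upwards [Units.isOpenEmbedding_val.isOpen_range.mem_nhds ⟨a, rfl⟩] with b hb
    obtain ⟨b, rfl⟩ := hb
    exact congrArg Units.val (toUnits_val b)
  rw [h4.mfderiv_eq, mfderiv_id] at h3
  exact (mfderiv_units_val _ _).symm.trans h3.symm

lemma mfderiv_units_mul_left (a : Rˣ) (v : R) :
    (mfderiv 𝓘(ℝ, R) 𝓘(ℝ, R) (fun b : Rˣ => a * b) 1 v : R) = (a : R) * v := by
  have h1 : MDifferentiableAt 𝓘(ℝ, R) 𝓘(ℝ, R) (fun b : Rˣ => a * b) 1 :=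
    ((contMDiff_mul_left (I := 𝓘(ℝ, R)) (n := ∞) (a := a)) _).mdifferentiableAt (by simp)
  have hv : ∀ b : Rˣ, MDifferentiableAt 𝓘(ℝ, R) 𝓘(ℝ, R) (Units.val : Rˣ → R) b := fun b =>
    (Units.contMDiff_val (n := ∞) b).mdifferentiableAt (by simp)
  have h2 := mfderiv_comp_apply (1 : Rˣ) (hv (a * 1)) h1 v
  have h3 : (Units.val : Rˣ → R) ∘ (fun b : Rˣ => a * b) =
      (ContinuousLinearMap.mul ℝ R a) ∘ (Units.val : Rˣ → R) := by
    ext b; simp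
  have h4 := mfderiv_comp_apply (1 : Rˣ) (I := 𝓘(ℝ, R)) (I' := 𝓘(ℝ, R)) (I'' := 𝓘(ℝ, R))
    (g := ContinuousLinearMap.mul ℝ R a) (f := (Units.val : Rˣ → R))
    (ContinuousLinearMap.mdifferentiableAt _) (hv 1) v
  rw [ContinuousLinearMap.mfderiv_eq] at h4
  rw [h3] at h2
  have h5 := (mfderiv_units_val (a * 1) _).symm.trans (h2.symm.trans h4)
  refine h5.trans ?_
  exact congrArg (fun w : R => (a : R) * w) (mfderiv_units_val 1 v)

set_option synthInstance.maxHeartbeats 200000 in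
lemma hasFDerivAt_ringInverse_one :
    HasFDerivAt (Ring.inverse : R → R) (-ContinuousLinearMap.id ℝ R) (1 : R) := by
  have h := hasFDerivAt_ringInverse (𝕜 := ℝ) (1 : Rˣ)
  refine h.congr_fderiv ?_
  ext v
  simp

end Units

lemma mdifferentiableAt_vectorField_of_differentiableAt {E : Type*} [NormedAddCommGroup E]
    [NormedSpace ℝ E] {V : E → E} {x : E} (hV : DifferentiableAt ℝ V x) :
    MDifferentiableAt 𝓘(ℝ, E) 𝓘(ℝ, E).tangent (fun y => (⟨y, V y⟩ : TangentBundle 𝓘(ℝ, E) E)) x := by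
  refine mdifferentiableAt_tangentBundle_iff.2 ⟨mdifferentiableAt_id, ?_⟩
  refine hV.mdifferentiableAt.congr_of_eventuallyEq (.of_forall fun y => ?_)
  rw [extChartAt_model_space_eq_id]
  change mvfderiv 𝓘(ℝ, E) id y (V y) = V y
  rw [mvfderiv, mfderiv_id]
  rfl

/-- A block upper triangular matrix as an element of the algebra of these matrices. -/
def BlockUpper.mk {n : ℕ} (A : Mat n) (hA : A ∈ blockUpperSubalgebra n) : BlockUpper n := ⟨A, hA⟩

@[simp] lemma blockMat_mk {n : ℕ} (A : Mat n) (hA : A ∈ blockUpperSubalgebra n) :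
    blockMat (BlockUpper.mk A hA) = A := rfl

/-! ### Horizontality of the curvature -/

namespace CartanGeometry

variable {n d : ℕ} {M 𝒢 : Type*} [TopologicalSpace M]
  [ChartedSpace (EuclideanSpace ℝ (Fin (2 * n))) M]
  [TopologicalSpace 𝒢] [ChartedSpace (EuclideanSpace ℝ (Fin d)) 𝒢] [IsManifold (𝓡 d) ∞ 𝒢]
  (C : CartanGeometry n d M 𝒢)

/-- Since `act (act u a)` is `act u` after left multiplication by `a`, the fundamental field of `X`
is the image of the left invariant field `a ↦ a X`. -/
lemma mfderiv_act_left (u : 𝒢) (a : ParabolicGL n) (X : Sl n)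
    (hX : toMat X ∈ blockUpperSubalgebra n) :
    mfderiv 𝓘(ℝ, BlockUpper n) (𝓡 d) (C.act u) a
      ((a : BlockUpper n) * (BlockUpper.mk (toMat X) hX)) = C.constField X (C.act u a) := by
  rw [C.constField_of_blockUpper _ X hX]
  have h1 : C.act (C.act u a) = C.act u ∘ (fun b => a * b) := by
    ext b
    rw [← C.act_mul]
    rfl
  have h2 := mfderiv_comp_apply (1 : ParabolicGL n) (I := 𝓘(ℝ, BlockUpper n))
    (I' := 𝓘(ℝ, BlockUpper n)) (I'' := 𝓡 d) (g := C.act u) (f := fun b => a * b)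
    ((C.contMDiff_act_left u _).mdifferentiableAt (by simp))
    (((contMDiff_mul_left (I := 𝓘(ℝ, BlockUpper n)) (n := ∞) (a := a)) _).mdifferentiableAt
      (by simp)) (BlockUpper.mk (toMat X) hX)
  rw [← h1] at h2
  refine Eq.trans ?_ h2.symm
  have h3 := mfderiv_units_mul_left a (BlockUpper.mk (toMat X) hX)
  -- The points `a * 1` and `a` have formally different tangent spaces, so the comparison is made
  -- after generalizing the point.
  have h4 : ∀ b : ParabolicGL n, b = a → ∀ w w' : BlockUpper n, w = w' →
      (mfderiv 𝓘(ℝ, BlockUpper n) (𝓡 d) (C.act u) b w : EuclideanSpace ℝ (Fin d)) =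
        mfderiv 𝓘(ℝ, BlockUpper n) (𝓡 d) (C.act u) a w' := by
    rintro b rfl w w' rfl
    rfl
  exact (h4 _ (mul_one a) _ _ h3).symm

/-- The action in a chart, extended to a neighbourhood of the identity in the algebra. -/
def actInChart (u₀ : 𝒢) (p : EuclideanSpace ℝ (Fin d) × BlockUpper n) : 𝒢 :=
  C.act ((extChartAt (𝓡 d) u₀).symm p.1) (toUnits p.2)

lemma constField_actInChart (u₀ : 𝒢) (y : EuclideanSpace ℝ (Fin d)) (a : ParabolicGL n) (X : Sl n) :
    (C.constField X (C.actInChart u₀ (y, (a : BlockUpper n))) : EuclideanSpace ℝ (Fin d)) =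
      C.constField X (C.act ((extChartAt (𝓡 d) u₀).symm y) a) := by
  have h : C.actInChart u₀ (y, (a : BlockUpper n)) = C.act ((extChartAt (𝓡 d) u₀).symm y) a := by
    simp [actInChart]
  rw [h]

lemma contMDiffAt_actInChart (u₀ : 𝒢) {y : EuclideanSpace ℝ (Fin d)}
    (hy : y ∈ (extChartAt (𝓡 d) u₀).target) (a : ParabolicGL n) :
    ContMDiffAt 𝓘(ℝ, EuclideanSpace ℝ (Fin d) × BlockUpper n) (𝓡 d) ∞ (C.actInChart u₀)
      (y, (a : BlockUpper n)) := by
  refine C.contMDiff_act.contMDiffAt.comp _ (ContMDiffAt.prodMk ?_ ?_)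
  · exact ContMDiffAt.comp (y, (a : BlockUpper n)) (g := (extChartAt (𝓡 d) u₀).symm)
      ((contMDiffOn_extChartAt_symm u₀).contMDiffAt ((isOpen_extChartAt_target u₀).mem_nhds hy))
      contDiffAt_fst.contMDiffAt
  · exact ContMDiffAt.comp (y, (a : BlockUpper n)) (g := toUnits (R := BlockUpper n))
      (contMDiffAt_toUnits a) contDiffAt_snd.contMDiffAt

lemma mfderiv_actInChart_snd (u₀ : 𝒢) {y : EuclideanSpace ℝ (Fin d)}
    (hy : y ∈ (extChartAt (𝓡 d) u₀).target) (a : ParabolicGL n) (X : Sl n)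
    (hX : toMat X ∈ blockUpperSubalgebra n) :
    mfderiv 𝓘(ℝ, EuclideanSpace ℝ (Fin d) × BlockUpper n) (𝓡 d) (C.actInChart u₀)
      (y, (a : BlockUpper n)) (0, (a : BlockUpper n) * (BlockUpper.mk (toMat X) hX)) =
      C.constField X (C.actInChart u₀ (y, (a : BlockUpper n))) := by
  have h1 : MDifferentiableAt 𝓘(ℝ, EuclideanSpace ℝ (Fin d) × BlockUpper n) (𝓡 d)
      (C.actInChart u₀) (y, (a : BlockUpper n)) :=
    (C.contMDiffAt_actInChart u₀ hy a).mdifferentiableAt (by simp)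
  have h2 := hasFDerivAt_prodMk_right (𝕜 := ℝ) y (a : BlockUpper n)
  have h3 := h1.hasMFDerivAt.comp (a : BlockUpper n) h2.hasMFDerivAt
  have h4 := ((C.contMDiff_act_left ((extChartAt (𝓡 d) u₀).symm y) _).mdifferentiableAt
    (by simp)).hasMFDerivAt.comp (a : BlockUpper n)
    ((contMDiffAt_toUnits a).mdifferentiableAt (by simp)).hasMFDerivAt
  have h5 := congrArg (fun L => L ((a : BlockUpper n) * BlockUpper.mk (toMat X) hX))
    (hasMFDerivAt_unique h3 h4)
  refine h5.trans ?_
  set v := (extChartAt (𝓡 d) u₀).symm y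
  have h6 := C.mfderiv_act_left v a X hX
  have h7 : ∀ b : ParabolicGL n, b = a → ∀ w w' : BlockUpper n, w = w' →
      (mfderiv 𝓘(ℝ, BlockUpper n) (𝓡 d) (C.act v) b w : EuclideanSpace ℝ (Fin d)) =
        mfderiv 𝓘(ℝ, BlockUpper n) (𝓡 d) (C.act v) a w' := by
    rintro b rfl w w' rfl
    rfl
  exact ((h7 _ (toUnits_val a) _ _ (mfderiv_toUnits a _)).trans h6).trans
    (C.constField_actInChart u₀ y a X).symm

/-- Translation by `a` changes `ω⁻¹(X)` into `ω⁻¹(Ad(a⁻¹) X)`. So the field in the chart direction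
which represents a given `ω⁻¹(Y)` must have the coefficient `Ad(b) Y` at `(y, b)`. -/
lemma mfderiv_actInChart_fst (u₀ : 𝒢) {y : EuclideanSpace ℝ (Fin d)}
    (hy : y ∈ (extChartAt (𝓡 d) u₀).target) (a : ParabolicGL n) (X : Sl n) :
    mfderiv 𝓘(ℝ, EuclideanSpace ℝ (Fin d) × BlockUpper n) (𝓡 d) (C.actInChart u₀)
      (y, (a : BlockUpper n)) (frameInChart C.conn u₀ ((extChartAt (𝓡 d) u₀).symm y) X, 0) =
      C.constField (adj a⁻¹ X) (C.actInChart u₀ (y, (a : BlockUpper n))) := by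
  have h1 : MDifferentiableAt 𝓘(ℝ, EuclideanSpace ℝ (Fin d) × BlockUpper n) (𝓡 d)
      (C.actInChart u₀) (y, (a : BlockUpper n)) :=
    (C.contMDiffAt_actInChart u₀ hy a).mdifferentiableAt (by simp)
  have h2 := hasFDerivAt_prodMk_left (𝕜 := ℝ) y (a : BlockUpper n)
  have h3 := h1.hasMFDerivAt.comp y h2.hasMFDerivAt
  have hs : MDifferentiableAt (𝓡 d) (𝓡 d) (extChartAt (𝓡 d) u₀).symm y :=
    ((contMDiffOn_extChartAt_symm (n := ∞) u₀).contMDiffAt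
      ((isOpen_extChartAt_target u₀).mem_nhds hy)).mdifferentiableAt (by simp)
  have h4 := ((C.contMDiff_act_right a ((extChartAt (𝓡 d) u₀).symm y)).mdifferentiableAt
    (by simp)).hasMFDerivAt.comp y hs.hasMFDerivAt
  have h0 : C.actInChart u₀ ∘ (fun y => (y, (a : BlockUpper n))) =
      (fun v => C.act v a) ∘ (extChartAt (𝓡 d) u₀).symm := by
    ext y
    simp [actInChart]
  rw [h0] at h3
  have h5 := congrArg (fun L => L (frameInChart C.conn u₀ ((extChartAt (𝓡 d) u₀).symm y) X))
    (hasMFDerivAt_unique h3 h4)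
  refine h5.trans (Eq.trans ?_ (C.constField_actInChart u₀ y a _).symm)
  have h6 : mfderiv (𝓡 d) (𝓡 d) (extChartAt (𝓡 d) u₀).symm y
      (mfderiv (𝓡 d) (𝓡 d) (extChartAt (𝓡 d) u₀) ((extChartAt (𝓡 d) u₀).symm y)
        ((C.conn ((extChartAt (𝓡 d) u₀).symm y)).symm X)) =
      (C.conn ((extChartAt (𝓡 d) u₀).symm y)).symm X := by
    have : IsManifold (𝓡 d) 1 𝒢 := .of_le (n := ∞) (by simp)
    have h7 := mfderivWithin_extChartAt_symm_comp_mfderiv_extChartAt (I := 𝓡 d) hy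
    rw [modelWithCornersSelf_coe, Set.range_id, mfderivWithin_univ] at h7
    exact congrArg (fun L => L ((C.conn ((extChartAt (𝓡 d) u₀).symm y)).symm X)) h7
  refine Eq.trans ?_ (C.mfderiv_act_conn_symm ((extChartAt (𝓡 d) u₀).symm y) a X)
  exact congrArg (mfderiv (𝓡 d) (𝓡 d) (fun u' => C.act u' a) ((extChartAt (𝓡 d) u₀).symm y)) h6

/-- The adjoint action, extended to the algebra of block upper triangular matrices. -/
def adjExt (Y : Sl n) (b : BlockUpper n) : Sl n :=
  -- `Ring.inverse` and `traceFree` only serve to define the formula at non-units as well; at units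
  -- the trace is already zero.
  traceFree (blockMat b * toMat Y * blockMat (Ring.inverse b))

lemma adjExt_val (Y : Sl n) (a : ParabolicGL n) : adjExt Y (a : BlockUpper n) = adj a Y := by
  apply toMat_injective
  rw [adjExt, toMat_traceFree, Ring.inverse_unit, ← toMat_adj, trace_toMat]
  simp

lemma hasFDerivAt_adjExt (Y : Sl n) :
    HasFDerivAt (adjExt Y) (LinearMap.toContinuousLinearMap (traceFree ∘ₗ
      ((LinearMap.mulRight ℝ (toMat Y) - LinearMap.mulLeft ℝ (toMat Y)) ∘ₗ
        blockMat.toLinearMap))) (1 : BlockUpper n) := by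
  have h1 := hasFDerivAt_ringInverse_one (R := BlockUpper n)
  let B : BlockUpper n →L[ℝ] Mat n := LinearMap.toContinuousLinearMap blockMat.toLinearMap
  let T : Mat n →L[ℝ] Sl n := LinearMap.toContinuousLinearMap traceFree
  have h2 := (T.hasFDerivAt.comp (1 : BlockUpper n)
    (((B.hasFDerivAt (x := (1 : BlockUpper n))).mul_const' (toMat Y)).mul'
      (B.hasFDerivAt.comp (1 : BlockUpper n) h1)))
  refine h2.congr_fderiv ?_
  ext X : 1
  have h3 : traceFree (toMat Y * blockMat (-X) + blockMat X * toMat Y) =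
      traceFree (blockMat X * toMat Y - toMat Y * blockMat X) := by
    rw [map_neg]
    congr 1
    noncomm_ring
  refine Eq.trans ?_ (h3.trans ?_)
  · have hB : B 1 = 1 := map_one blockMat
    have hR : (⇑B ∘ Ring.inverse) 1 = 1 := by
      rw [Function.comp_apply, Ring.inverse_one, hB]
    rw [hB, hR, one_mul]
    change traceFree (toMat Y * blockMat (-X) + blockMat X * toMat Y * 1) = _
    rw [mul_one]
  · simp

/-- The fundamental field of `X ∈ 𝔭` generates right translations, under which `ω` transforms by
`Ad`; so `[ω⁻¹(X), ω⁻¹(Y)] = ω⁻¹([X, Y])`. To see this, both fields are lifted through the action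
map to explicit fields `V`, `W` on the product of a chart and the matrix algebra, where the bracket
is a derivative in a vector space. -/
lemma curvature_of_blockUpper (u : 𝒢) (X Y : Sl n) (hX : toMat X ∈ blockUpperSubalgebra n) :
    C.curvature u X Y = 0 := by
  set φ := extChartAt (𝓡 d) u with hφ
  set p₀ : EuclideanSpace ℝ (Fin d) × BlockUpper n := (φ u, 1) with hp₀
  have hp₀' : p₀ = (φ u, ((1 : ParabolicGL n) : BlockUpper n)) := rfl
  have hu : C.actInChart u p₀ = u := by
    simp [actInChart, hp₀, C.act_one, φ]
  set X' := BlockUpper.mk (toMat X) hX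
  set Ω : EuclideanSpace ℝ (Fin d) → Sl n →L[ℝ] EuclideanSpace ℝ (Fin d) :=
    fun y => frameInChart C.conn u (φ.symm y) with hΩ
  have hΩs : ContDiffAt ℝ ∞ Ω (φ u) := by
    refine ContMDiffAt.contDiffAt (ContMDiffAt.comp (φ u)
      (g := frameInChart C.conn u) ?_ (contMDiffAt_extChartAt_symm u))
    rw [extChartAt_to_inv]
    exact contMDiffAt_frameInChart C.contMDiff_conn u
  set V : EuclideanSpace ℝ (Fin d) × BlockUpper n → EuclideanSpace ℝ (Fin d) × BlockUpper n :=
    fun p => (0, p.2 * X') with hV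
  set W : EuclideanSpace ℝ (Fin d) × BlockUpper n → EuclideanSpace ℝ (Fin d) × BlockUpper n :=
    fun p => (Ω p.1 (adjExt Y p.2), 0) with hW
  have hVd : HasFDerivAt V ((0 : _ →L[ℝ] EuclideanSpace ℝ (Fin d)).prod
      (((ContinuousLinearMap.mul ℝ (BlockUpper n)).flip X').comp
        (ContinuousLinearMap.snd ℝ _ _))) p₀ :=
    (hasFDerivAt_const _ _).prodMk
      (((ContinuousLinearMap.mul ℝ (BlockUpper n)).flip X').hasFDerivAt.comp p₀ hasFDerivAt_snd)
  have hΩd := (hΩs.differentiableAt (by simp)).hasFDerivAt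
  have hAd : HasFDerivAt (fun p : EuclideanSpace ℝ (Fin d) × BlockUpper n => adjExt Y p.2) _ p₀ :=
    HasFDerivAt.comp (g := adjExt Y) p₀ (hasFDerivAt_adjExt Y) hasFDerivAt_snd
  have hWd : HasFDerivAt W _ p₀ :=
    ((HasFDerivAt.comp (g := Ω) p₀ hΩd hasFDerivAt_fst).clm_apply hAd).prodMk (hasFDerivAt_const 0 p₀)
  -- At `p₀` the derivative of `W` along `V = (0, X)` differentiates only `Ad(b) Y`, which gives `XY
  -- - YX`; the derivative of `V` along `W` vanishes, as `W` has no component in the algebra.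
  have hbr : lieBracket ℝ V W p₀ = (Ω (φ u) (slBracket X Y), 0) := by
    rw [lieBracket, hVd.fderiv, hWd.fderiv]
    have h : traceFree (toMat X * toMat Y) - traceFree (toMat Y * toMat X) = slBracket X Y := by
      rw [← map_sub]
      apply toMat_injective
      rw [toMat_traceFree, ← toMat_slBracket, trace_toMat]
      simp
    simp only [hV, hW, hp₀]
    rw [← h]
    simp [X']
  have hnear : ∀ᶠ p in nhds p₀, p.1 ∈ φ.target ∧ ∃ a : ParabolicGL n, p.2 = (a : BlockUpper n) := by
    refine Filter.Eventually.and ?_ ?_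
    · exact continuousAt_fst.eventually
        ((isOpen_extChartAt_target u).mem_nhds (mem_extChartAt_target u))
    · filter_upwards [continuousAt_snd.eventually
        ((Units.isOpen (R := BlockUpper n)).mem_nhds (isUnit_one : (1 : BlockUpper n) ∈ {x | IsUnit x}))]
        with p hp
      obtain ⟨a, ha⟩ := hp
      exact ⟨a, ha.symm⟩
  have hVV : ∀ᶠ p in nhds p₀, mfderiv 𝓘(ℝ, EuclideanSpace ℝ (Fin d) × BlockUpper n) (𝓡 d)
      (C.actInChart u) p (V p) = C.constField X (C.actInChart u p) := by
    filter_upwards [hnear]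
    rintro ⟨y, b⟩ ⟨hy, a, rfl⟩
    exact C.mfderiv_actInChart_snd u hy a X hX
  have hWW : ∀ᶠ p in nhds p₀, mfderiv 𝓘(ℝ, EuclideanSpace ℝ (Fin d) × BlockUpper n) (𝓡 d)
      (C.actInChart u) p (W p) = C.constField Y (C.actInChart u p) := by
    filter_upwards [hnear]
    rintro ⟨y, b⟩ ⟨hy, a, rfl⟩
    have h := C.mfderiv_actInChart_fst u hy a (adj a Y)
    rw [adj_inv_adj] at h
    rw [← h]
    simp only [hW, hΩ, adjExt_val]
    rfl
  have hmain := mlieBracket_mfderiv_of_related (f := C.actInChart u) (x := p₀)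
    (V := V) (W := W) (V' := C.constField X) (W' := C.constField Y)
    (C.contMDiffAt_actInChart u (mem_extChartAt_target u) 1)
    (mdifferentiableAt_vectorField_of_differentiableAt hVd.differentiableAt)
    (mdifferentiableAt_vectorField_of_differentiableAt hWd.differentiableAt)
    (C.mdifferentiableAt_constField _ _) (C.mdifferentiableAt_constField _ _) hVV hWW
  rw [(mlieBracket_eq_lieBracket V W p₀).trans hbr] at hmain
  have h2 := C.mfderiv_actInChart_fst u (mem_extChartAt_target u) 1 (slBracket X Y)
  have h3 := hmain.symm.trans h2
  have h4 := (congrArg (C.conn (C.actInChart u p₀)) h3).trans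
    ((C.conn (C.actInChart u p₀)).apply_symm_apply _)
  have h5 : adj (1 : ParabolicGL n)⁻¹ (slBracket X Y) = slBracket X Y := by
    apply toMat_injective
    simp
  rw [hu, h5] at h4
  rw [curvature, h4, sub_self]

end CartanGeometry

/-! ### The map from `𝒢` to `End (TM)`: smoothness and vertical derivative -/

lemma mfderiv_comp_eq_zero {E E' E'' H H' H'' X X' X'' : Type*}
    [NormedAddCommGroup E] [NormedSpace ℝ E] [TopologicalSpace H] {I : ModelWithCorners ℝ E H}
    [TopologicalSpace X] [ChartedSpace H X]
    [NormedAddCommGroup E'] [NormedSpace ℝ E'] [TopologicalSpace H'] {I' : ModelWithCorners ℝ E' H'}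
    [TopologicalSpace X'] [ChartedSpace H' X']
    [NormedAddCommGroup E''] [NormedSpace ℝ E''] [TopologicalSpace H'']
    {I'' : ModelWithCorners ℝ E'' H''} [TopologicalSpace X''] [ChartedSpace H'' X'']
    {g : X' → X''} {f : X → X'} {x : X} {v : TangentSpace I x}
    (hg : MDifferentiableAt I' I'' g (f x)) (hf : MDifferentiableAt I I' f x)
    (hv : mfderiv I I' f x v = 0) : mfderiv I I'' (g ∘ f) x v = 0 := by
  rw [mfderiv_comp_apply x hg hf, hv, map_zero]

lemma hasFDerivAt_conj_upperLeft {n : ℕ} (S : Matrix (Fin 2) (Fin 2) ℝ) :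
    HasFDerivAt (fun b : BlockUpper n => upperLeft b * S * upperLeft (Ring.inverse b))
      (LinearMap.toContinuousLinearMap ((LinearMap.mulRight ℝ S - LinearMap.mulLeft ℝ S) ∘ₗ
        upperLeft.toLinearMap)) (1 : BlockUpper n) := by
  let U : BlockUpper n →L[ℝ] Matrix (Fin 2) (Fin 2) ℝ :=
    LinearMap.toContinuousLinearMap upperLeft.toLinearMap
  have hU : U 1 = 1 := map_one upperLeft
  have hR : (⇑U ∘ Ring.inverse) 1 = 1 := by rw [Function.comp_apply, Ring.inverse_one, hU]
  have h := ((U.hasFDerivAt (x := (1 : BlockUpper n))).mul_const' S).mul'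
    (U.hasFDerivAt.comp (1 : BlockUpper n) (hasFDerivAt_ringInverse_one (R := BlockUpper n)))
  refine h.congr_fderiv ?_
  rw [hR, hU, one_mul]
  ext X : 1
  change S * upperLeft (-X) + upperLeft X * S * 1 = upperLeft X * S - S * upperLeft X
  rw [map_neg]
  noncomm_ring

namespace CartanGeometry

variable {n d : ℕ} {M 𝒢 : Type*} [TopologicalSpace M]
  [ChartedSpace (EuclideanSpace ℝ (Fin (2 * n))) M] [IsManifold (𝓡 (2 * n)) ∞ M]
  [TopologicalSpace 𝒢] [ChartedSpace (EuclideanSpace ℝ (Fin d)) 𝒢] [IsManifold (𝓡 d) ∞ 𝒢]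
  (C : CartanGeometry n d M 𝒢)

lemma contMDiff_tangentEquiv (Y : Matrix (Fin n) (Fin 2) ℝ) :
    ContMDiff (𝓡 d) (𝓡 (2 * n)).tangent ∞
      (fun u => (⟨C.proj u, C.tangentEquiv u Y⟩ : TangentBundle (𝓡 (2 * n)) M)) :=
  (C.contMDiff_proj.contMDiff_tangentMap (m := ∞) (by simp)).comp (C.contMDiff_constField (gMinus n Y))

/-- In a trivialization, `stdEnd u S` is the conjugate of a constant endomorphism by the
identification `T u` of `tangentEquiv u` with a matrix. The fixed isomorphism `c` makes `T u` an
endomorphism of a single space, so that its inverse is seen to be smooth. -/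
lemma contMDiff_stdEnd (S : Matrix (Fin 2) (Fin 2) ℝ) :
    ContMDiff (𝓡 d) (endModel n) ∞
      (fun u => (⟨C.proj u, C.stdEnd u S⟩ : EndBundle n M)) := by
  intro u₀
  have : IsManifold (𝓡 (2 * n)) 1 M := .of_le (n := ∞) (by simp)
  set e := trivializationAt (EuclideanSpace ℝ (Fin (2 * n))) (TangentSpace (𝓡 (2 * n)) (M := M))
    (C.proj u₀) with he
  refine (contMDiffAt_hom_bundle _).2 ⟨C.contMDiff_proj u₀, ?_⟩
  let c : EuclideanSpace ℝ (Fin (2 * n)) ≃L[ℝ] Matrix (Fin n) (Fin 2) ℝ := (C.tangentEquiv u₀).symm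
  set T : 𝒢 → EuclideanSpace ℝ (Fin (2 * n)) →L[ℝ] EuclideanSpace ℝ (Fin (2 * n)) := fun u =>
    e.continuousLinearMapAt ℝ (C.proj u) ∘L (C.tangentEquiv u).toContinuousLinearMap ∘L
      c.toContinuousLinearMap with hT
  have hbase : ∀ᶠ u in nhds u₀, C.proj u ∈ e.baseSet :=
    C.contMDiff_proj.continuous.continuousAt.eventually
      (e.open_baseSet.mem_nhds (mem_baseSet_trivializationAt _ _ _))
  have hTs : ContMDiffAt (𝓡 d)
      𝓘(ℝ, EuclideanSpace ℝ (Fin (2 * n)) →L[ℝ] EuclideanSpace ℝ (Fin (2 * n))) ∞ T u₀ := by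
    refine contMDiffAt_clm_of_apply fun Y => ?_
    refine (contMDiffAt_totalSpace.1 (C.contMDiff_tangentEquiv (c Y) u₀)).2.congr_of_eventuallyEq ?_
    filter_upwards [hbase] with u hu
    exact congrFun (e.coe_linearMapAt_of_mem (R := ℝ) hu) _
  have hTe : ∀ u (hu : C.proj u ∈ e.baseSet),
      T u = ((c.trans (C.tangentEquiv u)).trans (e.continuousLinearEquivAt ℝ (C.proj u) hu) :
        EuclideanSpace ℝ (Fin (2 * n)) →L[ℝ] EuclideanSpace ℝ (Fin (2 * n))) := by
    intro u hu
    ext Y : 1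
    exact congrFun (e.coe_linearMapAt_of_mem (R := ℝ) hu) _
  have hu₀ := hbase.self_of_nhds
  have hinv : ContMDiffAt (𝓡 d)
      𝓘(ℝ, EuclideanSpace ℝ (Fin (2 * n)) →L[ℝ] EuclideanSpace ℝ (Fin (2 * n)))
      ∞ (fun u => (T u).inverse) u₀ := by
    have h1 := contDiffAt_map_inverse (n := ∞) ((c.trans (C.tangentEquiv u₀)).trans
      (e.continuousLinearEquivAt ℝ (C.proj u₀) hu₀))
    rw [← hTe u₀ hu₀] at h1
    exact h1.contMDiffAt.comp u₀ hTs
  refine ContMDiffAt.congr_of_eventuallyEq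
    (hTs.clm_comp ((contMDiffAt_const (c := c.symm.toContinuousLinearMap ∘L
      LinearMap.toContinuousLinearMap (mulRightMat S) ∘L c.toContinuousLinearMap)).clm_comp hinv)) ?_
  filter_upwards [hbase] with u hu
  rw [ContinuousLinearMap.inCoordinates_eq hu hu, hTe u hu, ContinuousLinearMap.inverse_equiv]
  ext v : 1
  change _ = e.continuousLinearEquivAt ℝ (C.proj u) hu (C.tangentEquiv u (c (c.symm (mulRightMat S
    (c (c.symm ((C.tangentEquiv u).symm ((e.continuousLinearEquivAt ℝ (C.proj u) hu).symm v))))))))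
  rw [c.apply_symm_apply, c.apply_symm_apply]
  rfl

/-- `stdEnd` as a linear map. -/
def stdEndLinear (u : 𝒢) : Matrix (Fin 2) (Fin 2) ℝ →ₗ[ℝ] TEnd n (C.proj u) where
  toFun := C.stdEnd u
  map_add' S S' := by
    ext v : 1
    simp [stdEnd, mulRightMat, Matrix.mul_add]
  map_smul' r S := by
    ext v : 1
    simp [stdEnd, mulRightMat]

lemma stdEnd_injective (hn : 2 ≤ n) (u : 𝒢) : Function.Injective (C.stdEnd u) := by
  refine (injective_iff_map_eq_zero (C.stdEndLinear u)).2 fun S hS => ?_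
  by_contra h
  exact C.stdEnd_ne_zero hn u h hS

/-- A fundamental vector field which is annihilated by `u ↦ (proj u, stdEnd u S)` commutes
with `S`. -/
lemma upperLeft_commute_of_mfderiv_stdEnd_eq_zero (hn : 2 ≤ n) (u : 𝒢)
    (S : Matrix (Fin 2) (Fin 2) ℝ) (X : Sl n) (hX : toMat X ∈ blockUpperSubalgebra n)
    (h : mfderiv (𝓡 d) (endModel n) (fun u => (⟨C.proj u, C.stdEnd u S⟩ : EndBundle n M)) u
      (C.constField X u) = 0) :
    (toMat X).toBlocks₁₁ * S = S * (toMat X).toBlocks₁₁ := by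
  set Φ := fun u => (⟨C.proj u, C.stdEnd u S⟩ : EndBundle n M) with hΦ
  set X' := BlockUpper.mk (toMat X) hX with hX'
  set e := trivializationAt (EuclideanSpace ℝ (Fin (2 * n)) →L[ℝ] EuclideanSpace ℝ (Fin (2 * n)))
    (fun x : M => TEnd n x) (C.proj u) with he
  have hbase : C.proj u ∈ e.baseSet := mem_baseSet_trivializationAt _ _ _
  let Λ : Matrix (Fin 2) (Fin 2) ℝ →L[ℝ]
      (EuclideanSpace ℝ (Fin (2 * n)) →L[ℝ] EuclideanSpace ℝ (Fin (2 * n))) :=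
    LinearMap.toContinuousLinearMap
      ((e.linearEquivAt ℝ (C.proj u) hbase).toLinearMap ∘ₗ C.stdEndLinear u)
  have hΛ : Function.Injective Λ :=
    (e.linearEquivAt ℝ (C.proj u) hbase).injective.comp (C.stdEnd_injective hn u)
  -- By `stdEnd_act`, in the trivialization the map `Φ` along the orbit of `u` is the conjugation of
  -- `S` followed by the injective linear map `Λ`. Its derivative at the identity is `Λ` of a
  -- commutator.
  set g : BlockUpper n → (EuclideanSpace ℝ (Fin (2 * n)) →L[ℝ] EuclideanSpace ℝ (Fin (2 * n))) :=
    fun b => Λ (upperLeft b * S * upperLeft (Ring.inverse b)) with hg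
  have hgX : fderiv ℝ g 1 X' = Λ ((toMat X).toBlocks₁₁ * S - S * (toMat X).toBlocks₁₁) := by
    have h1 : HasFDerivAt g _ 1 := Λ.hasFDerivAt.comp 1 (hasFDerivAt_conj_upperLeft S)
    rw [h1.fderiv]
    rfl
  have hgq : g =ᶠ[nhds 1] fun b => (e (Φ (C.act u (toUnits b)))).2 := by
    filter_upwards [(Units.isOpen (R := BlockUpper n)).mem_nhds
      (isUnit_one : (1 : BlockUpper n) ∈ {x | IsUnit x})] with b hb
    obtain ⟨a, rfl⟩ := hb
    simp only [hΦ, toUnits_val, C.stdEnd_act u a S, hg, Ring.inverse_unit]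
    rfl
  have h1 : MDifferentiableAt 𝓘(ℝ, BlockUpper n) (𝓡 d) (fun b => C.act u (toUnits b))
      (1 : BlockUpper n) :=
    ((C.contMDiff_act_left u _).mdifferentiableAt (by simp)).comp _
      ((contMDiffAt_toUnits (1 : ParabolicGL n)).mdifferentiableAt (by simp))
  have hact : C.act u (toUnits (1 : BlockUpper n)) = u := by rw [toUnits_one, C.act_one]
  have h1' : mfderiv 𝓘(ℝ, BlockUpper n) (𝓡 d) (fun b => C.act u (toUnits b))
      (1 : BlockUpper n) X' = C.constField X u := by
    have h := mfderiv_comp_apply (1 : BlockUpper n) (I := 𝓘(ℝ, BlockUpper n))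
      (I' := 𝓘(ℝ, BlockUpper n)) (I'' := 𝓡 d) (g := C.act u) (f := toUnits)
      ((C.contMDiff_act_left u _).mdifferentiableAt (by simp))
      ((contMDiffAt_toUnits (1 : ParabolicGL n)).mdifferentiableAt (by simp)) X'
    rw [C.constField_of_blockUpper u X hX]
    refine h.trans ?_
    have h7 : ∀ b : ParabolicGL n, b = 1 → ∀ w w' : BlockUpper n, w = w' →
        (mfderiv 𝓘(ℝ, BlockUpper n) (𝓡 d) (C.act u) b w : EuclideanSpace ℝ (Fin d)) =
          mfderiv 𝓘(ℝ, BlockUpper n) (𝓡 d) (C.act u) 1 w' := by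
      rintro b rfl w w' rfl
      rfl
    exact h7 _ toUnits_one _ _ (mfderiv_toUnits (1 : ParabolicGL n) X')
  have h2 : MDifferentiableAt (endModel n)
      𝓘(ℝ, EuclideanSpace ℝ (Fin (2 * n)) →L[ℝ] EuclideanSpace ℝ (Fin (2 * n)))
      (fun p : EndBundle n M => (e p).2) (Φ u) := by
    have h := (e.contMDiffOn (IB := 𝓡 (2 * n)) (n := ∞)).contMDiffAt
      (e.open_source.mem_nhds (e.mem_source.2 (show (Φ u).1 ∈ e.baseSet from hbase)))
    exact (contMDiff_snd.contMDiffAt.comp _ h).mdifferentiableAt (by simp)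
  have h3 : MDifferentiableAt (𝓡 d) (endModel n) Φ u :=
    (C.contMDiff_stdEnd S u).mdifferentiableAt (by simp)
  have h4 : mfderiv 𝓘(ℝ, BlockUpper n)
      𝓘(ℝ, EuclideanSpace ℝ (Fin (2 * n)) →L[ℝ] EuclideanSpace ℝ (Fin (2 * n)))
      (fun b => (e (Φ (C.act u (toUnits b)))).2) 1 X' = 0 := by
    have h5 : ∀ v, v = u → ∀ w : EuclideanSpace ℝ (Fin d), w = C.constField X u →
        (MDifferentiableAt (𝓡 d) (endModel n) Φ v ∧ MDifferentiableAt (endModel n)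
          𝓘(ℝ, EuclideanSpace ℝ (Fin (2 * n)) →L[ℝ] EuclideanSpace ℝ (Fin (2 * n)))
          (fun p : EndBundle n M => (e p).2) (Φ v)) ∧
        mfderiv (𝓡 d) (endModel n) Φ v w = 0 := by
      rintro v rfl w rfl
      exact ⟨⟨h3, h2⟩, h⟩
    obtain ⟨⟨h6, h7⟩, h8⟩ := h5 _ hact _ h1'
    exact mfderiv_comp_eq_zero (f := fun b => Φ (C.act u (toUnits b))) h7
      (h6.comp (1 : BlockUpper n) h1) ((mfderiv_comp_apply (1 : BlockUpper n) h6 h1 X').trans h8)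
  rw [← hgq.mfderiv_eq, mfderiv_eq_fderiv] at h4
  have h5 := hgX.symm.trans h4
  exact sub_eq_zero.1 ((map_eq_zero_iff Λ hΛ).1 h5)

section Twistor
variable {Q : AlmostParaquaternionic n M} (hn : 2 ≤ n) (hQ : C.Induces Q)
  {ε : ℝ} (j : EpsComplex ε) [ChartedSpace (EuclideanSpace ℝ (Fin (2 * n + 2))) (Q.Twistor ε)]
    [IsManifold (𝓡 (2 * n + 2)) ∞ (Q.Twistor ε)]

-- Smoothness into an embedded submanifold can be checked in the ambient `End (TM)`.
omit [IsManifold (𝓡 (2 * n + 2)) ∞ (Q.Twistor ε)] in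
lemma contMDiff_twistorProj
    (hZ : Manifold.IsSmoothEmbedding (𝓡 (2 * n + 2)) (Paraquat.endModel n) ∞
      (Subtype.val : Q.Twistor ε → Paraquat.EndBundle n M)) :
    ContMDiff (𝓡 d) (𝓡 (2 * n + 2)) ∞ (C.twistorProj hn hQ j) := by
  have h : ContMDiff (𝓡 d) (endModel n) ∞ (Subtype.val ∘ C.twistorProj hn hQ j) :=
    C.contMDiff_stdEnd j.mat
  exact (ContMDiff.iff_comp_isImmersion hZ.isImmersion).2
    ⟨hZ.isEmbedding.continuous_iff.2 h.continuous, h⟩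

end Twistor
end CartanGeometry

/-! ### The isotropy algebra `𝔯` and right multiplication modulo `𝔯` -/

section Algebra
variable {n : ℕ}

/-- The Lie algebra `𝔯` of the stabilizer of `X ↦ X ∘ S` in the parabolic subgroup. -/
def isotropy (n : ℕ) (S : Matrix (Fin 2) (Fin 2) ℝ) : Submodule ℝ (Sl n) where
  carrier := {X | lowerLeft X = 0 ∧ (toMat X).toBlocks₁₁ * S = S * (toMat X).toBlocks₁₁}
  zero_mem' := ⟨map_zero _, by
    rw [map_zero, show (0 : Mat n).toBlocks₁₁ = 0 from rfl, Matrix.zero_mul, Matrix.mul_zero]⟩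
  add_mem' := by
    rintro X Y ⟨hX, hX'⟩ ⟨hY, hY'⟩
    refine ⟨by rw [map_add, hX, hY, add_zero], ?_⟩
    rw [map_add, show (toMat X + toMat Y).toBlocks₁₁ = (toMat X).toBlocks₁₁ + (toMat Y).toBlocks₁₁
      from rfl, Matrix.add_mul, Matrix.mul_add, hX', hY']
  smul_mem' := by
    rintro r X ⟨hX, hX'⟩
    refine ⟨by rw [map_smul, hX, smul_zero], ?_⟩
    rw [map_smul, show (r • toMat X).toBlocks₁₁ = r • (toMat X).toBlocks₁₁ from rfl,
      Matrix.smul_mul, Matrix.mul_smul, hX']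

lemma mem_isotropy {S : Matrix (Fin 2) (Fin 2) ℝ} {X : Sl n} : X ∈ isotropy n S ↔
    lowerLeft X = 0 ∧ (toMat X).toBlocks₁₁ * S = S * (toMat X).toBlocks₁₁ := Iff.rfl

lemma lowerLeft_traceFree (A : Mat n) : lowerLeft (traceFree A) = A.toBlocks₂₁ := by
  ext i k
  simp [lowerLeft, toMat_traceFree, Matrix.toBlocks₂₁]

/-- Multiples of the identity change neither the lower left block nor the commutator with `S`, so
membership in `𝔯` can be tested on any representative in `𝔤𝔩(2 + n)`. -/
lemma traceFree_mem_isotropy_iff {S : Matrix (Fin 2) (Fin 2) ℝ} {A : Mat n} :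
    traceFree A ∈ isotropy n S ↔
      A.toBlocks₂₁ = 0 ∧ A.toBlocks₁₁ * S = S * A.toBlocks₁₁ := by
  have h : (toMat (traceFree A)).toBlocks₁₁ =
      A.toBlocks₁₁ - (((n : ℝ) + 2)⁻¹ * A.trace) • (1 : Matrix (Fin 2) (Fin 2) ℝ) := by
    ext i k
    simp [toMat_traceFree, Matrix.toBlocks₁₁, Matrix.one_apply]
  rw [mem_isotropy, lowerLeft_traceFree, h, Matrix.sub_mul, Matrix.mul_sub, Matrix.smul_mul,
    Matrix.mul_smul, Matrix.one_mul, Matrix.mul_one, sub_left_inj]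

lemma traceFree_toMat (X : Sl n) : traceFree (toMat X) = X := by
  apply toMat_injective
  simp [toMat_traceFree]

/-- `rightMul` uses the trace-free representative; any other one changes the result by a multiple of
the class of `(S 0; 0 0)`, which lies in `𝔯`. -/
lemma rightMul_traceFree (S : Matrix (Fin 2) (Fin 2) ℝ) (A : Mat n) :
    rightMul S (traceFree A) = traceFree (A * Matrix.fromBlocks S 0 0 0) -
      (((n : ℝ) + 2)⁻¹ * A.trace) • traceFree (Matrix.fromBlocks S 0 0 0) := by
  change traceFree (toMat (traceFree A) * _) = _
  rw [toMat_traceFree, sub_mul, smul_mul_assoc, one_mul, map_sub, map_smul]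

lemma rightMul_apply (S : Matrix (Fin 2) (Fin 2) ℝ) (X : Sl n) :
    rightMul S X = traceFree (toMat X * Matrix.fromBlocks S 0 0 0) := rfl

lemma traceFree_fromBlocks_mem_isotropy (S : Matrix (Fin 2) (Fin 2) ℝ) :
    traceFree (Matrix.fromBlocks S 0 0 0) ∈ isotropy n S :=
  traceFree_mem_isotropy_iff.2 ⟨by simp, by simp⟩

lemma mul_fromBlocks (A : Mat n) (S : Matrix (Fin 2) (Fin 2) ℝ) :
    A * Matrix.fromBlocks S 0 0 0 =
      Matrix.fromBlocks (A.toBlocks₁₁ * S) 0 (A.toBlocks₂₁ * S) 0 := by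
  conv_lhs => rw [← Matrix.fromBlocks_toBlocks A, Matrix.fromBlocks_multiply]
  simp

lemma rightMul_mem_isotropy {S : Matrix (Fin 2) (Fin 2) ℝ} {X : Sl n} (hX : X ∈ isotropy n S) :
    rightMul S X ∈ isotropy n S := by
  obtain ⟨h1, h2⟩ := mem_isotropy.1 hX
  replace h1 : (toMat X).toBlocks₂₁ = 0 := h1
  rw [rightMul_apply, mul_fromBlocks, traceFree_mem_isotropy_iff]
  refine ⟨by simp [h1], ?_⟩
  rw [Matrix.toBlocks_fromBlocks₁₁, h2, Matrix.mul_assoc, h2]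

lemma adj_traceFree (a : ParabolicGL n) (A : Mat n) : adj a (traceFree A) =
    traceFree (blockMat (a : BlockUpper n) * A * blockMat (↑a⁻¹ : BlockUpper n)) := by
  apply toMat_injective
  have h : (blockMat (a : BlockUpper n) * A * blockMat (↑a⁻¹ : BlockUpper n)).trace = A.trace := by
    rw [Matrix.trace_mul_comm, ← mul_assoc, blockMat_inv_mul, one_mul]
  rw [toMat_adj, toMat_traceFree, toMat_traceFree, h, mul_sub, sub_mul, mul_smul_comm,
    smul_mul_assoc, mul_one, blockMat_mul_inv]

/-- When `a₁₁` commutes with `S`, the commutator of `a` with `(S 0; 0 0)` has only an upper right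
block. A product ending in such a matrix has zero first block column, hence lies in `𝔯` modulo the
identity. -/
lemma rightMul_adj_sub_mem_isotropy {S : Matrix (Fin 2) (Fin 2) ℝ} {a : ParabolicGL n}
    (ha : upperLeft (a : BlockUpper n) * S = S * upperLeft (a : BlockUpper n)) (X : Sl n) :
    rightMul S (adj a⁻¹ X) - adj a⁻¹ (rightMul S X) ∈ isotropy n S := by
  rw [rightMul_apply, rightMul_apply, adj_traceFree, ← map_sub, toMat_adj, inv_inv]
  have h : blockMat (a : BlockUpper n) * Matrix.fromBlocks S 0 0 0 -
      Matrix.fromBlocks S 0 0 0 * blockMat (a : BlockUpper n) =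
      Matrix.fromBlocks 0 (-(S * (blockMat (a : BlockUpper n)).toBlocks₁₂)) 0 0 := by
    replace ha : (blockMat (a : BlockUpper n)).toBlocks₁₁ * S =
      S * (blockMat (a : BlockUpper n)).toBlocks₁₁ := ha
    rw [mul_fromBlocks, toBlocks₂₁_blockMat, blockMat_eq_fromBlocks (a : BlockUpper n),
      Matrix.fromBlocks_multiply, sub_eq_add_neg, Matrix.fromBlocks_neg, Matrix.fromBlocks_add]
    simp [ha]
  have h2 : ∀ (B : Mat n) (D : Matrix (Fin 2) (Fin n) ℝ),
      traceFree (B * Matrix.fromBlocks 0 D 0 0) ∈ isotropy n S := by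
    intro B D
    rw [← Matrix.fromBlocks_toBlocks B, Matrix.fromBlocks_multiply]
    exact traceFree_mem_isotropy_iff.2 ⟨by simp, by simp⟩
  convert h2 (blockMat (↑a⁻¹ : BlockUpper n) * toMat X)
    (-(S * (blockMat (a : BlockUpper n)).toBlocks₁₂)) using 2
  rw [← h]
  noncomm_ring

/-- The algebraic part of the Nijenhuis tensor of `rightMul S`. -/
lemma algebraicNijenhuis_mem_isotropy (S : Matrix (Fin 2) (Fin 2) ℝ) (X Y : Sl n) :
    -(rightMul S (rightMul S (slBracket X Y))) - slBracket (rightMul S X) (rightMul S Y)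
      + rightMul S (slBracket (rightMul S X) Y) + rightMul S (slBracket X (rightMul S Y)) ∈
      isotropy n S := by
  have hb : ∀ A B : Mat n, slBracket (traceFree A) (traceFree B) = traceFree (A * B - B * A) := by
    intro A B
    apply toMat_injective
    rw [toMat_slBracket, toMat_traceFree, toMat_traceFree, toMat_traceFree, Matrix.trace_sub,
      Matrix.trace_mul_comm, sub_self, mul_zero, zero_smul, sub_zero]
    simp only [sub_mul, mul_sub, smul_mul_assoc, mul_smul_comm, one_mul, mul_one]
    module
  have hr : ∀ A B : Mat n, rightMul S (traceFree (A * B - B * A)) =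
      traceFree ((A * B - B * A) * Matrix.fromBlocks S 0 0 0) := by
    intro A B
    rw [rightMul_traceFree, Matrix.trace_sub, Matrix.trace_mul_comm, sub_self, mul_zero, zero_smul,
      sub_zero]
  set e : Mat n := Matrix.fromBlocks S 0 0 0 with he
  set x := toMat X
  set y := toMat Y
  -- Commutators have trace zero, so a correction appears only when `rightMul` is applied twice: the
  -- trace of `(xy - yx)e` need not vanish.
  set c : ℝ := ((n : ℝ) + 2)⁻¹ * ((x * y - y * x) * e).trace with hc
  have hx : X = traceFree x := (traceFree_toMat X).symm
  have hy : Y = traceFree y := (traceFree_toMat Y).symm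
  have hAx : rightMul S X = traceFree (x * e) := rfl
  have hAy : rightMul S Y = traceFree (y * e) := rfl
  have h1 : rightMul S (rightMul S (slBracket X Y)) =
      traceFree ((x * y - y * x) * e * e) - c • traceFree e := by
    rw [hx, hy, hb, hr, rightMul_traceFree]
  have h2 : slBracket (rightMul S X) (rightMul S Y) =
      traceFree (x * e * (y * e) - y * e * (x * e)) := by rw [hAx, hAy, hb]
  have h3 : rightMul S (slBracket (rightMul S X) Y) =
      traceFree ((x * e * y - y * (x * e)) * e) := by rw [hAx, hy, hb, hr]
  have h4 : rightMul S (slBracket X (rightMul S Y)) =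
      traceFree ((x * (y * e) - y * e * x) * e) := by rw [hAy, hx, hb, hr]
  rw [h1, h2, h3, h4]
  convert (isotropy n S).smul_mem c (traceFree_fromBlocks_mem_isotropy S) using 1
  -- This holds for any three elements of an associative algebra.
  have h5 : -((x * y - y * x) * e * e) - (x * e * (y * e) - y * e * (x * e)) +
      (x * e * y - y * (x * e)) * e + (x * (y * e) - y * e * x) * e = 0 := by noncomm_ring
  have h6 := congrArg traceFree h5
  rw [map_add, map_add, map_sub, map_neg, map_zero] at h6
  rw [← sub_eq_zero, ← h6]
  abel

end Algebra

/-! ### Trace-free `2 × 2` matrices with square `ε` -/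

section TwoByTwo

lemma EpsComplex.entries {ε : ℝ} (j : EpsComplex ε) : ∃ a b c : ℝ, j.mat = !![a, b; c, -a] ∧
    a * a + b * c = ε ∧ (b = 0 → c = 0 → a ≠ 0) := by
  have htr := j.trace_eq_zero
  have hsq := congrFun (congrFun j.mul_self 0) 0
  have hne := j.ne_zero
  obtain ⟨a, b, c, d, hj⟩ : ∃ a b c d : ℝ, j.mat = !![a, b; c, d] :=
    ⟨_, _, _, _, Matrix.eta_fin_two _⟩
  rw [hj] at htr hsq hne
  obtain rfl : d = -a := by
    rw [Matrix.trace_fin_two_of] at htr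
    linarith
  refine ⟨a, b, c, hj, by simpa [Matrix.mul_apply, Fin.sum_univ_two] using hsq, ?_⟩
  rintro rfl rfl rfl
  apply hne
  ext i k
  fin_cases i <;> fin_cases k <;> simp

/-- A two-dimensional space of matrices which is transversal to the centralizer of `j`. -/
lemma EpsComplex.exists_transversal {ε : ℝ} (j : EpsComplex ε) :
    ∃ l : ℝ × ℝ →ₗ[ℝ] Matrix (Fin 2) (Fin 2) ℝ, ∀ p, l p * j.mat = j.mat * l p → p = 0 := by
  obtain ⟨a, b, c, hj, -, ha⟩ := j.entries
  let e (i k : Fin 2) : ℝ →ₗ[ℝ] Matrix (Fin 2) (Fin 2) ℝ := Matrix.singleLinearMap ℝ i k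
  have he : ∀ s t : ℝ, (e 0 0).coprod (e 1 0) (s, t) = !![s, 0; t, 0] ∧
      (e 0 1).coprod (e 1 1) (s, t) = !![0, s; 0, t] ∧
      (e 0 1).coprod (e 1 0) (s, t) = !![0, s; t, 0] := by
    intro s t
    refine ⟨?_, ?_, ?_⟩ <;> ext i k <;> fin_cases i <;> fin_cases k <;> simp [e]
  rw [hj]
  -- The centralizer of `j` is spanned by `1` and `j`. A complement is given by the matrices
  -- supported in the first column if `b ≠ 0`, in the second column if `c ≠ 0`, and off the diagonal
  -- if `j` is diagonal.
  by_cases hb : b = 0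
  · by_cases hc : c = 0
    · refine ⟨(e 0 1).coprod (e 1 0), ?_⟩
      rintro ⟨s, t⟩ h
      rw [(he s t).2.2] at h
      have h01 := congrFun (congrFun h 0) 1
      have h10 := congrFun (congrFun h 1) 0
      have := ha hb hc
      simp [Matrix.mul_apply, Fin.sum_univ_two] at h01 h10
      have hs : a * s = 0 := by linarith
      have ht : a * t = 0 := by linarith
      simp_all
    · refine ⟨(e 0 1).coprod (e 1 1), ?_⟩
      rintro ⟨s, t⟩ h
      rw [(he s t).2.1] at h
      have h00 := congrFun (congrFun h 0) 0
      have h10 := congrFun (congrFun h 1) 0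
      simp [Matrix.mul_apply, Fin.sum_univ_two] at h00 h10
      simp_all
  · refine ⟨(e 0 0).coprod (e 1 0), ?_⟩
    rintro ⟨s, t⟩ h
    rw [(he s t).1] at h
    have h01 := congrFun (congrFun h 0) 1
    have h11 := congrFun (congrFun h 1) 1
    simp [Matrix.mul_apply, Fin.sum_univ_two] at h01 h11
    simp_all

/-- Every trace-free `ε`-complex structure is conjugate to the companion matrix of `x² - ε`. -/
lemma EpsComplex.exists_companion {ε : ℝ} (j : EpsComplex ε) :
    ∃ p : Matrix (Fin 2) (Fin 2) ℝ, IsUnit p.det ∧ j.mat * p = p * !![0, ε; 1, 0] := by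
  obtain ⟨a, b, c, hj, hε, ha⟩ := j.entries
  rw [hj]
  -- The columns of `p` are `v` and `j v` for a cyclic vector `v`: the first basis vector if `c ≠
  -- 0`, the second if `c = 0` and `b ≠ 0`, and their sum if `j` is diagonal.
  by_cases hc : c = 0
  · by_cases hb : b = 0
    · refine ⟨!![1, a; 1, -a], ?_, ?_⟩
      · have := ha hb hc
        rw [Matrix.det_fin_two_of, isUnit_iff_ne_zero]
        intro h
        apply this
        linarith
      · subst hb hc
        ext i k
        fin_cases i <;> fin_cases k <;> simp [Matrix.mul_apply, Fin.sum_univ_two] <;> linarith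
    · refine ⟨!![0, b; 1, -a], ?_, ?_⟩
      · simpa [Matrix.det_fin_two_of, isUnit_iff_ne_zero] using hb
      · ext i k
        fin_cases i <;> fin_cases k <;> simp [Matrix.mul_apply, Fin.sum_univ_two] <;> linarith
  · refine ⟨!![1, a; 0, c], ?_, ?_⟩
    · simpa [Matrix.det_fin_two_of, isUnit_iff_ne_zero] using hc
    · ext i k
      fin_cases i <;> fin_cases k <;> simp [Matrix.mul_apply, Fin.sum_univ_two] <;> linarith

/-- Both are conjugate to the same companion matrix. It matters that the conjugation is in `GL(2,
ℝ)`: under `SL(2, ℝ)` there are two classes when `ε` is `-1` or `0`. -/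
lemma EpsComplex.exists_conj {ε : ℝ} (j j' : EpsComplex ε) :
    ∃ g h : Matrix (Fin 2) (Fin 2) ℝ, g * h = 1 ∧ h * g = 1 ∧ g * j.mat * h = j'.mat := by
  obtain ⟨p, hp, hp'⟩ := j.exists_companion
  obtain ⟨q, hq, hq'⟩ := j'.exists_companion
  have hpp := Matrix.mul_nonsing_inv p hp
  have hpp' := Matrix.nonsing_inv_mul p hp
  have hqq := Matrix.mul_nonsing_inv q hq
  have hqq' := Matrix.nonsing_inv_mul q hq
  refine ⟨q * p⁻¹, p * q⁻¹, ?_, ?_, ?_⟩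
  · rw [Matrix.mul_assoc, ← Matrix.mul_assoc p⁻¹, hpp', Matrix.one_mul, hqq]
  · rw [Matrix.mul_assoc, ← Matrix.mul_assoc q⁻¹, hqq', Matrix.one_mul, hpp]
  · calc q * p⁻¹ * j.mat * (p * q⁻¹) = q * (p⁻¹ * (j.mat * p)) * q⁻¹ := by
          simp only [Matrix.mul_assoc]
      _ = j'.mat * (q * q⁻¹) := by
        rw [hp', ← Matrix.mul_assoc p⁻¹, hpp', Matrix.one_mul, ← hq', Matrix.mul_assoc]
      _ = _ := by rw [hqq, Matrix.mul_one]

lemma exists_upperLeft_eq {n : ℕ} {g h : Matrix (Fin 2) (Fin 2) ℝ} (hgh : g * h = 1)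
    (hhg : h * g = 1) : ∃ a : ParabolicGL n, upperLeft (a : BlockUpper n) = g ∧
      upperLeft (↑a⁻¹ : BlockUpper n) = h := by
  have hm : ∀ k : Matrix (Fin 2) (Fin 2) ℝ,
      (Matrix.fromBlocks k 0 0 1 : Mat n) ∈ blockUpperSubalgebra n := fun k => by
    change Matrix.toBlocks₂₁ _ = 0
    simp
  have h1 : ∀ k l : Matrix (Fin 2) (Fin 2) ℝ, k * l = 1 →
      BlockUpper.mk _ (hm k) * BlockUpper.mk _ (hm l) = 1 := by
    intro k l hkl
    apply blockMat_injective
    rw [map_mul, blockMat_mk, blockMat_mk, Matrix.fromBlocks_multiply, map_one]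
    simp [hkl]
  refine ⟨⟨BlockUpper.mk _ (hm g), BlockUpper.mk _ (hm h), h1 _ _ hgh, h1 _ _ hhg⟩, ?_, ?_⟩
  · exact Matrix.toBlocks_fromBlocks₁₁ g (0 : Matrix _ (Fin n) ℝ) 0 (1 : Matrix (Fin n) (Fin n) ℝ)
  · exact Matrix.toBlocks_fromBlocks₁₁ h (0 : Matrix _ (Fin n) ℝ) 0 (1 : Matrix (Fin n) (Fin n) ℝ)

end TwoByTwo

/-! ### The twistor space as the quotient of `𝒢` by the stabilizer of `j` -/

namespace CartanGeometry

variable {n d : ℕ} {M 𝒢 : Type*} [TopologicalSpace M]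
  [ChartedSpace (EuclideanSpace ℝ (Fin (2 * n))) M] [IsManifold (𝓡 (2 * n)) ∞ M]
  [TopologicalSpace 𝒢] [ChartedSpace (EuclideanSpace ℝ (Fin d)) 𝒢] [IsManifold (𝓡 d) ∞ 𝒢]
  (C : CartanGeometry n d M 𝒢)
  {Q : AlmostParaquaternionic n M} (hn : 2 ≤ n) (hQ : C.Induces Q)
  {ε : ℝ} (j : EpsComplex ε)

omit [IsManifold (𝓡 (2 * n)) ∞ M] in
lemma exists_proj_eq (x : M) : ∃ u, C.proj u = x := by
  obtain ⟨U, -, hx, σ, -, hσ⟩ := C.exists_section x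
  exact ⟨σ x, hσ x hx⟩

/-- The upper left block of `a` is an arbitrary element of `GL(2, ℝ)`, and conjugation by this group
is transitive on the non-zero trace-free `S` with `S² = ε`. -/
lemma twistorProj_surjective : Function.Surjective (C.twistorProj hn hQ j) := by
  rintro ⟨⟨x, A⟩, hA, hA2, hA0⟩
  obtain ⟨u, rfl⟩ := C.exists_proj_eq x
  obtain ⟨S, hS, rfl⟩ := (hQ u A).1 hA
  have hSS : S * S = ε • 1 := by
    apply C.stdEnd_injective hn u
    rw [← C.stdEnd_comp, C.stdEnd_smul_one]
    exact hA2
  have hS0 : S ≠ 0 := by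
    rintro rfl
    exact hA0 (map_zero (C.stdEndLinear u))
  obtain ⟨g, h, hgh, hhg, hS'⟩ := j.exists_conj ⟨S, hS, hSS, hS0⟩
  obtain ⟨a, ha, ha'⟩ := exists_upperLeft_eq (n := n) hgh hhg
  refine ⟨C.act u a, Subtype.ext ((C.stdEnd_act u a j.mat).trans ?_)⟩
  rw [ha, ha', hS']

lemma exists_act_of_twistorProj_eq {u v : 𝒢}
    (h : C.twistorProj hn hQ j u = C.twistorProj hn hQ j v) : ∃ a : ParabolicGL n, v = C.act u a ∧
      upperLeft (a : BlockUpper n) * j.mat = j.mat * upperLeft (a : BlockUpper n) := by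
  have h1 := congrArg Subtype.val h
  obtain ⟨a, rfl⟩ := (C.proj_eq_iff u v).1 (congrArg TotalSpace.proj h1)
  refine ⟨a, rfl, ?_⟩
  have h2 := h1.trans (C.stdEnd_act u a j.mat)
  have h3 := C.stdEnd_injective hn u (eq_of_heq (TotalSpace.mk.inj h2).2)
  conv_rhs => rw [h3]
  rw [Matrix.mul_assoc, upperLeft_inv_mul, Matrix.mul_one]

lemma twistorProj_act {a : ParabolicGL n}
    (ha : upperLeft (a : BlockUpper n) * j.mat = j.mat * upperLeft (a : BlockUpper n)) (u : 𝒢) :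
    C.twistorProj hn hQ j (C.act u a) = C.twistorProj hn hQ j u := by
  refine Subtype.ext ((C.stdEnd_act u a j.mat).trans ?_)
  rw [ha, Matrix.mul_assoc, upperLeft_mul_inv, Matrix.mul_one]
  rfl

variable [ChartedSpace (EuclideanSpace ℝ (Fin (2 * n + 2))) (Q.Twistor ε)]
  (hZ : Manifold.IsSmoothEmbedding (𝓡 (2 * n + 2)) (Paraquat.endModel n) ∞
      (Subtype.val : Q.Twistor ε → Paraquat.EndBundle n M))
include hZ

lemma toTwistorTangent_act {a : ParabolicGL n}
    (ha : upperLeft (a : BlockUpper n) * j.mat = j.mat * upperLeft (a : BlockUpper n)) (u : 𝒢)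
    (X : Sl n) : (C.toTwistorTangent hn hQ j (C.act u a) (adj a⁻¹ X) :
      EuclideanSpace ℝ (Fin (2 * n + 2))) = C.toTwistorTangent hn hQ j u X := by
  have h := mfderiv_comp_apply (I := 𝓡 d) (I' := 𝓡 d) (I'' := 𝓡 (2 * n + 2)) u
    (g := C.twistorProj hn hQ j) (f := fun u' => C.act u' a)
    ((C.contMDiff_twistorProj hn hQ j hZ _).mdifferentiableAt (by simp))
    ((C.contMDiff_act_right a u).mdifferentiableAt (by simp)) ((C.conn u).symm X)
  rw [mfderiv_act_conn_symm] at h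
  have h2 : C.twistorProj hn hQ j ∘ (fun u' => C.act u' a) = C.twistorProj hn hQ j :=
    funext fun v => C.twistorProj_act hn hQ j ha v
  rw [h2] at h
  exact h.symm

/-- A vector killed by `Tp` is killed in `End (TM)` and in `M`. The second fact puts `X` into `𝔭`;
then the first one makes its upper left block commute with `j`. -/
lemma mem_isotropy_of_toTwistorTangent_eq_zero {u : 𝒢} {X : Sl n}
    (h : C.toTwistorTangent hn hQ j u X = 0) : X ∈ isotropy n j.mat := by
  have h1 : mfderiv (𝓡 d) (endModel n) (fun u => (⟨C.proj u, C.stdEnd u j.mat⟩ : EndBundle n M)) u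
      (C.constField X u) = 0 :=
    mfderiv_comp_eq_zero (g := (Subtype.val : Q.Twistor ε → EndBundle n M))
      (f := C.twistorProj hn hQ j)
      ((hZ.contMDiff _).mdifferentiableAt (by simp))
      ((C.contMDiff_twistorProj hn hQ j hZ _).mdifferentiableAt (by simp)) h
  have h2 : C.toTangent u X = 0 :=
    mfderiv_comp_eq_zero (I' := endModel n) (g := (TotalSpace.proj : EndBundle n M → M))
      (f := fun u => (⟨C.proj u, C.stdEnd u j.mat⟩ : EndBundle n M))
      (((Bundle.contMDiff_proj (n := ∞) (fun x : M => TEnd n x)) _).mdifferentiableAt (by simp))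
      ((C.contMDiff_stdEnd j.mat u).mdifferentiableAt (by simp)) h1
  rw [toTangent_eq_tangentEquiv, ContinuousLinearEquiv.map_eq_zero_iff] at h2
  exact ⟨h2, C.upperLeft_commute_of_mfderiv_stdEnd_eq_zero hn u j.mat X
    ((lowerLeft_eq_zero_iff X).1 h2) h1⟩

/-- On a subspace of dimension `2n + 2` meeting `𝔯` only in zero, `L_u` is injective, hence
bijective onto `T𝒵`. That one `Θ` serves all `u` is what yields smooth lifts later. -/
lemma exists_complement : ∃ Θ : Matrix (Fin n) (Fin 2) ℝ × (ℝ × ℝ) →ₗ[ℝ] Sl n,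
    (∀ p, Θ p ∈ isotropy n j.mat → p = 0) ∧
    ∀ u, Function.Bijective (C.toTwistorTangent hn hQ j u ∘ₗ Θ) := by
  obtain ⟨l, hl⟩ := j.exists_transversal
  let B : Matrix (Fin n) (Fin 2) ℝ × (ℝ × ℝ) →ₗ[ℝ] Mat n :=
    { toFun := fun p => Matrix.fromBlocks (l p.2) 0 p.1 0
      map_add' := fun p q => by simp [Matrix.fromBlocks_add]
      map_smul' := fun r p => by simp [Matrix.fromBlocks_smul] }
  have h0 : ∀ p, traceFree (B p) ∈ isotropy n j.mat → p = 0 := by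
    intro p hp
    have h := traceFree_mem_isotropy_iff.1 hp
    simp only [B, LinearMap.coe_mk, AddHom.coe_mk, Matrix.toBlocks_fromBlocks₂₁,
      Matrix.toBlocks_fromBlocks₁₁] at h
    exact Prod.ext h.1 (hl _ h.2)
  refine ⟨traceFree ∘ₗ B, h0, fun u => ?_⟩
  have hinj : Function.Injective (C.toTwistorTangent hn hQ j u ∘ₗ (traceFree ∘ₗ B)) :=
    (injective_iff_map_eq_zero _).2 fun p hp =>
      h0 p (C.mem_isotropy_of_toTwistorTangent_eq_zero hn hQ j hZ hp)
  have : FiniteDimensional ℝ (TangentSpace (𝓡 (2 * n + 2)) (C.twistorProj hn hQ j u)) :=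
    inferInstanceAs (FiniteDimensional ℝ (EuclideanSpace ℝ (Fin (2 * n + 2))))
  refine ⟨hinj, (LinearMap.injective_iff_surjective_of_finrank_eq_finrank ?_).1 hinj⟩
  change _ = Module.finrank ℝ (EuclideanSpace ℝ (Fin (2 * n + 2)))
  simp [Module.finrank_matrix, mul_comm]

lemma toTwistorTangent_surjective (u : 𝒢) : Function.Surjective (C.toTwistorTangent hn hQ j u) := by
  obtain ⟨Θ, -, h⟩ := C.exists_complement hn hQ j hZ
  exact Function.Surjective.of_comp (h u).2

/-- For `X ∈ 𝔯` choose `p` such that `Θ p` and `X` have the same image. Then `Θ p - X` is in the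
kernel, hence in `𝔯`, so `Θ p ∈ 𝔯` and `p = 0`. -/
lemma toTwistorTangent_eq_zero_iff {u : 𝒢} {X : Sl n} :
    C.toTwistorTangent hn hQ j u X = 0 ↔ X ∈ isotropy n j.mat := by
  refine ⟨C.mem_isotropy_of_toTwistorTangent_eq_zero hn hQ j hZ, fun hX => ?_⟩
  obtain ⟨Θ, h0, h⟩ := C.exists_complement hn hQ j hZ
  obtain ⟨p, hp⟩ := (h u).2 (C.toTwistorTangent hn hQ j u X)
  have h1 : Θ p - X ∈ isotropy n j.mat := by
    apply C.mem_isotropy_of_toTwistorTangent_eq_zero hn hQ j hZ (u := u)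
    rw [map_sub, ← hp, LinearMap.comp_apply, sub_self]
  have h2 := h0 p (by simpa using add_mem h1 hX)
  rw [← hp, h2, map_zero]

end CartanGeometry

/-! ### Descent of frame forms: existence and uniqueness of `𝒥` and `𝒯` -/

section Descent

variable {U Z V E : Type*} [AddCommGroup V] [Module ℝ V] [NormedAddCommGroup E] [NormedSpace ℝ E]
  [FiniteDimensional ℝ E] {p : U → Z} {L : U → V →ₗ[ℝ] E}

/-- Choose a point of `U` over each `z` and a right inverse of `L u`; the compatibility `hΦ` makes
these choices irrelevant. -/
lemma existsUnique_linear_descent (hp : Function.Surjective p)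
    (hL : ∀ u, Function.Surjective (L u)) (Φ : U → V →ₗ[ℝ] E)
    (hΦ : ∀ u u' X X', p u = p u' → L u X = L u' X' → Φ u X = Φ u' X') :
    ∃! J : Z → E →L[ℝ] E, ∀ u X, J (p u) (L u X) = Φ u X := by
  choose B hB using fun u => (L u).exists_rightInverse_of_surjective (LinearMap.range_eq_top.2 (hL u))
  refine ⟨fun z => LinearMap.toContinuousLinearMap
    (Φ (Function.surjInv hp z) ∘ₗ B (Function.surjInv hp z)), fun u X => ?_, fun J hJ => ?_⟩
  · exact hΦ _ _ _ _ (Function.surjInv_eq hp _) (LinearMap.congr_fun (hB _) _)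
  · funext z
    obtain ⟨u, rfl⟩ := hp z
    ext v : 1
    obtain ⟨X, rfl⟩ := hL u v
    rw [hJ]
    exact hΦ _ _ _ _ (Function.surjInv_eq hp _).symm (LinearMap.congr_fun (hB _) _).symm

lemma existsUnique_bilinear_descent (hp : Function.Surjective p)
    (hL : ∀ u, Function.Surjective (L u)) (Φ : U → V →ₗ[ℝ] V →ₗ[ℝ] E)
    (hΦ : ∀ u u' X X' Y Y', p u = p u' → L u X = L u' X' → L u Y = L u' Y' →
      Φ u X Y = Φ u' X' Y') :
    ∃! T : Z → E →L[ℝ] E →L[ℝ] E, ∀ u X Y, T (p u) (L u X) (L u Y) = Φ u X Y := by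
  choose B hB using fun u => (L u).exists_rightInverse_of_surjective (LinearMap.range_eq_top.2 (hL u))
  refine ⟨fun z => LinearMap.toContinuousLinearMap (LinearMap.toContinuousLinearMap.toLinearMap ∘ₗ
    (Φ (Function.surjInv hp z)).compl₁₂ (B (Function.surjInv hp z)) (B (Function.surjInv hp z))),
    fun u X Y => ?_, fun T hT => ?_⟩
  · exact hΦ _ _ _ _ _ _ (Function.surjInv_eq hp _) (LinearMap.congr_fun (hB _) _)
      (LinearMap.congr_fun (hB _) _)
  · funext z
    obtain ⟨u, rfl⟩ := hp z
    ext v w : 2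
    obtain ⟨X, rfl⟩ := hL u v
    obtain ⟨Y, rfl⟩ := hL u w
    rw [hT]
    exact hΦ _ _ _ _ _ _ (Function.surjInv_eq hp _).symm (LinearMap.congr_fun (hB _) _).symm
      (LinearMap.congr_fun (hB _) _).symm

end Descent

namespace CartanGeometry

variable {n d : ℕ} {M 𝒢 : Type*} [TopologicalSpace M]
  [ChartedSpace (EuclideanSpace ℝ (Fin (2 * n))) M]
  [TopologicalSpace 𝒢] [ChartedSpace (EuclideanSpace ℝ (Fin d)) 𝒢] [IsManifold (𝓡 d) ∞ 𝒢]
  (C : CartanGeometry n d M 𝒢)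

lemma curvature_swap (u : 𝒢) (X Y : Sl n) : C.curvature u X Y = -C.curvature u Y X := by
  have h : slBracket X Y = -slBracket Y X := by
    apply toMat_injective
    rw [map_neg, toMat_slBracket, toMat_slBracket, neg_sub]
  rw [curvature, curvature, mlieBracket_swap, h, Pi.neg_apply, map_neg]
  abel

lemma curvature_add_left (u : 𝒢) (X X' Y : Sl n) :
    C.curvature u (X + X') Y = C.curvature u X Y + C.curvature u X' Y := by
  have h : slBracket (X + X') Y = slBracket X Y + slBracket X' Y := by
    apply toMat_injective
    simp only [map_add, toMat_slBracket]
    noncomm_ring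
  have h2 : C.constField (X + X') = C.constField X + C.constField X' :=
    funext fun v => map_add (C.conn v).symm X X'
  rw [curvature, curvature, curvature, h, h2, mlieBracket_add_left
    (C.mdifferentiableAt_constField X u) (C.mdifferentiableAt_constField X' u), map_add]
  abel

lemma curvature_smul_left (u : 𝒢) (r : ℝ) (X Y : Sl n) :
    C.curvature u (r • X) Y = r • C.curvature u X Y := by
  have h : slBracket (r • X) Y = r • slBracket X Y := by
    apply toMat_injective
    simp only [map_smul, toMat_slBracket, smul_sub, smul_mul_assoc, mul_smul_comm]
  have h2 : C.constField (r • X) = r • C.constField X :=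
    funext fun v => map_smul (C.conn v).symm r X
  rw [curvature, curvature, h, h2, mlieBracket_const_smul_left
    (C.mdifferentiableAt_constField X u), map_smul, smul_sub]

/-- The curvature as a bilinear map. -/
def curvatureBilin (u : 𝒢) : Sl n →ₗ[ℝ] Sl n →ₗ[ℝ] Sl n :=
  LinearMap.mk₂ ℝ (C.curvature u) (C.curvature_add_left u) (C.curvature_smul_left u)
    (fun X Y Y' => by
      rw [curvature_swap, curvature_add_left, neg_add, ← curvature_swap, ← curvature_swap])
    (fun r X Y => by rw [curvature_swap, curvature_smul_left, ← smul_neg, ← curvature_swap])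

@[simp] lemma curvatureBilin_apply (u : 𝒢) (X Y : Sl n) :
    C.curvatureBilin u X Y = C.curvature u X Y := rfl

/-- Horizontality in each argument, since `𝔯 ⊂ 𝔭`. -/
lemma curvature_congr {u : 𝒢} {S : Matrix (Fin 2) (Fin 2) ℝ} {X X' Y Y' : Sl n}
    (hX : X - X' ∈ isotropy n S) (hY : Y - Y' ∈ isotropy n S) :
    C.curvature u X Y = C.curvature u X' Y' := by
  have h1 := C.curvature_of_blockUpper u (X - X') Y ((lowerLeft_eq_zero_iff _).1 hX.1)
  have h2 := C.curvature_of_blockUpper u (Y - Y') X' ((lowerLeft_eq_zero_iff _).1 hY.1)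
  rw [curvature_swap, neg_eq_zero] at h2
  simp only [← curvatureBilin_apply, map_sub, LinearMap.sub_apply] at h1 h2 ⊢
  rw [sub_eq_zero.1 h1, sub_eq_zero.1 h2]

variable [IsManifold (𝓡 (2 * n)) ∞ M]
  {Q : AlmostParaquaternionic n M} (hn : 2 ≤ n) (hQ : C.Induces Q)
  {ε : ℝ} (j : EpsComplex ε)
  [ChartedSpace (EuclideanSpace ℝ (Fin (2 * n + 2))) (Q.Twistor ε)]
  (hZ : Manifold.IsSmoothEmbedding (𝓡 (2 * n + 2)) (Paraquat.endModel n) ∞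
      (Subtype.val : Q.Twistor ε → Paraquat.EndBundle n M))
include hZ

/-- Two elements of `𝔤` which represent the same tangent vector at two points over the same point
of the twistor space. -/
lemma exists_act_of_toTwistorTangent_eq {u u' : 𝒢}
    (h : C.twistorProj hn hQ j u = C.twistorProj hn hQ j u') :
    ∃ a : ParabolicGL n, u' = C.act u a ∧
      upperLeft (a : BlockUpper n) * j.mat = j.mat * upperLeft (a : BlockUpper n) ∧
      ∀ X X' : Sl n, (C.toTwistorTangent hn hQ j u X : EuclideanSpace ℝ (Fin (2 * n + 2))) =
        C.toTwistorTangent hn hQ j u' X' ↔ adj a⁻¹ X - X' ∈ isotropy n j.mat := by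
  obtain ⟨a, rfl, ha⟩ := C.exists_act_of_twistorProj_eq hn hQ j h
  refine ⟨a, rfl, ha, fun X X' => ?_⟩
  rw [← C.toTwistorTangent_act hn hQ j hZ ha, ← C.toTwistorTangent_eq_zero_iff hn hQ j hZ
    (u := C.act u a), map_sub, sub_eq_zero]
  rfl

theorem existsUnique_canonicalStructure : ∃! J, C.IsCanonicalStructure hn hQ j J := by
  refine existsUnique_linear_descent (E := EuclideanSpace ℝ (Fin (2 * n + 2)))
    (L := fun u => C.toTwistorTangent hn hQ j u) (C.twistorProj_surjective hn hQ j)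
    (C.toTwistorTangent_surjective hn hQ j hZ)
    (fun u => C.toTwistorTangent hn hQ j u ∘ₗ rightMul j.mat) fun u u' X X' hu hX => ?_
  obtain ⟨a, rfl, ha, h⟩ := C.exists_act_of_toTwistorTangent_eq hn hQ j hZ hu
  refine (h _ _).2 ?_
  -- Replace `X'` by `Ad(a⁻¹) X` modulo `𝔯` (`h1`), then move `Ad(a⁻¹)` past `R` (`h2`).
  have h1 := rightMul_mem_isotropy ((h _ _).1 hX)
  have h2 := rightMul_adj_sub_mem_isotropy ha X
  rw [map_sub] at h1
  convert sub_mem h1 h2 using 1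
  abel

theorem existsUnique_twistorTorsion : ∃! T, C.IsTwistorTorsion hn hQ j T := by
  refine existsUnique_bilinear_descent (E := EuclideanSpace ℝ (Fin (2 * n + 2)))
    (L := fun u => C.toTwistorTangent hn hQ j u) (C.twistorProj_surjective hn hQ j)
    (C.toTwistorTangent_surjective hn hQ j hZ)
    (fun u => (C.curvatureBilin u).compr₂ (C.toTwistorTangent hn hQ j u))
    fun u u' X X' Y Y' hu hX hY => ?_
  obtain ⟨a, rfl, ha, h⟩ := C.exists_act_of_toTwistorTangent_eq hn hQ j hZ hu
  refine (h _ _).2 ?_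
  -- Equivariance moves the curvature from `u` to `u a`; horizontality then exchanges arguments
  -- which agree modulo `𝔯`.
  rw [curvatureBilin_apply, curvatureBilin_apply, ← C.curvature_act,
    C.curvature_congr ((h _ _).1 hX) ((h _ _).1 hY), sub_self]
  exact zero_mem _

end CartanGeometry

/-! ### Lifts of vector fields from the twistor space and their brackets -/

lemma exists_local_section {E E' N N' : Type*} [NormedAddCommGroup E] [NormedSpace ℝ E]
    [NormedAddCommGroup E'] [NormedSpace ℝ E'] [FiniteDimensional ℝ E']
    [TopologicalSpace N] [ChartedSpace E N] [IsManifold 𝓘(ℝ, E) ∞ N]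
    [TopologicalSpace N'] [ChartedSpace E' N'] [IsManifold 𝓘(ℝ, E') ∞ N']
    {f : N → N'} {x : N} (hf : ContMDiffAt 𝓘(ℝ, E) 𝓘(ℝ, E') ∞ f x)
    (hs : Function.Surjective (mfderiv 𝓘(ℝ, E) 𝓘(ℝ, E') f x)) :
    ∃ s : N' → N, s (f x) = x ∧ ContMDiffAt 𝓘(ℝ, E') 𝓘(ℝ, E) ∞ s (f x) ∧
      ∀ᶠ y in nhds (f x), f (s y) = y := by
  have : CompleteSpace E' := FiniteDimensional.complete ℝ E'
  set φ := extChartAt 𝓘(ℝ, E) x with hφ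
  set ψ := extChartAt 𝓘(ℝ, E') (f x) with hψ
  set h : E → E' := fun y => ψ (f (φ.symm y)) with hh
  have hφs : ContMDiffAt 𝓘(ℝ, E) 𝓘(ℝ, E) ∞ φ.symm (φ x) := contMDiffAt_extChartAt_symm x
  have hfs : ContMDiffAt 𝓘(ℝ, E) 𝓘(ℝ, E') ∞ f (φ.symm (φ x)) := by
    rw [hφ, extChartAt_to_inv]
    exact hf
  have hψs : ContMDiffAt 𝓘(ℝ, E') 𝓘(ℝ, E') ∞ ψ (f (φ.symm (φ x))) := by
    rw [hφ, extChartAt_to_inv]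
    exact contMDiffAt_extChartAt
  have hhs : ContDiffAt ℝ ∞ h (φ x) :=
    (hψs.comp (φ x) (hfs.comp (φ x) hφs)).contDiffAt
  have hder : mfderiv 𝓘(ℝ, E) 𝓘(ℝ, E') f x = fderiv ℝ h (φ x) := by
    rw [(hf.mdifferentiableAt (by simp)).mfderiv, modelWithCornersSelf_coe, Set.range_id,
      fderivWithin_univ]
    rfl
  obtain ⟨b, hb⟩ := (fderiv ℝ h (φ x)).toLinearMap.exists_rightInverse_of_surjective
    (LinearMap.range_eq_top.2 (by rw [hder] at hs; exact hs))
  -- `k` parametrizes an affine slice on which `f`, read in charts, has derivative the identity, so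
  -- the inverse function theorem applies to `h ∘ k`.
  set k : E' → E := fun w => φ x + LinearMap.toContinuousLinearMap b w with hk
  have hk0 : k 0 = φ x := by simp [hk]
  have hks : ContDiff ℝ ∞ k := contDiff_const.add (ContinuousLinearMap.contDiff _)
  have hkd : HasFDerivAt k (LinearMap.toContinuousLinearMap b) 0 :=
    (ContinuousLinearMap.hasFDerivAt _).const_add _
  have hg : ContDiffAt ℝ ∞ (h ∘ k) 0 := ContDiffAt.comp 0 (by rw [hk0]; exact hhs) hks.contDiffAt
  have hgd : HasFDerivAt (h ∘ k) ((ContinuousLinearEquiv.refl ℝ E' : E' ≃L[ℝ] E') : E' →L[ℝ] E') 0 := by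
    have h1 : HasFDerivAt h (fderiv ℝ h (φ x)) (k 0) := by
      rw [hk0]
      exact (hhs.differentiableAt (by simp)).hasFDerivAt
    refine (h1.comp 0 hkd).congr_fderiv ?_
    ext v
    exact LinearMap.congr_fun hb v
  have hn : (∞ : ℕ∞ω) ≠ 0 := by simp
  set i := hg.localInverse hgd hn with hi
  have hg0 : (h ∘ k) 0 = ψ (f x) := by
    rw [Function.comp_apply, hk0, hh]
    simp only [hφ, extChartAt_to_inv]
  have hi0 : i (ψ (f x)) = 0 := by
    rw [← hg0]
    exact hg.localInverse_apply_image hgd hn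
  have his : ContDiffAt ℝ ∞ i (ψ (f x)) := by
    rw [← hg0]
    exact hg.to_localInverse hgd hn
  have hsx : φ.symm (k (i (ψ (f x)))) = x := by rw [hi0, hk0, hφ, extChartAt_to_inv]
  have hss : ContMDiffAt 𝓘(ℝ, E') 𝓘(ℝ, E) ∞ (fun y => φ.symm (k (i (ψ y)))) (f x) := by
    refine ContMDiffAt.comp (f x) (g := φ.symm) (f := fun y => k (i (ψ y))) ?_
      (hks.contMDiff.contMDiffAt.comp (f x) (his.contMDiffAt.comp (f x) contMDiffAt_extChartAt))
    rw [hi0, hk0]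
    exact hφs
  refine ⟨fun y => φ.symm (k (i (ψ y))), hsx, hss, ?_⟩
  have hinv : ∀ᶠ w in nhds (ψ (f x)), (h ∘ k) (i w) = w := by
    rw [← hg0]
    exact (hg.hasStrictFDerivAt' hgd hn).eventually_right_inverse
  have hsrc : ∀ᶠ y in nhds (f x), y ∈ ψ.source := extChartAt_source_mem_nhds _
  -- The chart `ψ` is injective only on its source, so `f (s y)` must be known to stay there.
  have hsrc' : ∀ᶠ y in nhds (f x), f (φ.symm (k (i (ψ y)))) ∈ ψ.source := by
    have hc : ContinuousAt (fun y => f (φ.symm (k (i (ψ y))))) (f x) :=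
      ContinuousAt.comp (g := f) (f := fun y => φ.symm (k (i (ψ y))))
        (by rw [hsx]; exact hf.continuousAt) hss.continuousAt
    refine hc.eventually ?_
    beta_reduce
    rw [hsx]
    exact hsrc
  filter_upwards [hsrc, hsrc', (continuousAt_extChartAt (I := 𝓘(ℝ, E')) (f x)).eventually hinv]
    with y h1 h2 h3
  exact ψ.injOn h2 h1 h3

section Algebra

/-- As `j² = ε`, the first block column of `X e² - ε X` vanishes; the trace correction is a multiple
of the class of `e`, which is in `𝔯`. -/
lemma rightMul_rightMul_sub_mem_isotropy {n : ℕ} {ε : ℝ} (j : EpsComplex ε) (X : Sl n) :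
    rightMul j.mat (rightMul j.mat X) - ε • X ∈ isotropy n j.mat := by
  have h : rightMul j.mat (rightMul j.mat X) = traceFree (toMat X * Matrix.fromBlocks j.mat 0 0 0 *
      Matrix.fromBlocks j.mat 0 0 0) - (((n : ℝ) + 2)⁻¹ *
        (toMat X * Matrix.fromBlocks j.mat 0 0 0).trace) •
          traceFree (Matrix.fromBlocks j.mat 0 0 0) := by
    rw [rightMul_apply j.mat X, rightMul_traceFree]
  have h1 : traceFree (toMat X * Matrix.fromBlocks j.mat 0 0 0 *
      Matrix.fromBlocks j.mat 0 0 0) - ε • X ∈ isotropy n j.mat := by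
    nth_rw 2 [← traceFree_toMat X]
    rw [← map_smul, ← map_sub, traceFree_mem_isotropy_iff]
    have h2 : (toMat X * Matrix.fromBlocks j.mat 0 0 0 * Matrix.fromBlocks j.mat 0 0 0 -
        ε • toMat X) = Matrix.fromBlocks 0 (-(ε • (toMat X).toBlocks₁₂)) 0
          (-(ε • (toMat X).toBlocks₂₂)) := by
      rw [mul_fromBlocks, mul_fromBlocks]
      conv_lhs => rw [← Matrix.fromBlocks_toBlocks (toMat X)]
      rw [Matrix.fromBlocks_smul, sub_eq_add_neg, Matrix.fromBlocks_neg, Matrix.fromBlocks_add]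
      simp [Matrix.mul_assoc, j.mul_self]
    rw [h2]
    simp
  rw [h, sub_right_comm]
  exact sub_mem h1 ((isotropy n j.mat).smul_mem _ (traceFree_fromBlocks_mem_isotropy j.mat))

end Algebra

lemma contMDiffAt_inverse_apply {E F E' H' X : Type*} [NormedAddCommGroup E] [NormedSpace ℝ E]
    [CompleteSpace E] [NormedAddCommGroup F] [NormedSpace ℝ F]
    [NormedAddCommGroup E'] [NormedSpace ℝ E']
    [TopologicalSpace H'] {I' : ModelWithCorners ℝ E' H'} [TopologicalSpace X] [ChartedSpace H' X]
    {A : X → E →L[ℝ] F} {y : X → F} {x : X} (hA : ContMDiffAt I' 𝓘(ℝ, E →L[ℝ] F) ∞ A x)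
    (hy : ContMDiffAt I' 𝓘(ℝ, F) ∞ y x) (hinv : (A x).IsInvertible) :
    ContMDiffAt I' 𝓘(ℝ, E) ∞ (fun u => (A u).inverse (y u)) x := by
  obtain ⟨e, he⟩ := hinv
  have h := contDiffAt_map_inverse (n := ∞) e
  rw [he] at h
  exact (h.contMDiffAt.comp x hA).clm_apply hy

namespace CartanGeometry

variable {n d : ℕ} {M 𝒢 : Type*} [TopologicalSpace M]
  [ChartedSpace (EuclideanSpace ℝ (Fin (2 * n))) M] [IsManifold (𝓡 (2 * n)) ∞ M]
  [TopologicalSpace 𝒢] [ChartedSpace (EuclideanSpace ℝ (Fin d)) 𝒢] [IsManifold (𝓡 d) ∞ 𝒢]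
  (C : CartanGeometry n d M 𝒢)

omit [IsManifold (𝓡 (2 * n)) ∞ M] in
lemma conn_mlieBracket {f g : 𝒢 → Sl n} {u : 𝒢} (hf : ContMDiffAt (𝓡 d) 𝓘(ℝ, Sl n) ∞ f u)
    (hg : ContMDiffAt (𝓡 d) 𝓘(ℝ, Sl n) ∞ g u) :
    C.conn u (mlieBracket (𝓡 d) (fun y => (C.conn y).symm (f y)) (fun y => (C.conn y).symm (g y)) u) =
      mvfderiv (𝓡 d) g u ((C.conn u).symm (f u)) - mvfderiv (𝓡 d) f u ((C.conn u).symm (g u)) +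
      slBracket (f u) (g u) - C.curvature u (f u) (g u) := by
  rw [parallelism_mlieBracket C.contMDiff_conn hf hg]
  change _ = _ - (slBracket (f u) (g u) - _)
  rw [add_sub_assoc, sub_sub_cancel]
  rfl

variable {Q : AlmostParaquaternionic n M} (hn : 2 ≤ n) (hQ : C.Induces Q)
  {ε : ℝ} (j : EpsComplex ε)
  [ChartedSpace (EuclideanSpace ℝ (Fin (2 * n + 2))) (Q.Twistor ε)]
  [IsManifold (𝓡 (2 * n + 2)) ∞ (Q.Twistor ε)]
  (hZ : Manifold.IsSmoothEmbedding (𝓡 (2 * n + 2)) (Paraquat.endModel n) ∞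
      (Subtype.val : Q.Twistor ε → Paraquat.EndBundle n M))
include hZ

lemma contMDiffAt_toTwistorTangent {E' H' X : Type*} [NormedAddCommGroup E'] [NormedSpace ℝ E']
    [TopologicalSpace H'] {I' : ModelWithCorners ℝ E' H'} [TopologicalSpace X] [ChartedSpace H' X]
    {b : X → 𝒢} {g : X → Sl n} {x : X} (hb : ContMDiffAt I' (𝓡 d) ∞ b x)
    (hg : ContMDiffAt I' 𝓘(ℝ, Sl n) ∞ g x) :
    ContMDiffAt I' (𝓡 (2 * n + 2)).tangent ∞ (fun y => (⟨C.twistorProj hn hQ j (b y),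
      C.toTwistorTangent hn hQ j (b y) (g y)⟩ : TangentBundle (𝓡 (2 * n + 2)) (Q.Twistor ε))) x :=
  ((C.contMDiff_twistorProj hn hQ j hZ).contMDiff_tangentMap (m := ∞) (by simp)).contMDiffAt.comp x
    (C.contMDiffAt_conn_symm hb hg)

set_option maxHeartbeats 1000000 in
/-- Smooth lifts of vector fields on the twistor space. -/
lemma exists_lift (u₀ : 𝒢) (ξ : ∀ w : Q.Twistor ε, TangentSpace (𝓡 (2 * n + 2)) w)
    (hξ : ContMDiffAt (𝓡 (2 * n + 2)) (𝓡 (2 * n + 2)).tangent ∞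
      (fun w => (⟨w, ξ w⟩ : TangentBundle (𝓡 (2 * n + 2)) (Q.Twistor ε)))
      (C.twistorProj hn hQ j u₀)) :
    ∃ f : 𝒢 → Sl n, ContMDiffAt (𝓡 d) 𝓘(ℝ, Sl n) ∞ f u₀ ∧ ∀ᶠ u in nhds u₀,
      C.toTwistorTangent hn hQ j u (f u) = ξ (C.twistorProj hn hQ j u) := by
  have : IsManifold (𝓡 (2 * n + 2)) 1 (Q.Twistor ε) := .of_le (n := ∞) (by simp)
  have hp := C.contMDiff_twistorProj hn hQ j hZ
  obtain ⟨Θ₀, -, hΘ₀⟩ := C.exists_complement hn hQ j hZ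
  let c : EuclideanSpace ℝ (Fin (2 * n + 2)) ≃ₗ[ℝ] Matrix (Fin n) (Fin 2) ℝ × (ℝ × ℝ) :=
    (LinearEquiv.ofBijective _ (hΘ₀ u₀)).symm
  set Θ : EuclideanSpace ℝ (Fin (2 * n + 2)) →L[ℝ] Sl n :=
    LinearMap.toContinuousLinearMap (Θ₀ ∘ₗ c.toLinearMap) with hΘ
  have hΘb : ∀ u, Function.Bijective (fun v => C.toTwistorTangent hn hQ j u (Θ v)) := fun u =>
    (hΘ₀ u).comp c.bijective
  set ψ := extChartAt (𝓡 (2 * n + 2)) (C.twistorProj hn hQ j u₀) with hψ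
  set D : ∀ u : 𝒢, TangentSpace (𝓡 (2 * n + 2)) (C.twistorProj hn hQ j u) →L[ℝ]
      EuclideanSpace ℝ (Fin (2 * n + 2)) :=
    fun u => mvfderiv (𝓡 (2 * n + 2)) ψ (C.twistorProj hn hQ j u) with hD
  -- `A u` is `L_u` on the fixed complement, read in the chart at `p u₀`. It is smooth and
  -- invertible near `u₀`, and solving with it produces the lift.
  set A : 𝒢 → EuclideanSpace ℝ (Fin (2 * n + 2)) →L[ℝ] EuclideanSpace ℝ (Fin (2 * n + 2)) := fun u =>
    D u ∘L mfderiv (𝓡 d) (𝓡 (2 * n + 2)) (C.twistorProj hn hQ j) u ∘L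
      (C.conn u).symm.toContinuousLinearMap ∘L Θ with hA
  have hAs : ContMDiffAt (𝓡 d) 𝓘(ℝ, EuclideanSpace ℝ (Fin (2 * n + 2)) →L[ℝ]
      EuclideanSpace ℝ (Fin (2 * n + 2))) ∞ A u₀ :=
    contMDiffAt_clm_of_apply fun v => (contMDiffAt_tangentBundle_iff.1
      (C.contMDiffAt_toTwistorTangent hn hQ j hZ (b := id) (g := fun _ => Θ v) contMDiffAt_id
        contMDiffAt_const)).2
  have hDinv : ∀ᶠ u in nhds u₀, (D u).IsInvertible := by
    filter_upwards [hp.continuous.continuousAt.eventually (extChartAt_source_mem_nhds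
      (I := 𝓡 (2 * n + 2)) (C.twistorProj hn hQ j u₀))] with u hu
      using isInvertible_mfderiv_extChartAt (I := 𝓡 (2 * n + 2)) hu
  have hAinv : ∀ᶠ u in nhds u₀, (A u).IsInvertible := by
    filter_upwards [hDinv] with u hu
    have h : Function.Bijective (A u) := hu.bijective.comp (hΘb u)
    exact ⟨(LinearEquiv.ofBijective (A u).toLinearMap h).toContinuousLinearEquiv, by ext; rfl⟩
  have hys : ContMDiffAt (𝓡 d) (𝓡 (2 * n + 2)) ∞
      (fun u => D u (ξ (C.twistorProj hn hQ j u))) u₀ :=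
    (contMDiffAt_tangentBundle_iff.1 hξ).2.comp u₀ (hp u₀)
  refine ⟨fun u => Θ ((A u).inverse (D u (ξ (C.twistorProj hn hQ j u)))),
    Θ.contMDiff.contMDiffAt.comp u₀
      (contMDiffAt_inverse_apply hAs hys hAinv.self_of_nhds), ?_⟩
  filter_upwards [hDinv, hAinv] with u hu hu'
  exact hu.injective (hu'.self_apply_inverse _)

/-- A vector field on the twistor space is smooth if it has a smooth lift. -/
lemma contMDiffAt_of_lift {u₀ : 𝒢} {ξ : ∀ w : Q.Twistor ε, TangentSpace (𝓡 (2 * n + 2)) w}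
    {f : 𝒢 → Sl n} (hf : ContMDiffAt (𝓡 d) 𝓘(ℝ, Sl n) ∞ f u₀)
    (h : ∀ᶠ u in nhds u₀, C.toTwistorTangent hn hQ j u (f u) = ξ (C.twistorProj hn hQ j u)) :
    ContMDiffAt (𝓡 (2 * n + 2)) (𝓡 (2 * n + 2)).tangent ∞
      (fun w => (⟨w, ξ w⟩ : TangentBundle (𝓡 (2 * n + 2)) (Q.Twistor ε)))
      (C.twistorProj hn hQ j u₀) := by
  have hsurj : Function.Surjective (mfderiv (𝓡 d) (𝓡 (2 * n + 2)) (C.twistorProj hn hQ j) u₀) :=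
    Function.Surjective.of_comp (g := (C.conn u₀).symm)
      (C.toTwistorTangent_surjective hn hQ j hZ u₀)
  -- Along a local section `s` of `p`, the field is `Tp (ω⁻¹(f))` evaluated at `s`.
  obtain ⟨s, hs, hss, hsp⟩ := exists_local_section (C.contMDiff_twistorProj hn hQ j hZ u₀) hsurj
  have h1 := C.contMDiffAt_toTwistorTangent hn hQ j hZ hss (g := fun w => f (s w))
    (ContMDiffAt.comp (g := f) (C.twistorProj hn hQ j u₀) (by rw [hs]; exact hf) hss)
  refine h1.congr_of_eventuallyEq ?_
  have h2 : ∀ᶠ w in nhds (C.twistorProj hn hQ j u₀), C.toTwistorTangent hn hQ j (s w) (f (s w)) =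
      ξ (C.twistorProj hn hQ j (s w)) := by
    have hc := hss.continuousAt
    rw [ContinuousAt, hs] at hc
    exact hc.eventually h
  filter_upwards [hsp, h2] with w hw hw2
  rw [hw2, hw]

/-- The bracket of two vector fields on the twistor space in terms of smooth lifts. -/
lemma mlieBracket_of_lift {u₀ : 𝒢} {ξ η : ∀ w : Q.Twistor ε, TangentSpace (𝓡 (2 * n + 2)) w}
    {f g : 𝒢 → Sl n} (hf : ContMDiffAt (𝓡 d) 𝓘(ℝ, Sl n) ∞ f u₀)
    (hg : ContMDiffAt (𝓡 d) 𝓘(ℝ, Sl n) ∞ g u₀)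
    (hfξ : ∀ᶠ u in nhds u₀, C.toTwistorTangent hn hQ j u (f u) = ξ (C.twistorProj hn hQ j u))
    (hgη : ∀ᶠ u in nhds u₀, C.toTwistorTangent hn hQ j u (g u) = η (C.twistorProj hn hQ j u)) :
    mlieBracket (𝓡 (2 * n + 2)) ξ η (C.twistorProj hn hQ j u₀) = C.toTwistorTangent hn hQ j u₀
      (mvfderiv (𝓡 d) g u₀ ((C.conn u₀).symm (f u₀)) - mvfderiv (𝓡 d) f u₀ ((C.conn u₀).symm (g u₀)) +
      slBracket (f u₀) (g u₀) - C.curvature u₀ (f u₀) (g u₀)) := by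
  rw [← C.conn_mlieBracket hf hg]
  have h := mlieBracket_mfderiv_of_related (f := C.twistorProj hn hQ j) (x := u₀)
    (V := fun y => (C.conn y).symm (f y)) (W := fun y => (C.conn y).symm (g y)) (V' := ξ) (W' := η)
    (C.contMDiff_twistorProj hn hQ j hZ u₀)
    ((C.contMDiffAt_conn_symm contMDiffAt_id hf).mdifferentiableAt (by simp))
    ((C.contMDiffAt_conn_symm contMDiffAt_id hg).mdifferentiableAt (by simp))
    ((C.contMDiffAt_of_lift hn hQ j hZ hf hfξ).mdifferentiableAt (by simp))
    ((C.contMDiffAt_of_lift hn hQ j hZ hg hgη).mdifferentiableAt (by simp)) hfξ hgη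
  rw [← h]
  change _ = mfderiv _ _ _ _ ((C.conn u₀).symm (C.conn u₀ _))
  rw [ContinuousLinearEquiv.symm_apply_apply]

end CartanGeometry

/-! ### The Nijenhuis tensor and the torsion -/

/-- The Nijenhuis tensor of an endomorphism of a quotient `L : V → W`, up to terms which vanish. -/
lemma nijenhuis_of_quotient {V W : Type*} [AddCommGroup V] [Module ℝ V] [AddCommGroup W]
    [Module ℝ W] (L : V →ₗ[ℝ] W) (R : V →ₗ[ℝ] V) (J : W →ₗ[ℝ] W) (T : W → W → W) (B κ : V → V → V)
    (hJ : ∀ X, J (L X) = L (R X)) (hT : ∀ X Y, T (L X) (L Y) = L (κ X Y)) (ε : ℝ) (f g : V)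
    (hB : L (-(R (R (B f g))) - B (R f) (R g) + R (B (R f) g) + R (B f (R g))) = 0)
    -- In the application `a, b, c, d` are `D_f g`, `D_g f`, `D_{Rf} g`, `D_{Rg} f`, and `b₁, …, b₄`
    -- are the brackets `[ξ, η]`, `[𝒥ξ, 𝒥η]`, `[𝒥ξ, η]`, `[ξ, 𝒥η]`.
    (hR : L (R (R (κ f g)) - ε • κ f g) = 0) {a b c d : V} {v w b₁ b₂ b₃ b₄ : W}
    (hv : L f = v) (hw : L g = w) (h₁ : b₁ = L (a - b + B f g - κ f g))
    (h₂ : b₂ = L (R c - R d + B (R f) (R g) - κ (R f) (R g)))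
    (h₃ : b₃ = L (c - R b + B (R f) g - κ (R f) g))
    (h₄ : b₄ = L (R a - d + B f (R g) - κ f (R g))) :
    -(J (J b₁)) - b₂ + J b₃ + J b₄ =
      ε • T v w + T (J v) (J w) - J (T (J v) w) - J (T v (J w)) := by
  subst hv hw h₁ h₂ h₃ h₄
  simp only [hJ, hT]
  simp only [map_add, map_sub, map_neg, map_smul] at hB hR ⊢
  rw [← sub_eq_zero.1 hR, ← sub_eq_zero, ← hB]
  abel

/-- `rightMul` as a continuous linear map. -/
def rightMulL {n : ℕ} (S : Matrix (Fin 2) (Fin 2) ℝ) : Sl n →L[ℝ] Sl n :=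
  LinearMap.toContinuousLinearMap (rightMul S)

lemma rightMulL_apply {n : ℕ} (S : Matrix (Fin 2) (Fin 2) ℝ) (X : Sl n) :
    rightMulL S X = rightMul S X := rfl

lemma mvfderiv_continuousLinearMap_comp {E F G H X : Type*} [NormedAddCommGroup E] [NormedSpace ℝ E]
    [TopologicalSpace H] {I : ModelWithCorners ℝ E H} [TopologicalSpace X] [ChartedSpace H X]
    [NormedAddCommGroup F] [NormedSpace ℝ F] [NormedAddCommGroup G] [NormedSpace ℝ G]
    (R : F →L[ℝ] G) {f : X → F} {x : X} (hf : MDifferentiableAt I 𝓘(ℝ, F) f x)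
    (v : TangentSpace I x) : mvfderiv I (fun y => R (f y)) x v = R (mvfderiv I f x v) := by
  have h := mfderiv_comp_apply (I'' := 𝓘(ℝ, G)) (g := R) x R.mdifferentiableAt hf v
  rw [ContinuousLinearMap.mfderiv_eq] at h
  exact h

namespace CartanGeometry

variable {n d : ℕ} {M 𝒢 : Type*} [TopologicalSpace M]
  [ChartedSpace (EuclideanSpace ℝ (Fin (2 * n))) M] [IsManifold (𝓡 (2 * n)) ∞ M]
  [TopologicalSpace 𝒢] [ChartedSpace (EuclideanSpace ℝ (Fin d)) 𝒢] [IsManifold (𝓡 d) ∞ 𝒢]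
  (C : CartanGeometry n d M 𝒢)

variable {Q : AlmostParaquaternionic n M} (hn : 2 ≤ n) (hQ : C.Induces Q)
  {ε : ℝ} (j : EpsComplex ε)
  [ChartedSpace (EuclideanSpace ℝ (Fin (2 * n + 2))) (Q.Twistor ε)]
  [IsManifold (𝓡 (2 * n + 2)) ∞ (Q.Twistor ε)]

variable {J : ∀ z : Q.Twistor ε, TangentSpace (𝓡 (2 * n + 2)) z →L[ℝ] TangentSpace (𝓡 (2 * n + 2)) z}
  {T : ∀ z : Q.Twistor ε, TangentSpace (𝓡 (2 * n + 2)) z →L[ℝ]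
      TangentSpace (𝓡 (2 * n + 2)) z →L[ℝ] TangentSpace (𝓡 (2 * n + 2)) z}

omit [IsManifold (𝓡 (2 * n + 2)) ∞ (Q.Twistor ε)] in
/-- The action of the canonical structure on lifts. -/
lemma lift_canonicalStructure (hJ : C.IsCanonicalStructure hn hQ j J) {u₀ : 𝒢} {f : 𝒢 → Sl n}
    {ξ : ∀ w : Q.Twistor ε, TangentSpace (𝓡 (2 * n + 2)) w}
    (hfξ : ∀ᶠ u in nhds u₀, C.toTwistorTangent hn hQ j u (f u) = ξ (C.twistorProj hn hQ j u)) :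
    ∀ᶠ u in nhds u₀, C.toTwistorTangent hn hQ j u (rightMulL j.mat (f u)) =
      J (C.twistorProj hn hQ j u) (ξ (C.twistorProj hn hQ j u)) := by
  filter_upwards [hfξ] with v hv
  rw [rightMulL_apply, ← hJ, hv]

variable (hZ : Manifold.IsSmoothEmbedding (𝓡 (2 * n + 2)) (Paraquat.endModel n) ∞
      (Subtype.val : Q.Twistor ε → Paraquat.EndBundle n M))
include hZ

set_option maxHeartbeats 1000000 in
lemma nijenhuis_of_lift (hJ : C.IsCanonicalStructure hn hQ j J) (hT : C.IsTwistorTorsion hn hQ j T)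
    (u : 𝒢) {ξ η : ∀ w : Q.Twistor ε, TangentSpace (𝓡 (2 * n + 2)) w} {f g : 𝒢 → Sl n}
    (hf : ContMDiffAt (𝓡 d) 𝓘(ℝ, Sl n) ∞ f u) (hg : ContMDiffAt (𝓡 d) 𝓘(ℝ, Sl n) ∞ g u)
    (hfξ : ∀ᶠ u in nhds u, C.toTwistorTangent hn hQ j u (f u) = ξ (C.twistorProj hn hQ j u))
    (hgη : ∀ᶠ u in nhds u, C.toTwistorTangent hn hQ j u (g u) = η (C.twistorProj hn hQ j u)) :
    let z := C.twistorProj hn hQ j u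
    nijenhuis (𝓡 (2 * n + 2)) J ξ η z = ε • T z (ξ z) (η z) + T z (J z (ξ z)) (J z (η z)) -
      J z (T z (J z (ξ z)) (η z)) - J z (T z (ξ z) (J z (η z))) := by
  intro z
  have hR : ∀ f : 𝒢 → Sl n, ContMDiffAt (𝓡 d) 𝓘(ℝ, Sl n) ∞ f u →
      ContMDiffAt (𝓡 d) 𝓘(ℝ, Sl n) ∞ (fun v => rightMulL j.mat (f v)) u := fun f hf =>
    (rightMulL j.mat).contMDiff.contMDiffAt.comp u hf
  have hd : ∀ f : 𝒢 → Sl n, ContMDiffAt (𝓡 d) 𝓘(ℝ, Sl n) ∞ f u → ∀ v,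
      mvfderiv (𝓡 d) (fun v => rightMulL j.mat (f v)) u v =
        rightMulL j.mat (mvfderiv (𝓡 d) f u v) := fun f hf v =>
    mvfderiv_continuousLinearMap_comp _ (hf.mdifferentiableAt (by simp)) v
  have hJf := C.lift_canonicalStructure hn hQ j hJ hfξ
  have hJg := C.lift_canonicalStructure hn hQ j hJ hgη
  have e1 := C.mlieBracket_of_lift hn hQ j hZ hf hg hfξ hgη
  have e2 := C.mlieBracket_of_lift hn hQ j hZ (ξ := fun w => J w (ξ w)) (η := fun w => J w (η w))
    (hR f hf) (hR g hg) hJf hJg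
  have e3 := C.mlieBracket_of_lift hn hQ j hZ (ξ := fun w => J w (ξ w)) (hR f hf) hg hJf hgη
  have e4 := C.mlieBracket_of_lift hn hQ j hZ (η := fun w => J w (η w)) hf (hR g hg) hfξ hJg
  -- Pulling the constant map `R` out of the derivatives leaves only four of them, which cancel in
  -- the Nijenhuis tensor.
  rw [hd f hf, hd g hg] at e2
  rw [hd f hf] at e3
  rw [hd g hg] at e4
  exact nijenhuis_of_quotient (C.toTwistorTangent hn hQ j u) (rightMul j.mat) (J z).toLinearMap
    (fun v w => T z v w) slBracket (C.curvature u) (hJ u) (hT u) ε (f u) (g u)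
    ((C.toTwistorTangent_eq_zero_iff hn hQ j hZ).2
      (algebraicNijenhuis_mem_isotropy j.mat (f u) (g u)))
    ((C.toTwistorTangent_eq_zero_iff hn hQ j hZ).2
      (rightMul_rightMul_sub_mem_isotropy j (C.curvature u (f u) (g u))))
    hfξ.self_of_nhds hgη.self_of_nhds e1 e2 e3 e4

lemma nijenhuis_eq (hJ : C.IsCanonicalStructure hn hQ j J) (hT : C.IsTwistorTorsion hn hQ j T)
    (u : 𝒢) (ξ η : ∀ w : Q.Twistor ε, TangentSpace (𝓡 (2 * n + 2)) w)
    (hξ : ContMDiffAt (𝓡 (2 * n + 2)) (𝓡 (2 * n + 2)).tangent ∞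
      (fun w => (⟨w, ξ w⟩ : TangentBundle (𝓡 (2 * n + 2)) (Q.Twistor ε)))
      (C.twistorProj hn hQ j u))
    (hη : ContMDiffAt (𝓡 (2 * n + 2)) (𝓡 (2 * n + 2)).tangent ∞
      (fun w => (⟨w, η w⟩ : TangentBundle (𝓡 (2 * n + 2)) (Q.Twistor ε)))
      (C.twistorProj hn hQ j u)) :
    let z := C.twistorProj hn hQ j u
    nijenhuis (𝓡 (2 * n + 2)) J ξ η z = ε • T z (ξ z) (η z) + T z (J z (ξ z)) (J z (η z)) -
      J z (T z (J z (ξ z)) (η z)) - J z (T z (ξ z) (J z (η z))) := by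
  intro z
  exact (C.exists_lift hn hQ j hZ u ξ hξ).elim fun f hf =>
    (C.exists_lift hn hQ j hZ u η hη).elim fun g hg =>
      C.nijenhuis_of_lift hn hQ j hZ hJ hT u hf.1 hg.1 hf.2 hg.2

end CartanGeometry

/-- Here `s = -ε`. For `ε = ±1` the factor is `4ε` and `4ε / (4s) = -1`; for `ε = 0` it is `-4` and
`-4 / 4 = -1`. In all cases the expression in the `(0,2)`-part just changes sign. -/
theorem zeroTwoPart_eq {W : Type*} [AddCommGroup W] [Module ℝ W] [TopologicalSpace W]
    [IsTopologicalAddGroup W] [ContinuousConstSMul ℝ W] {ε : ℝ} (hε : ε = -1 ∨ ε = 0 ∨ ε = 1)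
    (A : W →L[ℝ] W) (φ : W →L[ℝ] W →L[ℝ] W) (X Y : W) :
    (if ε = 1 then (4 : ℝ) else -4) • zeroTwoPart (-ε) A φ X Y =
      ε • φ X Y + φ (A X) (A Y) - A (φ (A X) Y) - A (φ X (A Y)) := by
  rcases hε with rfl | rfl | rfl <;> norm_num [zeroTwoPart] <;> module

end Paraquat

end

theorem mainTheorem4 {n d : ℕ} (hn : 2 ≤ n) {M 𝒢 : Type*}
    [TopologicalSpace M] [ChartedSpace (EuclideanSpace ℝ (Fin (2 * n))) M]
    [IsManifold (𝓡 (2 * n)) ∞ M]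
    [TopologicalSpace 𝒢] [ChartedSpace (EuclideanSpace ℝ (Fin d)) 𝒢] [IsManifold (𝓡 d) ∞ 𝒢]
    (Q : Paraquat.AlmostParaquaternionic n M)
    (C : Paraquat.CartanGeometry n d M 𝒢) (_hnormal : C.IsNormal) (hQ : C.Induces Q)
    (ε : ℝ) (_hε : ε = -1 ∨ ε = 0 ∨ ε = 1) (j : Paraquat.EpsComplex ε)
    -- the manifold structure of the twistor space as an embedded submanifold of `End (TM)`
    [ChartedSpace (EuclideanSpace ℝ (Fin (2 * n + 2))) (Q.Twistor ε)]
    [IsManifold (𝓡 (2 * n + 2)) ∞ (Q.Twistor ε)]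
    (_hZ : Manifold.IsSmoothEmbedding (𝓡 (2 * n + 2)) (Paraquat.endModel n) ∞
      (Subtype.val : Q.Twistor ε → Paraquat.EndBundle n M)) :
    (∃! J, C.IsCanonicalStructure hn hQ j J) ∧
    (∃! T, C.IsTwistorTorsion hn hQ j T) ∧
    ∀ J T, C.IsCanonicalStructure hn hQ j J → C.IsTwistorTorsion hn hQ j T →
      ∀ (z : Q.Twistor ε) (ξ η : ∀ w : Q.Twistor ε, TangentSpace (𝓡 (2 * n + 2)) w),
        ContMDiffAt (𝓡 (2 * n + 2)) (𝓡 (2 * n + 2)).tangent ∞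
          (fun w => (⟨w, ξ w⟩ : TangentBundle (𝓡 (2 * n + 2)) (Q.Twistor ε))) z →
        ContMDiffAt (𝓡 (2 * n + 2)) (𝓡 (2 * n + 2)).tangent ∞
          (fun w => (⟨w, η w⟩ : TangentBundle (𝓡 (2 * n + 2)) (Q.Twistor ε))) z →
        Paraquat.nijenhuis (𝓡 (2 * n + 2)) J ξ η z =
          (if ε = 1 then (4 : ℝ) else -4) •
            Paraquat.zeroTwoPart (-ε) (J z) (T z) (ξ z) (η z) := by
  refine ⟨C.existsUnique_canonicalStructure hn hQ j _hZ, C.existsUnique_twistorTorsion hn hQ j _hZ,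
    fun J T hJ hT z ξ η hξ hη => ?_⟩
  obtain ⟨u, rfl⟩ := C.twistorProj_surjective hn hQ j z
  rw [C.nijenhuis_eq hn hQ j _hZ hJ hT u ξ η hξ hη]
  exact (Paraquat.zeroTwoPart_eq _hε _ _ _ _).symm
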